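/- **Proposition 6.6.** Let $\Omega=(-1,1)^3\ni(x,y,z)$, $G=(-1,1)^2$, $\nabla_H=(\partial_x,\partial_y)^T$, $\operatorname{div}_H=\nabla_H\cdot$, $\Delta_\delta=\partial_x^2+\partial_y^2+\delta\partial_z^2$, and for $T\in(0,\infty)$ put $$\mathbb E_0(T)=L^2(0,T;L^2(\Omega)),\qquad \mathbb E_1(T)=L^2(0,T;H^2_{per}(\Omega))\cap H^1(0,T;L^2(\Omega)),$$ $$\mathbb E_H(T)=L^2(0,T;L^2_zH^2_{xy})\cap H^1(0,T;L^2(\Omega)),\qquad \mathbb E_z(T)=L^2(0,T;H^1_zH^1_{xy})\cap L^\infty(0,T;H^1_zL^2_{xy}),$$ $$\mathbb E_{H,z}(T)=\mathbb E_z(T)\cap\mathbb E_H(T),$$ where $H^r_zH^s_{xy}=H^r(-1,1;H^s_{per}(G))$, the subscript $per$ denotes periodicity in all variables of the domain in question, $H^2$ carries the norm $(\|f\|_{L^2}^2+\sum_i\|\partial_if\|_{L^2}^2+\sum_{i,j}\|\partial_i\partial_jf\|_{L^2}^2)^{1/2}$, and intersections carry the sum of the norms. For a horizontal vector field $v$ put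 $w(v)(x,y,z)=-\int_{-1}^z\operatorname{div}_Hv(x,y,\xi)\,d\xi$. For every $T>0$ there is a constant $C>0$, depending only on $T$, with the following property. Let $\varepsilon\in(0,1]$, $\delta>0$, let $U=(V,W)\in\mathbb E_{H,z}(T)$ with $V=(V_1,V_2)$ even in $z$, $W$ odd in $z$ and $\operatorname{div}_HV+\tfrac1\varepsilon\partial_zW=0$, and let $v=(v_1,v_2)$ be such that, with $w=w(v)$, $u=(v,w)\in\mathbb E_1(T)$. Put $$F_H=-(V,\tfrac1\varepsilon W)\cdot\nabla v-u\cdot\nabla V-(V,\tfrac1\varepsilon W)\cdot\nabla V+\delta\partial_z^2v,$$ $$F_z=-(V,\tfrac1\varepsilon W)\cdot\nabla(\varepsilon w)-u\cdot\nabla W-(V,\tfrac1\varepsilon W)\cdot\nabla W-\varepsilon(\partial_tw-u\cdot\nabla w+\Delta_\delta w).$$ Then $(F_H,F_z)\in\mathbb E_0(T)$ and $$\|(F_H,F_z)\|_{\mathbb E_0(T)}\le C\Big(\|U\|_{\mathbb E_{H,z}(T)}^2+\|U\|_{\mathbb E_{H,z}(T)}\|u\|_{\mathbb E_1(T)}+\varepsilon\big(\|w\|_{\mathbb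 E_1(T)}+\|u\|_{\mathbb E_1(T)}^2\big)\Big)+\delta\|v\|_{\mathbb E_1(T)}.$$ -/

import Mathlib

open MeasureTheory Set
open scoped ENNReal ContDiff

noncomputable section

namespace HydroDiff

/-! ### Space-time domain, test functions, weak derivatives -/

/-- Space-time points `(t, x, y, z)`. -/
abbrev Pt : Type := ℝ × ℝ × ℝ × ℝ

/-- Scalar fields. Only their values almost everywhere on the space-time cylinder matter. -/
abbrev Field : Type := Pt → ℝ

/-- Unit vector of the time direction. -/
def eT : Pt := (1, 0, 0, 0)
/-- Unit vector of the `x`-direction. -/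
def eX : Pt := (0, 1, 0, 0)
/-- Unit vector of the `y`-direction. -/
def eY : Pt := (0, 0, 1, 0)
/-- Unit vector of the `z`-direction. -/
def eZ : Pt := (0, 0, 0, 1)
/-- The horizontal directions. -/
def eH : Fin 2 → Pt := ![eX, eY]
/-- The spatial directions. -/
def eS : Fin 3 → Pt := ![eX, eY, eZ]

/-- The spatial domain `Ω = (-1,1)³`. -/
def Omega : Set (ℝ × ℝ × ℝ) := Ioo (-1) 1 ×ˢ Ioo (-1) 1 ×ˢ Ioo (-1) 1

/-- Lebesgue measure on the space-time cylinder `(0,T) × Ω`. -/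
def mu (T : ℝ) : Measure Pt := volume.restrict (Ioo 0 T ×ˢ Omega)

/-- Smooth functions, compactly supported in time in `(0,T)`, that are `2`-periodic in
`x` and `y`. -/
structure IsHorTest (T : ℝ) (φ : Field) : Prop where
  smooth : ContDiff ℝ ∞ φ
  supp_time : ∃ a b : ℝ, 0 < a ∧ b < T ∧ ∀ t x y z, t ∉ Icc a b → φ (t, x, y, z) = 0
  per_x : ∀ t x y z, φ (t, x + 2, y, z) = φ (t, x, y, z)
  per_y : ∀ t x y z, φ (t, x, y + 2, z) = φ (t, x, y, z)

/-- Test functions that are moreover compactly supported in `(-1,1)` with respect to `z`. They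
define the spaces of functions of `z ∈ (-1,1)` with values in spaces of functions that are
periodic in `(x,y)`; no condition at `z = ± 1` results. -/
def zInterior (T : ℝ) : Set Field :=
  {φ | IsHorTest T φ ∧ ∃ r : ℝ, r < 1 ∧ ∀ t x y z, r < |z| → φ (t, x, y, z) = 0}

/-- Test functions that are moreover `2`-periodic in `z`. They define the spaces of functions
that are periodic in all of `x, y, z`. -/
def zPeriodic (T : ℝ) : Set Field :=
  {φ | IsHorTest T φ ∧ ∀ t x y z, φ (t, x, y, z + 2) = φ (t, x, y, z)}

/-- `g ∈ L²` is the weak derivative of `u ∈ L²` in direction `d`, with respect to a class `𝒟` of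
test functions. -/
def HasWeakDeriv (T : ℝ) (𝒟 : Set Field) (d : Pt) (u g : Field) : Prop :=
  MemLp u 2 (mu T) ∧ MemLp g 2 (mu T) ∧
    ∀ φ ∈ 𝒟, ∫ p, u p * fderiv ℝ φ p d ∂(mu T) = - ∫ p, g p * φ p ∂(mu T)

open Classical in
/-- The weak derivative in direction `d` on the space-time cylinder (unique almost everywhere if
it exists in `L²`; zero by convention otherwise). -/
def D (T : ℝ) (d : Pt) (u : Field) : Field :=
  if h : ∃ g, HasWeakDeriv T (zInterior T) d u g then h.choose else 0

/-- `u` has a weak derivative in `L²` in direction `d`. -/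
def Diffble (T : ℝ) (d : Pt) (u : Field) : Prop :=
  HasWeakDeriv T (zInterior T) d u (D T d u)

/-- `u` has a weak derivative in `L²` in direction `d` as a function that is periodic in
`x, y, z`. -/
def PerDiffble (T : ℝ) (d : Pt) (u : Field) : Prop :=
  Diffble T d u ∧ HasWeakDeriv T (zPeriodic T) d u (D T d u)

/-! ### Function spaces -/

/-- `L²(0,T; L²(Ω))`. -/
def MemE0 (T : ℝ) (u : Field) : Prop := MemLp u 2 (mu T)

/-- `L²(0,T; H²_per(Ω)) ∩ H¹(0,T; L²(Ω))`. -/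
structure MemE1 (T : ℝ) (u : Field) : Prop where
  memLp : MemLp u 2 (mu T)
  time : Diffble T eT u
  first : ∀ i, PerDiffble T (eS i) u
  second : ∀ i j, PerDiffble T (eS j) (D T (eS i) u)

/-- `L²(0,T; L²_z H²_xy) ∩ H¹(0,T; L²(Ω))`. -/
structure MemEH (T : ℝ) (u : Field) : Prop where
  memLp : MemLp u 2 (mu T)
  time : Diffble T eT u
  first : ∀ i, Diffble T (eH i) u
  second : ∀ i j, Diffble T (eH j) (D T (eH i) u)

variable {ι : Type} [Fintype ι]

/-- Square of the `L²` norm on the space-time cylinder. -/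
def sq (T : ℝ) (u : Field) : ℝ≥0∞ := eLpNorm u 2 (mu T) ^ 2

/-- Norm of a vector field in `L²(0,T; L²(Ω))`. -/
def normE0 (T : ℝ) (u : ι → Field) : ℝ≥0∞ :=
  (∑ k, sq T (u k)) ^ (1 / 2 : ℝ)

/-- Norm of a vector field in `H¹(0,T; L²(Ω))`. -/
def normH1L2 (T : ℝ) (u : ι → Field) : ℝ≥0∞ :=
  (∑ k, (sq T (u k) + sq T (D T eT (u k)))) ^ (1 / 2 : ℝ)

/-- Norm of a vector field in `L²(0,T; H²(Ω))`. -/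
def normL2H2 (T : ℝ) (u : ι → Field) : ℝ≥0∞ :=
  (∑ k, (sq T (u k) + ∑ i, sq T (D T (eS i) (u k)) +
    ∑ i, ∑ j, sq T (D T (eS j) (D T (eS i) (u k))))) ^ (1 / 2 : ℝ)

/-- Norm of a vector field in `L²(0,T; L²_z H²_xy)`. -/
def normL2L2zH2xy (T : ℝ) (u : ι → Field) : ℝ≥0∞ :=
  (∑ k, (sq T (u k) + ∑ i, sq T (D T (eH i) (u k)) +
    ∑ i, ∑ j, sq T (D T (eH j) (D T (eH i) (u k))))) ^ (1 / 2 : ℝ)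

/-- Norm of a vector field in `L²(0,T; H¹_z H¹_xy)`. -/
def normL2H1zH1xy (T : ℝ) (u : ι → Field) : ℝ≥0∞ :=
  (∑ k, (sq T (u k) + ∑ i, sq T (D T (eH i) (u k)) +
    (sq T (D T eZ (u k)) + ∑ i, sq T (D T (eH i) (D T eZ (u k)))))) ^ (1 / 2 : ℝ)

/-- Norm of a vector field in `L^∞(0,T; H¹_z L²_xy)`. -/
def normLinftyH1zL2xy (T : ℝ) (u : ι → Field) : ℝ≥0∞ :=
  essSup (fun t : ℝ =>
    (∑ k, (eLpNorm (fun q : ℝ × ℝ × ℝ => u k (t, q)) 2 (volume.restrict Omega) ^ 2 +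
      eLpNorm (fun q : ℝ × ℝ × ℝ => D T eZ (u k) (t, q)) 2 (volume.restrict Omega) ^ 2)) ^
        (1 / 2 : ℝ))
    (volume.restrict (Ioo 0 T))

/-- Norm of `𝔼₁(T)`. -/
def normE1 (T : ℝ) (u : ι → Field) : ℝ≥0∞ := normL2H2 T u + normH1L2 T u

/-- Norm of `𝔼_H(T)`. -/
def normEH (T : ℝ) (u : ι → Field) : ℝ≥0∞ := normL2L2zH2xy T u + normH1L2 T u

/-- Norm of `𝔼_z(T)`. -/
def normEz (T : ℝ) (u : ι → Field) : ℝ≥0∞ := normL2H1zH1xy T u + normLinftyH1zL2xy T u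

/-- Norm of `𝔼_{H,z}(T) = 𝔼_z(T) ∩ 𝔼_H(T)`. -/
def normEHz (T : ℝ) (u : ι → Field) : ℝ≥0∞ := normEz T u + normEH T u

/-- `L²(0,T; H¹_z H¹_xy) ∩ L^∞(0,T; H¹_z L²_xy)`, where `H¹_z = H¹(-1,1)` carries no boundary
condition. -/
structure MemEz (T : ℝ) (u : Field) : Prop where
  memLp : MemLp u 2 (mu T)
  hor : ∀ i, Diffble T (eH i) u
  vert : Diffble T eZ u
  mixed : ∀ i, Diffble T (eH i) (D T eZ u)
  bounded : normLinftyH1zL2xy T ![u] < ⊤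

/-- `𝔼_{H,z}(T) = 𝔼_z(T) ∩ 𝔼_H(T)`. -/
def MemEHz (T : ℝ) (u : Field) : Prop := MemEz T u ∧ MemEH T u

/-! ### The right-hand sides of the difference equations -/

/-- The vector field `(v, w)` with horizontal part `v` and vertical part `w`. -/
def vec (v : Fin 2 → Field) (w : Field) : Fin 3 → Field := ![v 0, v 1, w]

/-- Horizontal divergence. -/
def divH (T : ℝ) (v : Fin 2 → Field) : Field := fun p => D T eX (v 0) p + D T eY (v 1) p

/-- The vertical velocity `w(v)(x,y,z) = - ∫_{-1}^z div_H v (x,y,ξ) dξ`. -/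
def vertVel (T : ℝ) (v : Fin 2 → Field) : Field :=
  fun p => - ∫ ξ in (-1 : ℝ)..p.2.2.2, divH T v (p.1, p.2.1, p.2.2.1, ξ)

/-- Advection `a · ∇ f`. -/
def adv (T : ℝ) (a : Fin 3 → Field) (f : Field) : Field :=
  fun p => ∑ i, a i p * D T (eS i) f p

/-- The anisotropic Laplacian `Δ_δ = ∂_x² + ∂_y² + δ ∂_z²`. -/
def lapl (T δ : ℝ) (f : Field) : Field := fun p =>
  D T eX (D T eX f) p + D T eY (D T eY f) p + δ * D T eZ (D T eZ f) p

/-- `(V, W / ε)`. -/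
def scaled (ε : ℝ) (V : Fin 2 → Field) (W : Field) : Fin 3 → Field :=
  vec V (fun p => ε⁻¹ * W p)

/-- The horizontal right-hand side `F_H(V, W)`, for the limit velocity `u = (v, w(v))`. -/
def FH (T ε δ : ℝ) (v V : Fin 2 → Field) (W : Field) : Fin 2 → Field := fun k p =>
  - adv T (scaled ε V W) (v k) p
  - adv T (vec v (vertVel T v)) (V k) p
  - adv T (scaled ε V W) (V k) p
  + δ * D T eZ (D T eZ (v k)) p

/-- The vertical right-hand side `F_z(V, W)`, for the limit velocity `u = (v, w(v))`. -/
def Fz (T ε δ : ℝ) (v V : Fin 2 → Field) (W : Field) : Field := fun p =>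
  - adv T (scaled ε V W) (fun q => ε * vertVel T v q) p
  - adv T (vec v (vertVel T v)) W p
  - adv T (scaled ε V W) W p
  - ε * (D T eT (vertVel T v) p - adv T (vec v (vertVel T v)) (vertVel T v) p
      + lapl T δ (vertVel T v) p)

/-- `f` is even in `z`. -/
def EvenZ (T : ℝ) (f : Field) : Prop :=
  ∀ᵐ p ∂(mu T), f (p.1, p.2.1, p.2.2.1, -p.2.2.2) = f p

/-- `f` is odd in `z`. -/
def OddZ (T : ℝ) (f : Field) : Prop :=
  ∀ᵐ p ∂(mu T), f (p.1, p.2.1, p.2.2.1, -p.2.2.2) = - f p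

/-- The scaled divergence condition `div_H V + ε⁻¹ ∂_z W = 0`. -/
def DivEpsFree (T ε : ℝ) (V : Fin 2 → Field) (W : Field) : Prop :=
  ∀ᵐ p ∂(mu T), divH T V p + ε⁻¹ * D T eZ W p = 0

end HydroDiff

end

open HydroDiff

/-! Apart from linear terms, the right-hand sides consist of products `a i * ∂_i f`, where `a` is
`(V, W/ε)` or `u` and `f` is a component of `U` or `u`, up to a factor `ε`. Such a product is put in
`L²` by Hölder's inequality with `a ∈ L⁴_t L⁴_xy L^∞_z` and `∂_i f ∈ L⁴_t L⁴_xy L²_z` (`sq_mul_le`).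
The predicates `Advects` and `Controlled` record these two properties, and `eLpNorm_adv_le` combines
them.

Membership in `L⁴_t L⁴_xy L²_z` is an anisotropic Ladyzhenskaya inequality (`aniso_le`): boundedness
in time with values in `L²`, together with `L²` bounds of the function and its horizontal
derivatives, suffices. Boundedness in time has three sources: the space `H¹(0,T; L²)` for the
components of `u`; the definition of `𝔼_z` for `U` and `∂_z U`; and, for the remaining first
derivatives, a parabolic embedding in a single periodic direction (`ae_lintegral_sq_le_of_perPrim`).
The last one rests on the identity `‖∂f(t)‖² - ‖∂f(s)‖² = -⟨f(t) - f(s), ∂²f(t) + ∂²f(s)⟩`, which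
needs no time derivative of `∂f`.

Boundedness in `z` follows from `H¹_z ⊂ L^∞_z`, except for `W/ε`, where that would cost a power of
`ε`. There `∂_z W/ε = -div_H V`, and `W` has mean zero on vertical lines because it is odd, so `W/ε`
is bounded by the vertical integral of `|div_H V|`, uniformly in `ε` (`advects_inv_mul`).

The `δ`-terms carry the constant one. Since `∂_z w = -div_H v`, the square of `∂_z² w` is at most
twice a sum of squares of mixed derivatives of `v`, and the `H²` norm counts every mixed derivative
twice (`normE0_vert_le`).

All one-dimensional arguments take place on lines. Testing with products of one-variable functions
shows that a function with a weak derivative is, on almost every line, a primitive of it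
(`ae_prim`). In periodic directions the derivative also has mean zero, so boundary terms cancel. -/

noncomputable section

namespace HydroDiff

/-! ### Functions on an interval that are primitives of integrable functions -/

/-- On `(α, β)`, the function `u` agrees almost everywhere with a primitive of the integrable
function `g`. -/
structure Prim (α β : ℝ) (u g : ℝ → ℝ) : Prop where
  integrableOn : IntegrableOn g (Ioo α β)
  exists_const : ∃ c, ∀ᵐ s ∂(volume.restrict (Ioo α β)), u s = c + ∫ σ in α..s, g σ

lemma intervalIntegrable_of_Ioo {α β : ℝ} (h : α ≤ β) {g : ℝ → ℝ}
    (hg : IntegrableOn g (Ioo α β)) : IntervalIntegrable g volume α β := by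
  rw [intervalIntegrable_iff_integrableOn_Ioo_of_le h]; exact hg

lemma setIntegral_Ioo_eq_intervalIntegral {α β : ℝ} (h : α ≤ β) (g : ℝ → ℝ) :
    ∫ s in Ioo α β, g s = ∫ s in α..β, g s := by
  rw [intervalIntegral.integral_of_le h, integral_Ioc_eq_integral_Ioo]

/-- Integration by parts for explicit primitives. -/
lemma integral_primitive_mul_add {α β : ℝ} (h : α ≤ β) {g₁ g₂ : ℝ → ℝ} (c₁ c₂ : ℝ)
    (h₁ : IntegrableOn g₁ (Ioo α β)) (h₂ : IntegrableOn g₂ (Ioo α β)) {s r : ℝ}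
    (hs : s ∈ Icc α β) (hr : r ∈ Icc α β) :
    ∫ x in r..s, (g₁ x * (c₂ + ∫ σ in α..x, g₂ σ) + (c₁ + ∫ σ in α..x, g₁ σ) * g₂ x) =
      (c₁ + ∫ σ in α..s, g₁ σ) * (c₂ + ∫ σ in α..s, g₂ σ)
        - (c₁ + ∫ σ in α..r, g₁ σ) * (c₂ + ∫ σ in α..r, g₂ σ) := by
  have i₁ := intervalIntegrable_of_Ioo h h₁
  have i₂ := intervalIntegrable_of_Ioo h h₂
  have hsub : uIcc r s ⊆ uIcc α β := by
    rw [uIcc_of_le h]; exact ordConnected_Icc.uIcc_subset hr hs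
  have key : ∀ {g : ℝ → ℝ} (c : ℝ), IntervalIntegrable g volume α β →
      AbsolutelyContinuousOnInterval (fun x => c + ∫ σ in α..x, g σ) r s ∧
      ∀ᵐ x, x ∈ uIcc r s → HasDerivAt (fun x => c + ∫ σ in α..x, g σ) (g x) x := by
    intro g c hg
    refine ⟨((LipschitzOnWith.absolutelyContinuousOnInterval (K := 0)
      (LipschitzWith.const c).lipschitzOnWith).add
      (hg.absolutelyContinuousOnInterval_intervalIntegral left_mem_uIcc)).mono hsub, ?_⟩
    filter_upwards [hg.ae_hasDerivAt_integral] with x hx hxs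
    exact (hx (hsub hxs) α left_mem_uIcc).const_add c
  obtain ⟨a₁, d₁⟩ := key c₁ i₁
  obtain ⟨a₂, d₂⟩ := key c₂ i₂
  rw [← a₁.integral_deriv_mul_eq_sub a₂]
  apply intervalIntegral.integral_congr_ae
  filter_upwards [d₁, d₂] with x hx₁ hx₂ hx
  rw [(hx₁ (uIoc_subset_uIcc hx)).deriv, (hx₂ (uIoc_subset_uIcc hx)).deriv]

lemma continuousOn_primitive_add {α β : ℝ} (h : α ≤ β) {g : ℝ → ℝ} (c : ℝ)
    (hg : IntegrableOn g (Ioo α β)) :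
    ContinuousOn (fun x => c + ∫ σ in α..x, g σ) (Icc α β) := by
  have := intervalIntegral.continuousOn_primitive_interval' (intervalIntegrable_of_Ioo h hg)
    (left_mem_uIcc)
  rw [uIcc_of_le h] at this
  exact continuousOn_const.add this

lemma integrableOn_mul_primitive {α β : ℝ} (h : α ≤ β) {g f : ℝ → ℝ} (c : ℝ)
    (hg : IntegrableOn g (Ioo α β)) (hf : IntegrableOn f (Ioo α β)) :
    IntegrableOn (fun x => f x * (c + ∫ σ in α..x, g σ)) (Ioo α β) := by
  rw [← integrableOn_Icc_iff_integrableOn_Ioo] at *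
  rw [integrableOn_Icc_iff_integrableOn_Ioo] at hg
  exact hf.mul_continuousOn (continuousOn_primitive_add h c hg) isCompact_Icc

/-- Integration by parts for primitives. -/
lemma Prim.integral_mul_add {α β : ℝ} (h : α ≤ β) {u₁ u₂ g₁ g₂ : ℝ → ℝ}
    (h₁ : Prim α β u₁ g₁) (h₂ : Prim α β u₂ g₂) :
    ∃ c₁ c₂ : ℝ, (∀ᵐ s ∂(volume.restrict (Ioo α β)), u₁ s = c₁ + ∫ σ in α..s, g₁ σ) ∧
      (∀ᵐ s ∂(volume.restrict (Ioo α β)), u₂ s = c₂ + ∫ σ in α..s, g₂ σ) ∧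
      (∫ s in Ioo α β, g₁ s * u₂ s) + (∫ s in Ioo α β, u₁ s * g₂ s) =
      (c₁ + ∫ s in Ioo α β, g₁ s) * (c₂ + ∫ s in Ioo α β, g₂ s) - c₁ * c₂ := by
  obtain ⟨c₁, e₁⟩ := h₁.exists_const
  obtain ⟨c₂, e₂⟩ := h₂.exists_const
  refine ⟨c₁, c₂, e₁, e₂, ?_⟩
  have := integral_primitive_mul_add h c₁ c₂ h₁.integrableOn h₂.integrableOn
    (right_mem_Icc.2 h) (left_mem_Icc.2 h)
  rw [← setIntegral_Ioo_eq_intervalIntegral h, ← setIntegral_Ioo_eq_intervalIntegral h,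
    ← setIntegral_Ioo_eq_intervalIntegral h] at this
  simp only [intervalIntegral.integral_same, add_zero] at this
  rw [← this, integral_add (integrableOn_mul_primitive h _ h₂.integrableOn h₁.integrableOn)
    ((integrableOn_mul_primitive h c₁ h₁.integrableOn h₂.integrableOn).congr
      (ae_of_all _ fun s => mul_comm _ _))]
  congr 1
  · apply integral_congr_ae; filter_upwards [e₂] with s hs; rw [hs]
  · apply integral_congr_ae; filter_upwards [e₁] with s hs; rw [hs]

/-- Integration by parts for periodic primitives. -/
lemma Prim.integral_mul_eq_neg {α β : ℝ} (h : α ≤ β) {u₁ u₂ g₁ g₂ : ℝ → ℝ}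
    (h₁ : Prim α β u₁ g₁) (h₂ : Prim α β u₂ g₂)
    (p₁ : ∫ s in Ioo α β, g₁ s = 0) (p₂ : ∫ s in Ioo α β, g₂ s = 0) :
    ∫ s in Ioo α β, g₁ s * u₂ s = - ∫ s in Ioo α β, u₁ s * g₂ s := by
  obtain ⟨c₁, c₂, -, -, e⟩ := h₁.integral_mul_add h h₂
  rw [p₁, p₂] at e; linarith

/-- A single exceptional set serves all pairs of points, so the formula can be used at `τ` and `τ +
h` simultaneously. -/
lemma Prim.sub_eq {α β : ℝ} (h : α ≤ β) {u g : ℝ → ℝ} (hu : Prim α β u g) :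
    ∃ E : Set ℝ, (∀ᵐ s ∂(volume.restrict (Ioo α β)), s ∈ E) ∧ ∀ s ∈ E, ∀ r ∈ E,
      s ∈ Ioo α β → r ∈ Ioo α β → u s - u r = ∫ σ in r..s, g σ := by
  obtain ⟨c, hc⟩ := hu.exists_const
  refine ⟨{s | u s = c + ∫ σ in α..s, g σ}, hc, fun s hs r hr hsi hri => ?_⟩
  rw [mem_ofPred_eq] at hs hr
  have i := intervalIntegrable_of_Ioo h hu.integrableOn
  have i₁ : ∀ x ∈ Ioo α β, IntervalIntegrable g volume α x := fun x hx =>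
    i.mono_set (by rw [uIcc_of_le h, uIcc_of_le hx.1.le]; exact Icc_subset_Icc_right hx.2.le)
  rw [hs, hr, add_sub_add_left_eq_sub,
    intervalIntegral.integral_interval_sub_left (i₁ s hsi) (i₁ r hri)]

/-- A primitive is bounded by its mean and the total variation, in squared form. -/
lemma Prim.sq_le {α β : ℝ} (h : α < β) {u g : ℝ → ℝ} (hu : Prim α β u g) :
    ∀ᵐ s ∂(volume.restrict (Ioo α β)), ‖u s‖ₑ ^ 2 ≤
      ∫⁻ r in Ioo α β, (ENNReal.ofReal (β - α)⁻¹ * ‖u r‖ₑ ^ 2 + 2 * ‖u r‖ₑ * ‖g r‖ₑ) := by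
  obtain ⟨c, hc⟩ := hu.exists_const
  have hg := hu.integrableOn
  set U : ℝ → ℝ := fun x => c + ∫ σ in α..x, g σ with hU
  have hUc : ContinuousOn U (Icc α β) := continuousOn_primitive_add h.le c hg
  have hgU : IntegrableOn (fun x => g x * U x) (Ioo α β) :=
    integrableOn_mul_primitive h.le c hg hg
  have hU2 : IntegrableOn (fun x => U x ^ 2) (Ioo α β) :=
    ((hUc.pow 2).integrableOn_Icc).mono_set Ioo_subset_Icc_self
  have hfin : IntegrableOn (fun r => (β - α)⁻¹ * U r ^ 2 + 2 * |U r| * |g r|) (Ioo α β) := by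
    refine (hU2.const_mul _).add ?_
    refine (hgU.abs.const_mul 2).congr (ae_of_all _ fun x => ?_)
    simp only [abs_mul]; ring
  have hpos : 0 < β - α := sub_pos.2 h
  have main : ∀ s ∈ Ioo α β, U s ^ 2 ≤
      ∫ r in Ioo α β, ((β - α)⁻¹ * U r ^ 2 + 2 * |U r| * |g r|) := by
    intro s hs
    -- The fundamental theorem for `U ^ 2` between `r` and `s`; averaging over `r` then produces the
    -- factor `(β - α)⁻¹`.
    have step : ∀ r ∈ Ioo α β, U s ^ 2 ≤ U r ^ 2 + ∫ x in Ioo α β, 2 * |U x| * |g x| := by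
      intro r hr
      have e := integral_primitive_mul_add h.le c c hg hg (Ioo_subset_Icc_self hs)
        (Ioo_subset_Icc_self hr)
      have b : ‖∫ x in r..s, (g x * U x + U x * g x)‖ ≤ ∫ x in Ioo α β, 2 * |U x| * |g x| := by
        refine (intervalIntegral.norm_integral_le_integral_norm_uIoc).trans ?_
        have sub : uIoc r s ⊆ Ioo α β := by
          intro x hx
          rw [mem_uIoc] at hx
          rcases hx with hx | hx
          · exact ⟨hr.1.trans hx.1, hx.2.trans_lt hs.2⟩
          · exact ⟨hs.1.trans hx.1, hx.2.trans_lt hr.2⟩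
        have : ∀ x, ‖g x * U x + U x * g x‖ = 2 * |U x| * |g x| := by
          intro x
          rw [show g x * U x + U x * g x = 2 * (U x * g x) by ring, norm_mul, norm_mul]
          simp [mul_assoc]
        simp only [this]
        refine setIntegral_mono_set ?_ (ae_of_all _ fun x => by positivity)
          (LE.le.eventuallyLE sub)
        refine (hgU.abs.const_mul 2).congr (ae_of_all _ fun x => ?_)
        simp only [abs_mul]; ring
      rw [Real.norm_eq_abs] at b
      have := (le_abs_self _).trans b
      rw [e] at this
      simp only [hU] at this ⊢
      nlinarith
    have hi2 : IntegrableOn (fun x => 2 * |U x| * |g x|) (Ioo α β) := by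
      refine (hgU.abs.const_mul 2).congr (ae_of_all _ fun x => ?_)
      simp only [abs_mul]; ring
    have av := setIntegral_mono_on (f := fun _ => U s ^ 2) (by simp) (hU2.add
      (integrable_const (μ := volume.restrict (Ioo α β)) (∫ x in Ioo α β, 2 * |U x| * |g x|)))
      measurableSet_Ioo step
    simp only [Pi.add_apply] at av
    rw [integral_add hU2 (integrable_const _), setIntegral_const, setIntegral_const] at av
    simp only [measureReal_def, Real.volume_Ioo, ENNReal.toReal_ofReal hpos.le, smul_eq_mul] at av
    rw [integral_add (hU2.const_mul _) hi2, integral_const_mul]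
    rw [← mul_le_mul_iff_right₀ hpos, mul_add, ← mul_assoc, mul_inv_cancel₀ hpos.ne', one_mul]
    exact av
  filter_upwards [hc, ae_restrict_mem measurableSet_Ioo] with s hs hsi
  have : ∫⁻ r in Ioo α β, (ENNReal.ofReal (β - α)⁻¹ * ‖u r‖ₑ ^ 2 + 2 * ‖u r‖ₑ * ‖g r‖ₑ) =
      ENNReal.ofReal (∫ r in Ioo α β, ((β - α)⁻¹ * U r ^ 2 + 2 * |U r| * |g r|)) := by
    rw [ofReal_integral_eq_lintegral_ofReal hfin (ae_of_all _ fun x => by positivity)]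
    apply lintegral_congr_ae
    filter_upwards [hc] with r hr
    rw [hr, ENNReal.ofReal_add (by positivity) (by positivity), ENNReal.ofReal_mul (by positivity),
      ENNReal.ofReal_mul (by positivity), ENNReal.ofReal_mul (by positivity),
      Real.enorm_eq_ofReal_abs, Real.enorm_eq_ofReal_abs, ← ENNReal.ofReal_pow (abs_nonneg _),
      sq_abs]
    simp [hU]
  rw [this, hs, Real.enorm_eq_ofReal_abs, ← ENNReal.ofReal_pow (abs_nonneg _), sq_abs]
  exact ENNReal.ofReal_le_ofReal (main s hsi)

/-- A primitive of mean zero is bounded by the total variation. -/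
lemma Prim.enorm_le {α β : ℝ} (h : α < β) {u g : ℝ → ℝ} (hu : Prim α β u g)
    (h0 : ∫ s in Ioo α β, u s = 0) :
    ∀ᵐ s ∂(volume.restrict (Ioo α β)), ‖u s‖ₑ ≤ ∫⁻ r in Ioo α β, ‖g r‖ₑ := by
  obtain ⟨c, hc⟩ := hu.exists_const
  obtain ⟨E, hE, hEE⟩ := hu.sub_eq h.le
  have hg := hu.integrableOn
  have hpos : 0 < β - α := sub_pos.2 h
  have hui : IntegrableOn u (Ioo α β) :=
    (((continuousOn_primitive_add h.le c hg).integrableOn_Icc).mono_set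
      Ioo_subset_Icc_self).congr (by filter_upwards [hc] with s hs; exact hs.symm)
  filter_upwards [hE, ae_restrict_mem measurableSet_Ioo] with s hs hsi
  -- By the mean-zero condition `u s` is the average of the increments `u s - u r`, each bounded by
  -- the total variation.
  have e : (β - α) * u s = ∫ r in Ioo α β, (u s - u r) := by
    rw [integral_sub (integrable_const _) hui, h0, setIntegral_const]
    simp [measureReal_def, ENNReal.toReal_ofReal hpos.le]
  have b : ‖∫ r in Ioo α β, (u s - u r)‖ ≤ (∫ x in Ioo α β, ‖g x‖) * (β - α) := by
    have := norm_setIntegral_le_of_norm_le_const_ae (μ := volume) (s := Ioo α β)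
      (f := fun r => u s - u r) (C := ∫ x in Ioo α β, ‖g x‖) (by simp) ?_
    · simpa [measureReal_def, ENNReal.toReal_ofReal hpos.le] using this
    · filter_upwards [hE, ae_restrict_mem measurableSet_Ioo] with r hr hri
      rw [hEE s hs r hr hsi hri]
      refine (intervalIntegral.norm_integral_le_integral_norm_uIoc).trans ?_
      refine setIntegral_mono_set hg.norm (ae_of_all _ fun x => norm_nonneg _)
          (LE.le.eventuallyLE ?_)
      intro x hx
      rw [mem_uIoc] at hx
      rcases hx with hx | hx
      · exact ⟨hri.1.trans hx.1, hx.2.trans_lt hsi.2⟩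
      · exact ⟨hsi.1.trans hx.1, hx.2.trans_lt hri.2⟩
  rw [← e, norm_mul, Real.norm_of_nonneg hpos.le, mul_comm] at b
  have b' := le_of_mul_le_mul_right b hpos
  rw [← ofReal_integral_norm_eq_lintegral_enorm hg, ← ofReal_norm]
  exact ENNReal.ofReal_le_ofReal b'

/-! ### Separating classes of test functions -/

/-- A class of bounded measurable functions that separates integrable functions. -/
structure Separates {X : Type*} [MeasurableSpace X] (𝒞 : Set (X → ℝ)) (μ : Measure X) : Prop where
  measurable : ∀ φ ∈ 𝒞, Measurable φ
  bounded : ∀ φ ∈ 𝒞, ∃ K, ∀ x, |φ x| ≤ K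
  eq_zero : ∀ F, Integrable F μ → (∀ φ ∈ 𝒞, ∫ x, F x * φ x ∂μ = 0) → F =ᵐ[μ] 0

/-- Products of test functions in two groups of variables. -/
def prodTests {X Y : Type*} (𝒞 : Set (X → ℝ)) (𝒟 : Set (Y → ℝ)) : Set (X × Y → ℝ) :=
  {φ | ∃ a ∈ 𝒞, ∃ b ∈ 𝒟, φ = fun p => a p.1 * b p.2}

/-- An integrable function whose integrals over measurable rectangles vanish is zero. -/
lemma ae_eq_zero_of_rectangles {X Y : Type*} [MeasurableSpace X] [MeasurableSpace Y]
    {μ : Measure X} {ν : Measure Y} [IsFiniteMeasure μ] [IsFiniteMeasure ν] {F : X × Y → ℝ}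
    (hF : Integrable F (μ.prod ν))
    (h : ∀ A B, MeasurableSet A → MeasurableSet B → ∫ p in A ×ˢ B, F p ∂(μ.prod ν) = 0) :
    F =ᵐ[μ.prod ν] 0 := by
  refine hF.ae_eq_zero_of_forall_setIntegral_eq_zero fun s hs _ => ?_
  induction s, hs using MeasurableSpace.induction_on_inter generateFrom_prod.symm
    isPiSystem_prod with
  | empty => simp
  | basic t ht =>
    obtain ⟨A, hA, B, hB, rfl⟩ := ht
    exact h A B hA hB
  | compl t ht ih =>
    have huniv := h univ univ MeasurableSet.univ MeasurableSet.univ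
    rw [univ_prod_univ, setIntegral_univ] at huniv
    rw [setIntegral_compl ht hF, huniv, ih (measure_lt_top _ _), sub_zero]
  | iUnion f hd hm ih =>
    rw [integral_iUnion hm hd hF.integrableOn]
    simp [fun i => ih i (measure_lt_top _ _)]

lemma Separates.integrable_mul {X : Type*} [MeasurableSpace X] {𝒞 : Set (X → ℝ)} {μ : Measure X}
    (h : Separates 𝒞 μ) {φ : X → ℝ} (hφ : φ ∈ 𝒞) {F : X → ℝ} (hF : Integrable F μ) :
    Integrable (fun x => F x * φ x) μ := by
  obtain ⟨K, hK⟩ := h.bounded φ hφ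
  exact hF.mul_bdd (c := K) (h.measurable φ hφ).aestronglyMeasurable (ae_of_all _ hK)

/-- For fixed `b`, testing in the first variable gives `∫ F b dy = 0` for almost every `x`. The
exceptional set depends on `b`, so one integrates over `A` before letting `b` vary; testing in the
second variable then gives `∫_A F dx = 0` for almost every `y`, and rectangles suffice. -/
lemma Separates.prod {X Y : Type*} [MeasurableSpace X] [MeasurableSpace Y]
    {μ : Measure X} {ν : Measure Y} [IsFiniteMeasure μ] [IsFiniteMeasure ν]
    {𝒞 : Set (X → ℝ)} {𝒟 : Set (Y → ℝ)} (h𝒞 : Separates 𝒞 μ) (h𝒟 : Separates 𝒟 ν) :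
    Separates (prodTests 𝒞 𝒟) (μ.prod ν) where
  measurable := by
    rintro _ ⟨a, ha, b, hb, rfl⟩
    exact ((h𝒞.measurable a ha).comp measurable_fst).mul ((h𝒟.measurable b hb).comp measurable_snd)
  bounded := by
    rintro _ ⟨a, ha, b, hb, rfl⟩
    obtain ⟨K, hK⟩ := h𝒞.bounded a ha
    obtain ⟨L, hL⟩ := h𝒟.bounded b hb
    refine ⟨K * L, fun p => ?_⟩
    rw [abs_mul]
    exact mul_le_mul (hK _) (hL _) (abs_nonneg _) ((abs_nonneg _).trans (hK p.1))
  eq_zero := by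
    intro F hF h
    have bddX : ∀ b ∈ 𝒟, Integrable (fun p : X × Y => F p * b p.2) (μ.prod ν) := by
      intro b hb
      obtain ⟨K, hK⟩ := h𝒟.bounded b hb
      exact hF.mul_bdd (c := K)
        ((h𝒟.measurable b hb).comp measurable_snd).aestronglyMeasurable (ae_of_all _ fun p => hK _)
    refine ae_eq_zero_of_rectangles hF fun A B hA hB => ?_
    have step : ∀ b ∈ 𝒟, (fun x => ∫ y, F (x, y) * b y ∂ν) =ᵐ[μ] 0 := by
      intro b hb
      refine h𝒞.eq_zero _ (bddX b hb).integral_prod_left fun a ha => ?_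
      obtain ⟨K, hK⟩ := h𝒞.bounded a ha
      have hi : Integrable (fun p : X × Y => F p * (a p.1 * b p.2)) (μ.prod ν) := by
        have := (bddX b hb).mul_bdd (c := K) (g := fun p : X × Y => a p.1)
          ((h𝒞.measurable a ha).comp measurable_fst).aestronglyMeasurable
          (ae_of_all _ fun p => hK _)
        exact this.congr (ae_of_all _ fun p => by ring)
      have := h _ ⟨a, ha, b, hb, rfl⟩
      rw [integral_prod _ hi] at this
      rw [← this]
      congr 1; ext x
      rw [← integral_mul_const]
      congr 1; ext y; ring
    have hFA : Integrable F ((μ.restrict A).prod ν) := by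
      rw [← Measure.restrict_univ (μ := ν), Measure.prod_restrict]
      exact hF.integrableOn
    have step2 : (fun y => ∫ x in A, F (x, y) ∂μ) =ᵐ[ν] 0 := by
      refine h𝒟.eq_zero _ hFA.integral_prod_right fun b hb => ?_
      have hi : Integrable (fun p : X × Y => F p * b p.2) ((μ.restrict A).prod ν) := by
        rw [← Measure.restrict_univ (μ := ν), Measure.prod_restrict]
        exact (bddX b hb).integrableOn
      have e1 := integral_prod_symm _ hi
      have e2 := integral_prod _ hi
      have : ∫ x in A, ∫ y, F (x, y) * b y ∂ν ∂μ = 0 := by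
        rw [← integral_zero X ℝ (μ := μ.restrict A)]
        exact integral_congr_ae (ae_restrict_of_ae (step b hb))
      rw [← e2, e1] at this
      rw [← this]
      congr 1; ext y
      rw [← integral_mul_const]
    rw [← Measure.prod_restrict]
    have hFAB : Integrable F ((μ.restrict A).prod (ν.restrict B)) := by
      rw [Measure.prod_restrict]; exact hF.integrableOn
    rw [integral_prod_symm _ hFAB, ← integral_zero Y ℝ (μ := ν.restrict B)]
    exact integral_congr_ae (ae_restrict_of_ae step2)

/-! ### Test functions of one variable -/

/-- Smooth functions with compact support in `(α, β)`. -/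
def bumps (α β : ℝ) : Set (ℝ → ℝ) :=
  {φ | ContDiff ℝ ∞ φ ∧ ∃ a b, α < a ∧ b < β ∧ ∀ t, t ∉ Icc a b → φ t = 0}

/-- Smooth `2`-periodic functions. -/
def perTests : Set (ℝ → ℝ) := {φ | ContDiff ℝ ∞ φ ∧ ∀ t, φ (t + 2) = φ t}

/-- A class of bounded smooth functions that contains an extension of the restriction to `(α, β)`
of each smooth function with compact support in `(α, β)`. -/
structure TestClass (𝒞 : Set (ℝ → ℝ)) (α β : ℝ) : Prop where
  smooth : ∀ φ ∈ 𝒞, ContDiff ℝ ∞ φ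
  bounded : ∀ φ ∈ 𝒞, ∃ K, ∀ x, |φ x| ≤ K
  extends_bumps : ∀ η ∈ bumps α β, ∃ φ ∈ 𝒞, EqOn φ η (Ioo α β)

/-- Only values on `(α, β)` enter the integrals, so every bump may be replaced by a member of `𝒞`
that agrees with it there, and the fundamental lemma of the calculus of variations applies. -/
lemma TestClass.separates {𝒞 : Set (ℝ → ℝ)} {α β : ℝ} (h : TestClass 𝒞 α β) :
    Separates 𝒞 (volume.restrict (Ioo α β)) where
  measurable φ hφ := (h.smooth φ hφ).continuous.measurable
  bounded := h.bounded
  eq_zero := by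
    intro F hF h0
    have := isOpen_Ioo.ae_eq_zero_of_integral_contDiff_smul_eq_zero (U := Ioo α β)
      (μ := volume.restrict (Ioo α β)) (f := F) hF.integrableOn.locallyIntegrableOn ?_
    · filter_upwards [this, ae_restrict_mem measurableSet_Ioo] with x hx hxi using hx hxi
    · intro η hη hc hs
      obtain ⟨φ, hφ, e⟩ := h.extends_bumps η (by
        refine ⟨hη, ?_⟩
        rcases (tsupport η).eq_empty_or_nonempty with he | hne
        -- For an empty support any endpoints inside the bounds serve; they need not be ordered.
        · refine ⟨α + 1, β - 1, by linarith, by linarith, fun t _ => ?_⟩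
          exact image_eq_zero_of_notMem_tsupport (by simp [he])
        · refine ⟨sInf (tsupport η), sSup (tsupport η), (hs (hc.isCompact.sInf_mem hne)).1,
            (hs (hc.isCompact.sSup_mem hne)).2, fun t ht => ?_⟩
          refine image_eq_zero_of_notMem_tsupport fun hmem => ht ?_
          exact ⟨csInf_le hc.isCompact.bddBelow hmem, le_csSup hc.isCompact.bddAbove hmem⟩)
      rw [← h0 φ hφ]
      refine setIntegral_congr_fun measurableSet_Ioo fun x hx => ?_
      simp only [smul_eq_mul, e hx, mul_comm]

lemma bumps_bounded {α β : ℝ} {φ : ℝ → ℝ} (hφ : φ ∈ bumps α β) : ∃ K, ∀ x, |φ x| ≤ K := by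
  obtain ⟨hs, a, b, -, -, h0⟩ := hφ
  obtain ⟨K, hK⟩ := isCompact_Icc (a := a) (b := b).exists_bound_of_continuousOn
    hs.continuous.continuousOn
  refine ⟨max K 0, fun x => ?_⟩
  by_cases hx : x ∈ Icc a b
  · exact (hK x hx).trans (le_max_left _ _)
  · simp [h0 x hx]

lemma bumps_deriv {α β : ℝ} {φ : ℝ → ℝ} (hφ : φ ∈ bumps α β) : deriv φ ∈ bumps α β := by
  obtain ⟨hs, a, b, ha, hb, h0⟩ := hφ
  refine ⟨(contDiff_infty_iff_deriv.1 hs).2, a, b, ha, hb, fun t ht => ?_⟩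
  have : φ =ᶠ[nhds t] fun _ => 0 :=
    Filter.eventually_of_mem (isClosed_Icc.isOpen_compl.mem_nhds ht) fun x hx => h0 x hx
  rw [this.deriv_eq]; simp

lemma testClass_bumps (α β : ℝ) : TestClass (bumps α β) α β where
  smooth _ h := h.1
  bounded _ h := bumps_bounded h
  extends_bumps η h := ⟨η, h, fun _ _ => rfl⟩

lemma perTests_bounded {φ : ℝ → ℝ} (hφ : φ ∈ perTests) : ∃ K, ∀ x, |φ x| ≤ K := by
  obtain ⟨K, hK⟩ := isCompact_Icc (a := (0 : ℝ)) (b := 2).exists_bound_of_continuousOn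
    hφ.1.continuous.continuousOn
  refine ⟨K, fun x => ?_⟩
  obtain ⟨y, hy, e⟩ := Function.Periodic.exists_mem_Ico₀ (f := φ) (c := 2) hφ.2 two_pos x
  rw [e]
  exact hK y (Ico_subset_Icc_self hy)

lemma perTests_deriv {φ : ℝ → ℝ} (hφ : φ ∈ perTests) : deriv φ ∈ perTests := by
  refine ⟨(contDiff_infty_iff_deriv.1 hφ.1).2, fun t => ?_⟩
  rw [← deriv_comp_add_const]
  congr 1; ext s; exact hφ.2 s

/-- The `2`-periodic extension of a smooth function with compact support in `(-1, 1)`. -/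
lemma exists_periodic_extension {η : ℝ → ℝ} (hη : η ∈ bumps (-1) 1) :
    ∃ φ ∈ perTests, EqOn φ η (Ioo (-1) 1) := by
  obtain ⟨hs, a, b, ha, hb, h0⟩ := hη
  have two : (0 : ℝ) < 2 := two_pos
  set φ : ℝ → ℝ := fun x => η (toIcoMod two (-1) x) with hφ
  have per : ∀ t, φ (t + 2) = φ t := fun t => by simp [hφ, toIcoMod_add_right]
  have perz : ∀ (n : ℤ) t, φ (t + n * 2) = φ t := fun n t =>
    (show Function.Periodic φ 2 from per).int_mul n t
  have on : ∀ x ∈ Ico (-1 : ℝ) 1, φ x = η x := fun x hx => by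
    simp only [hφ]
    rw [(toIcoMod_eq_self two).2]
    convert hx using 1; norm_num
  have loc : ∀ x ∈ Ioo (-1 : ℝ) 1, ContDiffAt ℝ ∞ φ x := fun x hx => by
    refine hs.contDiffAt.congr_of_eventuallyEq ?_
    filter_upwards [isOpen_Ioo.mem_nhds hx] with y hy
    exact on y (Ioo_subset_Ico_self hy)
  have loc1 : ContDiffAt ℝ ∞ φ (-1) := by
    refine (contDiffAt_const (c := (0 : ℝ))).congr_of_eventuallyEq ?_
    -- Near the seam the extension vanishes: points to the right of `-1` lie before `[a, b]`, and
    -- points to its left, shifted by `2`, lie beyond it.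
    have : Ioo (max (b - 2) (-3)) (min a 1) ∈ nhds (-1 : ℝ) := isOpen_Ioo.mem_nhds
      ⟨max_lt (by linarith) (by norm_num), lt_min ha (by norm_num)⟩
    filter_upwards [this] with y hy
    have h1 := (max_lt_iff.1 hy.1)
    have h2 := (lt_min_iff.1 hy.2)
    rcases lt_or_ge y (-1) with hlt | hge
    · rw [← per, on _ ⟨by linarith, by linarith⟩]
      exact h0 _ fun hm => by linarith [hm.2]
    · rw [on _ ⟨hge, by linarith⟩]
      exact h0 _ fun hm => by linarith [hm.1]
  refine ⟨φ, ⟨contDiff_iff_contDiffAt.2 fun x => ?_, per⟩, fun x hx => on x (Ioo_subset_Ico_self hx)⟩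
  have hx := toIcoMod_mem_Ico two (-1) x
  set n := toIcoDiv two (-1) x with hn
  have e : x - n * 2 = toIcoMod two (-1) x := by
    rw [← self_sub_toIcoDiv_zsmul, zsmul_eq_mul]
  have tr : φ = φ ∘ fun y => y - n * 2 := by
    ext y
    have := perz n (y - n * 2)
    simp only [Function.comp]
    rw [← this]; congr 1; ring
  rw [tr]
  refine ContDiffAt.comp x ?_ (contDiffAt_id.sub contDiffAt_const)
  rw [e]
  rcases eq_or_lt_of_le hx.1 with h | h
  · rw [← h]; exact loc1
  · refine loc _ ⟨h, ?_⟩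
    have := hx.2; norm_num at this ⊢; exact this

lemma testClass_perTests : TestClass perTests (-1) 1 where
  smooth _ h := h.1
  bounded _ h := perTests_bounded h
  extends_bumps _ h := exists_periodic_extension h

lemma one_mem_perTests : (fun _ => 1 : ℝ → ℝ) ∈ perTests := ⟨contDiff_const, fun _ => rfl⟩

/-! ### Absolute continuity on lines -/

lemma exists_bump_integral_one {α β : ℝ} (h : α < β) :
    ∃ η ∈ bumps α β, ∫ s in Ioo α β, η s = 1 := by
  let f : ContDiffBump ((α + β) / 2) := ⟨(β - α) / 8, (β - α) / 4, by linarith, by linarith⟩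
  have hz : ∀ t, t ∉ Ioo α β → f.normed volume t = 0 := by
    intro t ht
    have : t ∉ Function.support (f.normed volume) := by
      rw [f.support_normed_eq, Real.ball_eq_Ioo]
      intro hm
      exact ht ⟨by have := hm.1; simp only [f] at this; linarith,
        by have := hm.2; simp only [f] at this; linarith⟩
    simpa using this
  refine ⟨f.normed volume, ⟨f.contDiff_normed, (α + β) / 2 - (β - α) / 4,
    (α + β) / 2 + (β - α) / 4, by linarith, by linarith, fun t ht => ?_⟩, ?_⟩
  · have : t ∉ Function.support (f.normed volume) := by
      rw [f.support_normed_eq, Real.ball_eq_Ioo]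
      exact fun hm => ht (Ioo_subset_Icc_self hm)
    simpa using this
  · rw [setIntegral_eq_integral_of_forall_compl_eq_zero hz, f.integral_normed]

/-- The mean-zero condition makes the primitive vanish again to the right of the support. -/
lemma exists_bump_primitive {α β : ℝ} (h : α < β) {η : ℝ → ℝ} (hη : η ∈ bumps α β)
    (h0 : ∫ s in Ioo α β, η s = 0) : ∃ a ∈ bumps α β, deriv a = η := by
  obtain ⟨hs, p, q, hp, hq, hz⟩ := hη
  have hc := hs.continuous
  have hd : ∀ s, HasDerivAt (fun s => ∫ σ in α..s, η σ) (η s) s := fun s =>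
    intervalIntegral.integral_hasDerivAt_right (hc.intervalIntegrable _ _)
      (hc.stronglyMeasurableAtFilter _ _) hc.continuousAt
  have e : deriv (fun s => ∫ σ in α..s, η σ) = η := funext fun s => (hd s).deriv
  refine ⟨fun s => ∫ σ in α..s, η σ, ⟨?_, p, q, hp, hq, fun t ht => ?_⟩, e⟩
  · rw [contDiff_infty_iff_deriv, e]
    exact ⟨fun s => (hd s).differentiableAt, hs⟩
  · rw [mem_Icc, not_and_or, not_le, not_le] at ht
    have zero : ∀ r s : ℝ, (∀ x ∈ uIoc r s, x ∉ Icc p q) → ∫ σ in r..s, η σ = 0 := by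
      intro r s hrs
      rw [intervalIntegral.integral_congr_ae (g := fun _ => 0)
        (ae_of_all _ fun x hx => hz x (hrs x hx))]
      simp
    rcases ht with ht | ht
    · refine zero _ _ fun x hx hm => ?_
      rcases mem_uIoc.1 hx with hx | hx <;> linarith [hx.1, hx.2, hm.1]
    · change ∫ σ in α..t, η σ = 0
      rw [← intervalIntegral.integral_add_adjacent_intervals (b := β)
        (hc.intervalIntegrable _ _) (hc.intervalIntegrable _ _),
        ← setIntegral_Ioo_eq_intervalIntegral h.le, h0, zero_add]
      refine zero _ _ fun x hx hm => ?_
      rcases mem_uIoc.1 hx with hx | hx <;> linarith [hx.1, hx.2, hm.2]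

lemma bumps_sub_smul {α β : ℝ} {η ζ : ℝ → ℝ} (hη : η ∈ bumps α β) (hζ : ζ ∈ bumps α β) (m : ℝ) :
    (fun s => η s - m * ζ s) ∈ bumps α β := by
  obtain ⟨h1, a, b, ha, hb, hz⟩ := hη
  obtain ⟨h2, c, d, hc, hd, hz'⟩ := hζ
  refine ⟨h1.sub (contDiff_const.mul h2), min a c, max b d, lt_min ha hc, max_lt hb hd,
    fun t ht => ?_⟩
  change η t - m * ζ t = 0
  rw [hz t fun hm => ht ⟨(min_le_left _ _).trans hm.1, hm.2.trans (le_max_left _ _)⟩,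
    hz' t fun hm => ht ⟨(min_le_right _ _).trans hm.1, hm.2.trans (le_max_right _ _)⟩]
  simp

/-- Integration by parts of a primitive against a bump. -/
lemma integral_primitive_mul_deriv_bump {α β : ℝ} (h : α < β) {g a : ℝ → ℝ}
    (hg : IntegrableOn g (Ioo α β)) (ha : a ∈ bumps α β) :
    ∫ s in Ioo α β, (∫ σ in α..s, g σ) * deriv a s = - ∫ s in Ioo α β, g s * a s := by
  have hd := bumps_deriv ha
  obtain ⟨hs, p, q, hp, hq, hz⟩ := ha
  have hda : ∀ x, ∫ σ in α..x, deriv a σ = a x := by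
    intro x
    rw [intervalIntegral.integral_deriv_eq_sub (fun y _ => (hs.differentiable (by simp)) y)
      (hd.1.continuous.intervalIntegrable _ _), hz α fun hm => by linarith [hm.1], sub_zero]
  have hβ : a β = 0 := hz β fun hm => by linarith [hm.2]
  have hdi : IntegrableOn (deriv a) (Ioo α β) :=
    (hd.1.continuous.continuousOn.integrableOn_Icc).mono_set Ioo_subset_Icc_self
  have := integral_primitive_mul_add h.le 0 0 hg hdi (right_mem_Icc.2 h.le) (left_mem_Icc.2 h.le)
  simp only [hda, zero_add, hβ, mul_zero, intervalIntegral.integral_same, zero_mul, sub_zero] at this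
  rw [← setIntegral_Ioo_eq_intervalIntegral h.le, integral_add] at this
  · linarith
  · have := integrableOn_mul_primitive h.le 0 hdi hg
    simp only [hda, zero_add] at this
    exact this
  · have := integrableOn_mul_primitive h.le 0 hg hdi
    simp only [zero_add] at this
    exact this.congr (ae_of_all _ fun s => mul_comm _ _)

section ACL

variable {Y : Type*} [MeasurableSpace Y] {ν : Measure Y} [IsFiniteMeasure ν] {α β : ℝ}

/-- With the indicator the domain of integration is fixed, which makes joint measurability in the
endpoint and the parameter accessible. -/
lemma integral_indicator_le_eq {g : ℝ → ℝ} {s : ℝ} (hs : s ∈ Ioo α β) :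
    ∫ σ in Ioo α β, (Iic s).indicator g σ = ∫ σ in α..s, g σ := by
  rw [setIntegral_indicator measurableSet_Iic, intervalIntegral.integral_of_le hs.1.le]
  congr 2
  ext x
  simp only [mem_inter_iff, mem_Ioo, mem_Iic, mem_Ioc]
  exact ⟨fun h => ⟨h.1.1, h.2⟩, fun h => ⟨⟨h.1, h.2.trans_lt hs.2⟩, h.2⟩⟩

/-- Dominated by the integral of `‖g‖` over the whole line, which does not depend on the first
variable and is integrable since the interval has finite measure. -/
lemma integrable_parametric_primitive {g : ℝ × Y → ℝ} (hgm : StronglyMeasurable g)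
    (hg : Integrable g ((volume.restrict (Ioo α β)).prod ν)) :
    Integrable (fun p : ℝ × Y => ∫ σ in Ioo α β, (Iic p.1).indicator (fun σ => g (σ, p.2)) σ)
      ((volume.restrict (Ioo α β)).prod ν) := by
  have hm : StronglyMeasurable (fun p : ℝ × Y =>
      ∫ σ in Ioo α β, (Iic p.1).indicator (fun σ => g (σ, p.2)) σ) := by
    have : StronglyMeasurable (fun q : (ℝ × Y) × ℝ =>
        ({q : (ℝ × Y) × ℝ | q.2 ≤ q.1.1}).indicator (fun q => g (q.2, q.1.2)) q) := by
      refine StronglyMeasurable.indicator (hgm.comp_measurable (by fun_prop)) ?_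
      exact measurableSet_le (by fun_prop) (by fun_prop)
    exact this.integral_prod_right'
  have hd : Integrable (fun p : ℝ × Y => ∫ σ in Ioo α β, ‖g (σ, p.2)‖)
      ((volume.restrict (Ioo α β)).prod ν) :=
    (hg.norm.integral_prod_right).comp_snd _
  refine hd.mono' hm.aestronglyMeasurable ?_
  have : ∀ᵐ p : ℝ × Y ∂((volume.restrict (Ioo α β)).prod ν),
      Integrable (fun σ => g (σ, p.2)) (volume.restrict (Ioo α β)) :=
    Measure.quasiMeasurePreserving_snd.ae hg.prod_left_ae
  filter_upwards [this] with p hp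
  refine norm_integral_le_of_norm_le hp.norm (ae_of_all _ fun σ => ?_)
  exact norm_indicator_le_norm_self _ _

/-- The lemma of du Bois-Reymond with a parameter. The difference `H` of `u` and the primitive `G`
of `g` is orthogonal to `deriv a * χ` for all bumps `a`, so `H` depends on `y` only, and its value
is `c y = ∫ H η₀`. Strong measurability of `g` ensures that `G` is measurable; `ae_prim` removes it.
-/
lemma acl_bumps_of_stronglyMeasurable (hαβ : α < β) {𝒳 : Set (Y → ℝ)} (h𝒳 : Separates 𝒳 ν)
    {u g : ℝ × Y → ℝ} (hu : Integrable u ((volume.restrict (Ioo α β)).prod ν))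
    (hgm : StronglyMeasurable g) (hg : Integrable g ((volume.restrict (Ioo α β)).prod ν))
    (h : ∀ a ∈ bumps α β, ∀ χ ∈ 𝒳,
      ∫ p, u p * (deriv a p.1 * χ p.2) ∂((volume.restrict (Ioo α β)).prod ν) =
        - ∫ p, g p * (a p.1 * χ p.2) ∂((volume.restrict (Ioo α β)).prod ν)) :
    ∀ᵐ y ∂ν, Prim α β (fun s => u (s, y)) (fun s => g (s, y)) := by
  obtain ⟨η₀, hη₀, hη₀1⟩ := exists_bump_integral_one hαβ
  set μ := volume.restrict (Ioo α β) with hμ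
  set G : ℝ × Y → ℝ := fun p => ∫ σ in Ioo α β, (Iic p.1).indicator (fun σ => g (σ, p.2)) σ with hG
  have hGi : Integrable G (μ.prod ν) := integrable_parametric_primitive hgm hg
  have hsep := (testClass_bumps α β).separates
  have mulS : ∀ {F : ℝ × Y → ℝ} (_ : Integrable F (μ.prod ν)) {a : ℝ → ℝ} (_ : a ∈ bumps α β),
      Integrable (fun p : ℝ × Y => F p * a p.1) (μ.prod ν) := by
    intro F hF a ha
    obtain ⟨K, hK⟩ := bumps_bounded ha
    exact hF.mul_bdd (c := K) (ha.1.continuous.measurable.comp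
      measurable_fst).aestronglyMeasurable (ae_of_all _ fun p => hK _)
  have mulX : ∀ {F : ℝ × Y → ℝ} (_ : Integrable F (μ.prod ν)) {χ : Y → ℝ} (_ : χ ∈ 𝒳),
      Integrable (fun p : ℝ × Y => F p * χ p.2) (μ.prod ν) := by
    intro F hF χ hχ
    obtain ⟨K, hK⟩ := h𝒳.bounded χ hχ
    exact hF.mul_bdd (c := K) ((h𝒳.measurable χ hχ).comp
      measurable_snd).aestronglyMeasurable (ae_of_all _ fun p => hK _)
  set H : ℝ × Y → ℝ := fun p => u p - G p with hH
  have hHi : Integrable H (μ.prod ν) := hu.sub hGi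
  set c : Y → ℝ := fun y => ∫ s, H (s, y) * η₀ s ∂μ with hc
  have hci : Integrable c ν := (mulS hHi hη₀).integral_prod_right
  have hci' : Integrable (fun p : ℝ × Y => c p.2) (μ.prod ν) := hci.comp_snd μ
  have key : (fun p => H p - c p.2) =ᵐ[μ.prod ν] 0 := by
    refine (hsep.prod h𝒳).eq_zero _ (hHi.sub hci') ?_
    rintro _ ⟨η, hη, χ, hχ, rfl⟩
    set m := ∫ s, η s ∂μ with hm
    have hηi : Integrable η μ := by
      obtain ⟨K, hK⟩ := bumps_bounded hη
      exact Integrable.of_bound hη.1.continuous.measurable.aestronglyMeasurable K (ae_of_all _ hK)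
    have hη₀i : Integrable η₀ μ := by
      obtain ⟨K, hK⟩ := bumps_bounded hη₀
      exact Integrable.of_bound hη₀.1.continuous.measurable.aestronglyMeasurable K (ae_of_all _ hK)
    -- Subtracting `m * η₀` removes the mean of `η`, so the remainder is the derivative of a bump.
    obtain ⟨a, ha, hae⟩ := exists_bump_primitive hαβ (bumps_sub_smul hη hη₀ m) (by
      rw [integral_sub hηi (hη₀i.const_mul m), integral_const_mul, hη₀1, mul_one, ← hm, sub_self])
    have i1 : Integrable (fun p : ℝ × Y => (H p - c p.2) * (η p.1 * χ p.2)) (μ.prod ν) :=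
      (mulX (mulS (hHi.sub hci') hη) hχ).congr (ae_of_all _ fun p => by
        simp only [Pi.sub_apply]; ring)
    have i2 : Integrable (fun p : ℝ × Y => u p * (deriv a p.1 * χ p.2)) (μ.prod ν) :=
      (mulX (mulS hu (bumps_deriv ha)) hχ).congr (ae_of_all _ fun p => by ring)
    have i3 : Integrable (fun p : ℝ × Y => g p * (a p.1 * χ p.2)) (μ.prod ν) :=
      (mulX (mulS hg ha) hχ).congr (ae_of_all _ fun p => by ring)
    have hha := h a ha χ hχ
    rw [eq_neg_iff_add_eq_zero, ← integral_add i2 i3, integral_prod_symm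
      (fun p : ℝ × Y => u p * (deriv a p.1 * χ p.2) + g p * (a p.1 * χ p.2)) (i2.add i3)] at hha
    rw [integral_prod_symm _ i1, ← hha]
    apply integral_congr_ae
    filter_upwards [hu.prod_left_ae, hg.prod_left_ae, hGi.prod_left_ae,
      (mulS hHi hη).prod_left_ae, (mulS hHi hη₀).prod_left_ae,
      (mulS hu (bumps_deriv ha)).prod_left_ae, (mulS hg ha).prod_left_ae,
      (mulS hGi (bumps_deriv ha)).prod_left_ae]
      with y hyu hyg hyG hy1 hy2 hy3 hy4 hy5
    have lhs : ∫ s, (H (s, y) - c y) * (η s * χ y) ∂μ =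
        χ y * ∫ s, H (s, y) * deriv a s ∂μ := by
      rw [hae]
      have : ∫ s, H (s, y) * (η s - m * η₀ s) ∂μ = ∫ s, H (s, y) * η s ∂μ - m * c y := by
        rw [hc, ← integral_const_mul, ← integral_sub hy1 (hy2.const_mul m)]
        congr 1; ext s; ring
      rw [this, hm, ← integral_mul_const, ← integral_sub hy1 (hηi.mul_const _), ← integral_const_mul]
      congr 1; ext s; ring
    have mid : ∫ s, H (s, y) * deriv a s ∂μ =
        ∫ s, (u (s, y) * deriv a s + g (s, y) * a s) ∂μ := by
      have b := integral_primitive_mul_deriv_bump hαβ (g := fun s => g (s, y)) hyg ha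
      have b' : ∫ s, G (s, y) * deriv a s ∂μ = ∫ s in Ioo α β, (∫ σ in α..s, g (σ, y)) * deriv a s :=
        setIntegral_congr_fun measurableSet_Ioo fun s hs => by
          simp only [hG]; rw [integral_indicator_le_eq hs]
      rw [integral_add hy3 hy4, ← neg_neg (∫ s, g (s, y) * a s ∂μ), ← b, ← b', ← sub_eq_add_neg,
        ← integral_sub hy3 hy5]
      congr 1; ext s; simp only [hH]; ring
    change ∫ s, (H (s, y) - c y) * (η s * χ y) ∂μ =
      ∫ s, (u (s, y) * (deriv a s * χ y) + g (s, y) * (a s * χ y)) ∂μ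
    rw [lhs, mid, ← integral_const_mul]
    congr 1; ext s; ring
  have key' := Measure.ae_ae_of_ae_prod
    ((Measure.measurePreserving_swap (μ := ν) (ν := μ)).quasiMeasurePreserving.ae key)
  filter_upwards [key', hg.prod_left_ae] with y hy hyg
  refine ⟨hyg, c y, ?_⟩
  filter_upwards [hy, ae_restrict_mem measurableSet_Ioo] with s hs hsi
  have : H (s, y) - c y = 0 := hs
  simp only [hH, hG] at this
  rw [integral_indicator_le_eq hsi] at this
  linarith

lemma Prim.congr {u u' g g' : ℝ → ℝ} (h : Prim α β u g)
    (hu : u =ᵐ[volume.restrict (Ioo α β)] u') (hg : g =ᵐ[volume.restrict (Ioo α β)] g') :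
    Prim α β u' g' := by
  obtain ⟨c, hc⟩ := h.exists_const
  refine ⟨h.integrableOn.congr hg, c, ?_⟩
  filter_upwards [hc, hu, ae_restrict_mem measurableSet_Ioo] with s hs hs' hsi
  rw [← hs', hs]
  congr 1
  rw [← integral_indicator_le_eq hsi, ← integral_indicator_le_eq hsi]
  apply integral_congr_ae
  filter_upwards [hg] with σ hσ
  by_cases hm : σ ∈ Iic s <;> simp [hm, hσ]

lemma ae_ae_swap {p : ℝ × Y → Prop} {μ : Measure ℝ} [SFinite μ] (h : ∀ᵐ q ∂(μ.prod ν), p q) :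
    ∀ᵐ y ∂ν, ∀ᵐ s ∂μ, p (s, y) :=
  Measure.ae_ae_of_ae_prod
    ((Measure.measurePreserving_swap (μ := ν) (ν := μ)).quasiMeasurePreserving.ae h)

/-- A function with a weak partial derivative is, on almost every line, a primitive of it. -/
theorem ae_prim (hαβ : α < β) {𝒞 : Set (ℝ → ℝ)} (h𝒞 : TestClass 𝒞 α β) {𝒳 : Set (Y → ℝ)}
    (h𝒳 : Separates 𝒳 ν) {u g : ℝ × Y → ℝ}
    (hu : Integrable u ((volume.restrict (Ioo α β)).prod ν))
    (hg : Integrable g ((volume.restrict (Ioo α β)).prod ν))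
    (h : ∀ a ∈ 𝒞, ∀ χ ∈ 𝒳,
      ∫ p, u p * (deriv a p.1 * χ p.2) ∂((volume.restrict (Ioo α β)).prod ν) =
        - ∫ p, g p * (a p.1 * χ p.2) ∂((volume.restrict (Ioo α β)).prod ν)) :
    ∀ᵐ y ∂ν, Prim α β (fun s => u (s, y)) (fun s => g (s, y)) := by
  have hmem : ∀ᵐ p : ℝ × Y ∂((volume.restrict (Ioo α β)).prod ν), p.1 ∈ Ioo α β :=
    Measure.quasiMeasurePreserving_fst.ae (ae_restrict_mem measurableSet_Ioo)
  have hmk := hg.1.ae_eq_mk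
  have := acl_bumps_of_stronglyMeasurable hαβ h𝒳 hu hg.1.stronglyMeasurable_mk
    (hg.congr hmk) (fun η hη χ hχ => by
      -- Since the interval is open, agreement of `a` and `η` on it carries over to their
      -- derivatives.
      obtain ⟨a, ha, hae⟩ := h𝒞.extends_bumps η hη
      have e1 : ∫ p, u p * (deriv η p.1 * χ p.2) ∂((volume.restrict (Ioo α β)).prod ν) =
          ∫ p, u p * (deriv a p.1 * χ p.2) ∂((volume.restrict (Ioo α β)).prod ν) := by
        apply integral_congr_ae
        filter_upwards [hmem] with p hp
        rw [Filter.EventuallyEq.deriv_eq (hae.eventuallyEq_of_mem (isOpen_Ioo.mem_nhds hp))]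
      rw [e1, h a ha χ hχ]
      congr 1
      apply integral_congr_ae
      filter_upwards [hmem, hmk] with p hp hp'
      rw [hae hp, hp'])
  filter_upwards [this, ae_ae_swap hmk] with y hy hy'
  exact hy.congr (ae_of_all _ fun _ => rfl) (by filter_upwards [hy'] with s hs using hs.symm)

/-- If constants are admissible test functions, the derivative has mean zero on almost every
line. -/
theorem ae_integral_eq_zero {𝒞 : Set (ℝ → ℝ)} (h1 : (fun _ => 1) ∈ 𝒞)
    {𝒳 : Set (Y → ℝ)} (h𝒳 : Separates 𝒳 ν) {u g : ℝ × Y → ℝ}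
    (hg : Integrable g ((volume.restrict (Ioo α β)).prod ν))
    (h : ∀ a ∈ 𝒞, ∀ χ ∈ 𝒳,
      ∫ p, u p * (deriv a p.1 * χ p.2) ∂((volume.restrict (Ioo α β)).prod ν) =
        - ∫ p, g p * (a p.1 * χ p.2) ∂((volume.restrict (Ioo α β)).prod ν)) :
    ∀ᵐ y ∂ν, ∫ s in Ioo α β, g (s, y) = 0 := by
  refine h𝒳.eq_zero _ hg.integral_prod_right fun χ hχ => ?_
  have e := h _ h1 χ hχ
  simp only [deriv_const', zero_mul, mul_zero, integral_zero, one_mul] at e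
  obtain ⟨K, hK⟩ := h𝒳.bounded χ hχ
  have i : Integrable (fun p : ℝ × Y => g p * χ p.2) ((volume.restrict (Ioo α β)).prod ν) :=
    hg.mul_bdd (c := K) ((h𝒳.measurable χ hχ).comp
      measurable_snd).aestronglyMeasurable (ae_of_all _ fun p => hK _)
  rw [integral_prod_symm _ i, zero_eq_neg] at e
  rw [← e]
  congr 1; ext y
  rw [← integral_mul_const]

end ACL

/-! ### The cylinder as a product, and moving a coordinate to the front -/

/-- Lebesgue measure on `(-1, 1)`. -/
abbrev muJ : Measure ℝ := volume.restrict (Ioo (-1) 1)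

/-- Lebesgue measure on `(0, T)`. -/
abbrev muT (T : ℝ) : Measure ℝ := volume.restrict (Ioo 0 T)

lemma restrict_Omega : (volume.restrict Omega : Measure (ℝ × ℝ × ℝ)) = muJ.prod (muJ.prod muJ) := by
  rw [Measure.prod_restrict, Measure.prod_restrict]; rfl

lemma mu_eq (T : ℝ) : mu T = (muT T).prod (muJ.prod (muJ.prod muJ)) := by
  rw [← restrict_Omega, Measure.prod_restrict]; rfl

instance (T : ℝ) : IsFiniteMeasure (mu T) := by rw [mu_eq]; infer_instance

/-- Exchange of the first two of three factors. -/
def swapFst (α β γ : Type*) [MeasurableSpace α] [MeasurableSpace β] [MeasurableSpace γ] :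
    α × β × γ ≃ᵐ β × α × γ :=
  MeasurableEquiv.prodAssoc.symm.trans
    ((MeasurableEquiv.prodComm.prodCongr (MeasurableEquiv.refl γ)).trans MeasurableEquiv.prodAssoc)

lemma measurePreserving_swapFst {α β γ : Type*} [MeasurableSpace α] [MeasurableSpace β]
    [MeasurableSpace γ] (a : Measure α) (b : Measure β) (c : Measure γ) [SFinite a] [SFinite b]
    [SFinite c] : MeasurePreserving (swapFst α β γ) (a.prod (b.prod c)) (b.prod (a.prod c)) :=
  (measurePreserving_prodAssoc b a c).comp
    ((Measure.measurePreserving_swap.prod (MeasurePreserving.id c)).comp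
      ((measurePreserving_prodAssoc a b c).symm _))

/-- `(x, (t, y, z)) ↦ (t, x, y, z)`. -/
def insX : ℝ × (ℝ × ℝ × ℝ) ≃ᵐ Pt := swapFst _ _ _

/-- `(y, (t, x, z)) ↦ (t, x, y, z)`. -/
def insY : ℝ × (ℝ × ℝ × ℝ) ≃ᵐ Pt :=
  (swapFst _ _ _).trans ((MeasurableEquiv.refl ℝ).prodCongr (swapFst _ _ _))

/-- `(z, (t, x, y)) ↦ (t, x, y, z)`. -/
def insZ : ℝ × (ℝ × ℝ × ℝ) ≃ᵐ Pt :=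
  (swapFst _ _ _).trans ((MeasurableEquiv.refl ℝ).prodCongr
    ((swapFst _ _ _).trans ((MeasurableEquiv.refl ℝ).prodCongr MeasurableEquiv.prodComm)))


lemma measurePreserving_insX (T : ℝ) :
    MeasurePreserving insX (muJ.prod ((muT T).prod (muJ.prod muJ))) (mu T) := by
  rw [mu_eq]; exact measurePreserving_swapFst _ _ _

lemma measurePreserving_insY (T : ℝ) :
    MeasurePreserving insY (muJ.prod ((muT T).prod (muJ.prod muJ))) (mu T) := by
  rw [mu_eq]
  exact ((MeasurePreserving.id _).prod (measurePreserving_swapFst _ _ _)).comp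
    (measurePreserving_swapFst _ _ _)

lemma measurePreserving_insZ (T : ℝ) :
    MeasurePreserving insZ (muJ.prod ((muT T).prod (muJ.prod muJ))) (mu T) := by
  rw [mu_eq]
  exact ((MeasurePreserving.id _).prod (((MeasurePreserving.id _).prod
    Measure.measurePreserving_swap).comp (measurePreserving_swapFst _ _ _))).comp
    (measurePreserving_swapFst _ _ _)

/-! ### Product test functions -/

/-- Product test functions. -/
def tens (a b c e : ℝ → ℝ) : Field := fun p => a p.1 * (b p.2.1 * (c p.2.2.1 * e p.2.2.2))

section tens

variable {a b c e : ℝ → ℝ}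

lemma contDiff_tens (ha : ContDiff ℝ ∞ a) (hb : ContDiff ℝ ∞ b) (hc : ContDiff ℝ ∞ c)
    (he : ContDiff ℝ ∞ e) : ContDiff ℝ ∞ (tens a b c e) := by
  unfold tens; fun_prop

lemma fderiv_tens (ha : ContDiff ℝ ∞ a) (hb : ContDiff ℝ ∞ b) (hc : ContDiff ℝ ∞ c)
    (he : ContDiff ℝ ∞ e) (p : Pt) :
    fderiv ℝ (tens a b c e) p eT = tens (deriv a) b c e p ∧
    fderiv ℝ (tens a b c e) p eX = tens a (deriv b) c e p ∧
    fderiv ℝ (tens a b c e) p eY = tens a b (deriv c) e p ∧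
    fderiv ℝ (tens a b c e) p eZ = tens a b c (deriv e) p := by
  have hd := ((contDiff_tens ha hb hc he).differentiable (by simp)) p
  have key : ∀ (f : ℝ → ℝ) (s : ℝ), deriv (fun r => f (s + r)) 0 = deriv f s := fun f s => by
    rw [deriv_comp_const_add]; simp
  refine ⟨?_, ?_, ?_, ?_⟩ <;> rw [← hd.lineDeriv_eq_fderiv] <;>
    simp [lineDeriv, tens, eT, eX, eY, eZ, deriv_const_mul_field, deriv_mul_const_field, key]

lemma isHorTest_tens {T : ℝ} (ha : a ∈ bumps 0 T) (hb : b ∈ perTests) (hc : c ∈ perTests)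
    (he : ContDiff ℝ ∞ e) : IsHorTest T (tens a b c e) where
  smooth := contDiff_tens ha.1 hb.1 hc.1 he
  supp_time := by
    obtain ⟨-, r, s, hr, hs, h⟩ := ha
    exact ⟨r, s, hr, hs, fun t x y z ht => by simp [tens, h t ht]⟩
  per_x t x y z := by simp [tens, hb.2]
  per_y t x y z := by simp [tens, hc.2]

lemma tens_mem_zInterior {T : ℝ} (ha : a ∈ bumps 0 T) (hb : b ∈ perTests) (hc : c ∈ perTests)
    (he : e ∈ bumps (-1) 1) : tens a b c e ∈ zInterior T := by
  refine ⟨isHorTest_tens ha hb hc he.1, ?_⟩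
  obtain ⟨-, r, s, hr, hs, h⟩ := he
  refine ⟨max (-r) s, max_lt (by linarith) hs, fun t x y z hz => ?_⟩
  have : e z = 0 := h z fun hm => by
    rcases abs_cases z with ⟨h1, -⟩ | ⟨h1, -⟩ <;> rw [h1] at hz <;>
      linarith [hm.1, hm.2, le_max_left (-r) s, le_max_right (-r) s]
  simp [tens, this]

lemma tens_mem_zPeriodic {T : ℝ} (ha : a ∈ bumps 0 T) (hb : b ∈ perTests) (hc : c ∈ perTests)
    (he : e ∈ perTests) : tens a b c e ∈ zPeriodic T :=
  ⟨isHorTest_tens ha hb hc he.1, fun t x y z => by simp [tens, he.2]⟩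

end tens

lemma separates_tens (T : ℝ) {𝒵 : Set (ℝ → ℝ)} (h𝒵 : TestClass 𝒵 (-1) 1) :
    Separates (prodTests (bumps 0 T) (prodTests perTests (prodTests perTests 𝒵))) (mu T) := by
  rw [mu_eq]
  exact (testClass_bumps 0 T).separates.prod
    (testClass_perTests.separates.prod (testClass_perTests.separates.prod h𝒵.separates))

/-! ### Uniqueness of weak derivatives and elementary consequences -/

lemma HasWeakDeriv.integrable {T : ℝ} {𝒟 : Set Field} {d : Pt} {u g : Field}
    (h : HasWeakDeriv T 𝒟 d u g) : Integrable u (mu T) ∧ Integrable g (mu T) :=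
  ⟨h.1.integrable one_le_two, h.2.1.integrable one_le_two⟩

/-- `L¹` functions with the same integrals against product test functions agree. -/
lemma ae_eq_of_integral_tens {T : ℝ} {f g : Field} (hf : Integrable f (mu T))
    (hg : Integrable g (mu T))
    (h : ∀ a ∈ bumps 0 T, ∀ b ∈ perTests, ∀ c ∈ perTests, ∀ e ∈ bumps (-1) 1,
      ∫ p, f p * tens a b c e p ∂(mu T) = ∫ p, g p * tens a b c e p ∂(mu T)) :
    f =ᵐ[mu T] g := by
  have hsep := separates_tens T (testClass_bumps (-1) 1)
  have := hsep.eq_zero _ (hf.sub hg) (by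
    intro φ hφ
    have h1 := hsep.integrable_mul hφ hf
    have h2 := hsep.integrable_mul hφ hg
    obtain ⟨a, ha, _, ⟨b, hb, _, ⟨c, hc, e, he, rfl⟩, rfl⟩, rfl⟩ := hφ
    have := h a ha b hb c hc e he
    simp only [tens] at this
    simp only [Pi.sub_apply, sub_mul]
    rw [integral_sub h1 h2]
    exact sub_eq_zero.2 this)
  filter_upwards [this] with p hp
  exact sub_eq_zero.1 hp

lemma HasWeakDeriv.unique {T : ℝ} {d : Pt} {u g g' : Field}
    (h : HasWeakDeriv T (zInterior T) d u g) (h' : HasWeakDeriv T (zInterior T) d u g') :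
    g =ᵐ[mu T] g' := by
  refine ae_eq_of_integral_tens h.integrable.2 h'.integrable.2 fun a ha b hb c hc e he => ?_
  have hm := tens_mem_zInterior ha hb hc he
  rw [← neg_inj, ← h.2.2 _ hm, ← h'.2.2 _ hm]

lemma HasWeakDeriv.diffble {T : ℝ} {d : Pt} {u g : Field}
    (h : HasWeakDeriv T (zInterior T) d u g) : Diffble T d u := by
  have hex : ∃ g, HasWeakDeriv T (zInterior T) d u g := ⟨g, h⟩
  unfold Diffble D
  rw [dif_pos hex]
  exact hex.choose_spec

lemma HasWeakDeriv.D_ae_eq {T : ℝ} {d : Pt} {u g : Field}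
    (h : HasWeakDeriv T (zInterior T) d u g) : D T d u =ᵐ[mu T] g :=
  HasWeakDeriv.unique h.diffble h

lemma HasWeakDeriv.const_mul {T : ℝ} {𝒟 : Set Field} {d : Pt} {u g : Field}
    (h : HasWeakDeriv T 𝒟 d u g) (r : ℝ) :
    HasWeakDeriv T 𝒟 d (fun p => r * u p) (fun p => r * g p) := by
  refine ⟨h.1.const_mul r, h.2.1.const_mul r, fun φ hφ => ?_⟩
  simp only [mul_assoc, integral_const_mul, h.2.2 φ hφ]; ring

lemma HasWeakDeriv.congr {T : ℝ} {𝒟 : Set Field} {d : Pt} {u u' g g' : Field}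
    (h : HasWeakDeriv T 𝒟 d u g) (hu : u =ᵐ[mu T] u') (hg : g =ᵐ[mu T] g') :
    HasWeakDeriv T 𝒟 d u' g' := by
  refine ⟨(memLp_congr_ae hu).1 h.1, (memLp_congr_ae hg).1 h.2.1, fun φ hφ => ?_⟩
  have e1 := integral_congr_ae (hu.mul (ae_eq_refl fun p => fderiv ℝ φ p d))
  have e2 := integral_congr_ae (hg.mul (ae_eq_refl φ))
  simp only [Pi.mul_apply] at e1 e2
  rw [← e1, ← e2]
  exact h.2.2 φ hφ

lemma deriv_tens_integral {T : ℝ} {d : Pt} {u g : Field} (h : HasWeakDeriv T (zInterior T) d u g)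
    {a b c e a' b' c' e' : ℝ → ℝ} (ha : a ∈ bumps 0 T) (hb : b ∈ perTests) (hc : c ∈ perTests)
    (he : e ∈ bumps (-1) 1)
    (hd : ∀ p, fderiv ℝ (tens a b c e) p d = tens a' b' c' e' p) :
    ∫ p, g p * tens a b c e p ∂(mu T) = - ∫ p, u p * tens a' b' c' e' p ∂(mu T) := by
  have := h.2.2 _ (tens_mem_zInterior ha hb hc he)
  simp only [hd] at this
  rw [this, neg_neg]

/-- Mixed weak derivatives in a horizontal direction and in `z` commute. -/
lemma mixed_comm {T : ℝ} (i : Fin 2) {u ux uz uxz uzx : Field}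
    (h1 : HasWeakDeriv T (zInterior T) (eH i) u ux) (h2 : HasWeakDeriv T (zInterior T) eZ ux uxz)
    (h3 : HasWeakDeriv T (zInterior T) eZ u uz) (h4 : HasWeakDeriv T (zInterior T) (eH i) uz uzx) :
    uxz =ᵐ[mu T] uzx := by
  -- Both orders transfer the derivatives to the same product test function, in which the horizontal
  -- factor and the factor in `z` are each differentiated once.
  refine ae_eq_of_integral_tens h2.integrable.2 h4.integrable.2 fun a ha b hb c hc e he => ?_
  have hb' := perTests_deriv hb
  have hc' := perTests_deriv hc
  have he' := bumps_deriv he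
  have f1 := fun p => fderiv_tens ha.1 hb.1 hc.1 he.1 p
  have f2 := fun p => fderiv_tens ha.1 hb.1 hc.1 he'.1 p
  fin_cases i
  · have f3 := fun p => fderiv_tens ha.1 hb'.1 hc.1 he.1 p
    rw [deriv_tens_integral h2 ha hb hc he fun p => (f1 p).2.2.2,
      deriv_tens_integral h1 ha hb hc he' fun p => (f2 p).2.1,
      deriv_tens_integral h4 ha hb hc he fun p => (f1 p).2.1,
      deriv_tens_integral h3 ha hb' hc he fun p => (f3 p).2.2.2]
  · have f3 := fun p => fderiv_tens ha.1 hb.1 hc'.1 he.1 p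
    rw [deriv_tens_integral h2 ha hb hc he fun p => (f1 p).2.2.2,
      deriv_tens_integral h1 ha hb hc he' fun p => (f2 p).2.2.1,
      deriv_tens_integral h4 ha hb hc he fun p => (f1 p).2.2.1,
      deriv_tens_integral h3 ha hb hc' he fun p => (f3 p).2.2.2]

/-! ### Absolute continuity in each coordinate direction -/

section lines

variable {T : ℝ} {𝒟 : Set Field} {d : Pt} {u g : Field} {Y : Type*} [MeasurableSpace Y]
  {ν : Measure Y} {α β : ℝ} {𝒞 : Set (ℝ → ℝ)} {𝒳 : Set (Y → ℝ)}

/-- The equivalence `e` brings the direction of differentiation to the front, so that one argument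
serves all four coordinates. -/
lemma weak_comp_equiv (e : ℝ × Y ≃ᵐ Pt)
    (he : MeasurePreserving e ((volume.restrict (Ioo α β)).prod ν) (mu T))
    (htest : ∀ a ∈ 𝒞, ∀ χ ∈ 𝒳, ∃ φ ∈ 𝒟, (∀ q, φ (e q) = a q.1 * χ q.2) ∧
      ∀ q, fderiv ℝ φ (e q) d = deriv a q.1 * χ q.2)
    (h : HasWeakDeriv T 𝒟 d u g) :
    ∀ a ∈ 𝒞, ∀ χ ∈ 𝒳,
      ∫ p, u (e p) * (deriv a p.1 * χ p.2) ∂((volume.restrict (Ioo α β)).prod ν) =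
        - ∫ p, g (e p) * (a p.1 * χ p.2) ∂((volume.restrict (Ioo α β)).prod ν) := by
  intro a ha χ hχ
  obtain ⟨φ, hφ, h1, h2⟩ := htest a ha χ hχ
  have := h.2.2 φ hφ
  rw [← he.integral_comp', ← he.integral_comp'] at this
  simpa only [h1, h2] using this

lemma ae_prim_of_equiv [IsFiniteMeasure ν] (e : ℝ × Y ≃ᵐ Pt)
    (he : MeasurePreserving e ((volume.restrict (Ioo α β)).prod ν) (mu T)) (hαβ : α < β)
    (h𝒞 : TestClass 𝒞 α β) (h𝒳 : Separates 𝒳 ν)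
    (htest : ∀ a ∈ 𝒞, ∀ χ ∈ 𝒳, ∃ φ ∈ 𝒟, (∀ q, φ (e q) = a q.1 * χ q.2) ∧
      ∀ q, fderiv ℝ φ (e q) d = deriv a q.1 * χ q.2)
    (h : HasWeakDeriv T 𝒟 d u g) :
    ∀ᵐ y ∂ν, Prim α β (fun s => u (e (s, y))) (fun s => g (e (s, y))) :=
  ae_prim hαβ h𝒞 h𝒳 (u := fun q => u (e q)) (g := fun q => g (e q))
    (he.integrable_comp_of_integrable h.integrable.1)
    (he.integrable_comp_of_integrable h.integrable.2)
    (weak_comp_equiv e he htest h)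

lemma ae_integral_eq_zero_of_equiv [IsFiniteMeasure ν] (e : ℝ × Y ≃ᵐ Pt)
    (he : MeasurePreserving e ((volume.restrict (Ioo α β)).prod ν) (mu T))
    (h1 : (fun _ => 1) ∈ 𝒞) (h𝒳 : Separates 𝒳 ν)
    (htest : ∀ a ∈ 𝒞, ∀ χ ∈ 𝒳, ∃ φ ∈ 𝒟, (∀ q, φ (e q) = a q.1 * χ q.2) ∧
      ∀ q, fderiv ℝ φ (e q) d = deriv a q.1 * χ q.2)
    (h : HasWeakDeriv T 𝒟 d u g) :
    ∀ᵐ y ∂ν, ∫ s in Ioo α β, g (e (s, y)) = 0 :=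
  ae_integral_eq_zero h1 h𝒳 (u := fun q => u (e q)) (g := fun q => g (e q))
    (he.integrable_comp_of_integrable h.integrable.2)
    (weak_comp_equiv e he htest h)

end lines

section directions

variable {T : ℝ} {u g : Field}

lemma ae_prim_T (hT : 0 < T) (h : HasWeakDeriv T (zInterior T) eT u g) :
    ∀ᵐ q ∂(muJ.prod (muJ.prod muJ)), Prim 0 T (fun s => u (s, q)) (fun s => g (s, q)) := by
  refine ae_prim_of_equiv (MeasurableEquiv.refl Pt) (by rw [mu_eq]; exact MeasurePreserving.id _)
    hT (testClass_bumps 0 T) (testClass_perTests.separates.prod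
      (testClass_perTests.separates.prod (testClass_bumps (-1) 1).separates)) ?_ h
  rintro a ha _ ⟨b, hb, _, ⟨c, hc, e, he, rfl⟩, rfl⟩
  exact ⟨_, tens_mem_zInterior ha hb hc he, fun q => rfl,
    fun q => (fderiv_tens ha.1 hb.1 hc.1 he.1 q).1⟩

lemma separates_TYZ (T : ℝ) : Separates (prodTests (bumps 0 T)
    (prodTests perTests (bumps (-1) 1))) ((muT T).prod (muJ.prod muJ)) :=
  (testClass_bumps 0 T).separates.prod
    (testClass_perTests.separates.prod (testClass_bumps (-1) 1).separates)

lemma separates_TXY (T : ℝ) : Separates (prodTests (bumps 0 T)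
    (prodTests perTests perTests)) ((muT T).prod (muJ.prod muJ)) :=
  (testClass_bumps 0 T).separates.prod
    (testClass_perTests.separates.prod testClass_perTests.separates)

/-- A line-wise periodic primitive on `(-1, 1)`. -/
structure PerPrim (u g : ℝ → ℝ) : Prop where
  prim : Prim (-1) 1 u g
  mean : ∫ s in Ioo (-1) 1, g s = 0

lemma htest_X (T : ℝ) : ∀ a ∈ perTests, ∀ χ ∈ prodTests (bumps 0 T)
    (prodTests perTests (bumps (-1) 1)), ∃ φ ∈ zInterior T, (∀ q, φ (insX q) = a q.1 * χ q.2) ∧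
      ∀ q, fderiv ℝ φ (insX q) eX = deriv a q.1 * χ q.2 := by
  rintro b hb _ ⟨a, ha, _, ⟨c, hc, e, he, rfl⟩, rfl⟩
  refine ⟨_, tens_mem_zInterior ha hb hc he, fun q => ?_, fun q => ?_⟩
  · exact mul_left_comm (a q.2.1) (b q.1) _
  · exact ((fderiv_tens ha.1 hb.1 hc.1 he.1 _).2.1).trans (mul_left_comm (a q.2.1) _ _)

lemma htest_Y (T : ℝ) : ∀ a ∈ perTests, ∀ χ ∈ prodTests (bumps 0 T)
    (prodTests perTests (bumps (-1) 1)), ∃ φ ∈ zInterior T, (∀ q, φ (insY q) = a q.1 * χ q.2) ∧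
      ∀ q, fderiv ℝ φ (insY q) eY = deriv a q.1 * χ q.2 := by
  rintro c hc _ ⟨a, ha, _, ⟨b, hb, e, he, rfl⟩, rfl⟩
  refine ⟨_, tens_mem_zInterior ha hb hc he, fun q => ?_, fun q => ?_⟩
  · change a q.2.1 * (b q.2.2.1 * (c q.1 * e q.2.2.2)) = c q.1 * (a q.2.1 * (b q.2.2.1 * e q.2.2.2))
    ring
  · refine ((fderiv_tens ha.1 hb.1 hc.1 he.1 _).2.2.1).trans ?_
    change a q.2.1 * (b q.2.2.1 * (deriv c q.1 * e q.2.2.2)) =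
      deriv c q.1 * (a q.2.1 * (b q.2.2.1 * e q.2.2.2))
    ring

/-- The class `𝒵` stays general because vertical lines are tested both with bumps, which impose
nothing at `z = ± 1`, and with periodic functions. -/
lemma htest_Z (T : ℝ) {𝒵 : Set (ℝ → ℝ)} {𝒟 : Set Field} (hs : ∀ e ∈ 𝒵, ContDiff ℝ ∞ e)
    (hmem : ∀ a ∈ bumps 0 T, ∀ b ∈ perTests, ∀ c ∈ perTests, ∀ e ∈ 𝒵, tens a b c e ∈ 𝒟) :
    ∀ a ∈ 𝒵, ∀ χ ∈ prodTests (bumps 0 T)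
    (prodTests perTests perTests), ∃ φ ∈ 𝒟, (∀ q, φ (insZ q) = a q.1 * χ q.2) ∧
      ∀ q, fderiv ℝ φ (insZ q) eZ = deriv a q.1 * χ q.2 := by
  rintro e he _ ⟨a, ha, _, ⟨b, hb, c, hc, rfl⟩, rfl⟩
  refine ⟨_, hmem a ha b hb c hc e he, fun q => ?_, fun q => ?_⟩
  · change a q.2.1 * (b q.2.2.1 * (c q.2.2.2 * e q.1)) = e q.1 * (a q.2.1 * (b q.2.2.1 * c q.2.2.2))
    ring
  · refine ((fderiv_tens ha.1 hb.1 hc.1 (hs e he) _).2.2.2).trans ?_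
    change a q.2.1 * (b q.2.2.1 * (c q.2.2.2 * deriv e q.1)) =
      deriv e q.1 * (a q.2.1 * (b q.2.2.1 * c q.2.2.2))
    ring

lemma ae_perPrim_X (h : HasWeakDeriv T (zInterior T) eX u g) :
    ∀ᵐ q ∂((muT T).prod (muJ.prod muJ)),
      PerPrim (fun s => u (insX (s, q))) (fun s => g (insX (s, q))) := by
  filter_upwards [ae_prim_of_equiv insX (measurePreserving_insX T) (by norm_num)
    testClass_perTests (separates_TYZ T) (htest_X T) h,
    ae_integral_eq_zero_of_equiv insX (measurePreserving_insX T) one_mem_perTests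
    (separates_TYZ T) (htest_X T) h] with q h1 h2 using ⟨h1, h2⟩

lemma ae_perPrim_Y (h : HasWeakDeriv T (zInterior T) eY u g) :
    ∀ᵐ q ∂((muT T).prod (muJ.prod muJ)),
      PerPrim (fun s => u (insY (s, q))) (fun s => g (insY (s, q))) := by
  filter_upwards [ae_prim_of_equiv insY (measurePreserving_insY T) (by norm_num)
    testClass_perTests (separates_TYZ T) (htest_Y T) h,
    ae_integral_eq_zero_of_equiv insY (measurePreserving_insY T) one_mem_perTests
    (separates_TYZ T) (htest_Y T) h] with q h1 h2 using ⟨h1, h2⟩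

lemma ae_prim_Z (h : HasWeakDeriv T (zInterior T) eZ u g) :
    ∀ᵐ q ∂((muT T).prod (muJ.prod muJ)),
      Prim (-1) 1 (fun s => u (insZ (s, q))) (fun s => g (insZ (s, q))) :=
  ae_prim_of_equiv insZ (measurePreserving_insZ T) (by norm_num)
    (testClass_bumps (-1) 1) (separates_TXY T)
    (htest_Z T (fun _ h => h.1) fun _ ha _ hb _ hc _ he => tens_mem_zInterior ha hb hc he) h

lemma ae_perPrim_Z (h : HasWeakDeriv T (zPeriodic T) eZ u g) :
    ∀ᵐ q ∂((muT T).prod (muJ.prod muJ)),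
      PerPrim (fun s => u (insZ (s, q))) (fun s => g (insZ (s, q))) := by
  have ht := htest_Z T (𝒵 := perTests) (fun _ h => h.1)
    fun _ ha _ hb _ hc _ he => tens_mem_zPeriodic ha hb hc he
  filter_upwards [ae_prim_of_equiv insZ (measurePreserving_insZ T) (by norm_num)
    testClass_perTests (separates_TXY T) ht h,
    ae_integral_eq_zero_of_equiv insZ (measurePreserving_insZ T) one_mem_perTests
    (separates_TXY T) ht h] with q h1 h2 using ⟨h1, h2⟩

end directions

/-- A null measurable property that holds almost everywhere on almost every line holds almost
everywhere. -/
lemma ae_of_ae_lines {X Y Z : Type*} [MeasurableSpace X] [MeasurableSpace Y] [MeasurableSpace Z]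
    {ξ : Measure X} {ν : Measure Y} {ζ : Measure Z} [SFinite ξ] [SFinite ν] (e : X × Y ≃ᵐ Z)
    (he : MeasurePreserving e (ξ.prod ν) ζ) {p : Z → Prop} (hp : NullMeasurableSet {x | p x} ζ)
    (h : ∀ᵐ y ∂ν, ∀ᵐ s ∂ξ, p (e (s, y))) : ∀ᵐ x ∂ζ, p x := by
  -- Passing from lines to the product requires a measurable set, hence a measurable subset that is
  -- almost everywhere equal.
  obtain ⟨t, hts, htm, hte⟩ := hp.exists_measurable_subset_ae_eq
  have hsw : MeasurePreserving (fun q : Y × X => e (q.2, q.1)) (ν.prod ξ) ζ :=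
    he.comp Measure.measurePreserving_swap
  have h1 : ∀ᵐ q ∂(ν.prod ξ), e (q.2, q.1) ∈ t := by
    refine (Measure.ae_prod_iff_ae_ae (p := fun q : Y × X => e (q.2, q.1) ∈ t)
      (hsw.measurable htm)).2 ?_
    filter_upwards [h, Measure.ae_ae_of_ae_prod (hsw.quasiMeasurePreserving.ae hte.mem_iff)]
      with y hy hy'
    filter_upwards [hy, hy'] with s hs hs'
    exact hs'.2 hs
  have h2 : ∀ᵐ x ∂ζ, x ∈ t := by
    have := (Measure.measurePreserving_swap.comp (he.symm e)).quasiMeasurePreserving.ae h1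
    filter_upwards [this] with x hx
    simpa using hx
  exact h2.mono hts

/-! ### The vertical velocity -/

/-- Splitting the integrals requires integrable products, hence tests that are bounded on the
cylinder together with their derivative. -/
lemma HasWeakDeriv.add {T : ℝ} {𝒟 : Set Field} {d : Pt} {u u' g g' : Field}
    (hsm : ∀ φ ∈ 𝒟, ContDiff ℝ ∞ φ ∧ (∃ K, ∀ᵐ p ∂(mu T), ‖φ p‖ ≤ K) ∧
      ∃ K, ∀ᵐ p ∂(mu T), ‖fderiv ℝ φ p d‖ ≤ K)
    (h : HasWeakDeriv T 𝒟 d u g) (h' : HasWeakDeriv T 𝒟 d u' g') :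
    HasWeakDeriv T 𝒟 d (fun p => u p + u' p) (fun p => g p + g' p) := by
  refine ⟨h.1.add h'.1, h.2.1.add h'.2.1, fun φ hφ => ?_⟩
  obtain ⟨hs, ⟨K, hK⟩, ⟨L, hL⟩⟩ := hsm φ hφ
  have m1 : AEStronglyMeasurable φ (mu T) := hs.continuous.aestronglyMeasurable
  have m2 : AEStronglyMeasurable (fun p => fderiv ℝ φ p d) (mu T) :=
    ((hs.continuous_fderiv (by simp)).clm_apply continuous_const).aestronglyMeasurable
  simp only [add_mul]
  rw [integral_add (h.integrable.1.mul_bdd m2 hL) (h'.integrable.1.mul_bdd m2 hL),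
    integral_add (h.integrable.2.mul_bdd m1 hK) (h'.integrable.2.mul_bdd m1 hK),
    h.2.2 φ hφ, h'.2.2 φ hφ, neg_add]

/-- Test functions may be unbounded in `z` on the whole space, but the cylinder lies in a compact
set. -/
lemma isHorTest_bounds {T : ℝ} {φ : Field} (hs : ContDiff ℝ ∞ φ) (d : Pt) :
    ContDiff ℝ ∞ φ ∧ (∃ K, ∀ᵐ p ∂(mu T), ‖φ p‖ ≤ K) ∧
      ∃ K, ∀ᵐ p ∂(mu T), ‖fderiv ℝ φ p d‖ ≤ K := by
  have hc : IsCompact (Icc 0 T ×ˢ (Icc (-1 : ℝ) 1 ×ˢ (Icc (-1 : ℝ) 1 ×ˢ Icc (-1 : ℝ) 1))) :=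
    isCompact_Icc.prod (isCompact_Icc.prod (isCompact_Icc.prod isCompact_Icc))
  have hsub : ∀ᵐ p ∂(mu T), p ∈ (Icc 0 T ×ˢ (Icc (-1 : ℝ) 1 ×ˢ (Icc (-1 : ℝ) 1 ×ˢ Icc (-1 : ℝ) 1))) := by
    have hm : MeasurableSet (Ioo 0 T ×ˢ Omega) :=
      measurableSet_Ioo.prod (measurableSet_Ioo.prod (measurableSet_Ioo.prod measurableSet_Ioo))
    filter_upwards [ae_restrict_mem hm] with p hp
    exact ⟨Ioo_subset_Icc_self hp.1, Ioo_subset_Icc_self hp.2.1, Ioo_subset_Icc_self hp.2.2.1,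
      Ioo_subset_Icc_self hp.2.2.2⟩
  obtain ⟨K, hK⟩ := hc.exists_bound_of_continuousOn hs.continuous.continuousOn
  obtain ⟨L, hL⟩ := hc.exists_bound_of_continuousOn
    ((hs.continuous_fderiv (by simp)).clm_apply (continuous_const (y := d))).continuousOn
  exact ⟨hs, ⟨K, hsub.mono fun p hp => hK p hp⟩, ⟨L, hsub.mono fun p hp => hL p hp⟩⟩

lemma HasWeakDeriv.add_zInterior {T : ℝ} {d : Pt} {u u' g g' : Field}
    (h : HasWeakDeriv T (zInterior T) d u g) (h' : HasWeakDeriv T (zInterior T) d u' g') :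
    HasWeakDeriv T (zInterior T) d (fun p => u p + u' p) (fun p => g p + g' p) :=
  h.add (fun _ hφ => isHorTest_bounds hφ.1.smooth d) h'

/-- An integrable function whose primitive is constant vanishes. -/
lemma ae_eq_zero_of_primitive_const {α β : ℝ} (h : α < β) {k : ℝ → ℝ}
    (hk : IntegrableOn k (Ioo α β)) {C : ℝ}
    (hC : ∀ᵐ s ∂(volume.restrict (Ioo α β)), ∫ σ in α..s, k σ = C) :
    ∀ᵐ s ∂(volume.restrict (Ioo α β)), k s = 0 := by
  have hcont : ContinuousOn (fun s => ∫ σ in α..s, k σ) (Ioo α β) := by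
    have := (continuousOn_primitive_add h.le 0 hk).mono Ioo_subset_Icc_self
    simpa only [zero_add] using this
  -- Continuity turns equality almost everywhere into equality on the whole interval, so the
  -- primitive can be differentiated.
  have heq := Measure.eqOn_open_of_ae_eq (μ := volume) (U := Ioo α β)
    (f := fun s => ∫ σ in α..s, k σ) (g := fun _ => C) hC isOpen_Ioo hcont continuousOn_const
  have hd := (intervalIntegrable_of_Ioo h.le hk).ae_hasDerivAt_integral
  filter_upwards [ae_restrict_of_ae hd, ae_restrict_mem measurableSet_Ioo] with s hs hsi
  have h1 := hs (by rw [uIcc_of_le h.le]; exact Ioo_subset_Icc_self hsi) α left_mem_uIcc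
  have h2 : HasDerivAt (fun s => ∫ σ in α..s, k σ) 0 s :=
    (hasDerivAt_const s C).congr_of_eventuallyEq
      (heq.eventuallyEq_of_mem (isOpen_Ioo.mem_nhds hsi))
  exact h1.unique h2

/-- `∂_z w(v) = - div_H v`. -/
lemma D_eZ_vertVel {T : ℝ} {v : Fin 2 → Field} (hw : Diffble T eZ (vertVel T v))
    (h0 : Diffble T eX (v 0)) (h1 : Diffble T eY (v 1)) :
    D T eZ (vertVel T v) =ᵐ[mu T] fun p => - divH T v p := by
  have hdiv : MemLp (divH T v) 2 (mu T) := h0.2.1.add h1.2.1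
  have hmp := measurePreserving_insZ T
  have hdl := (hmp.integrable_comp_of_integrable (hdiv.integrable one_le_two)).prod_left_ae
  refine ae_of_ae_lines insZ hmp
    (nullMeasurableSet_eq_fun hw.2.1.1.aemeasurable hdiv.1.aemeasurable.neg) ?_
  filter_upwards [ae_prim_Z hw, hdl] with q hq hd
  obtain ⟨c, hc⟩ := hq.exists_const
  have hg := hq.integrableOn
  have hd' : IntegrableOn (fun s => divH T v (insZ (s, q))) (Ioo (-1) 1) := hd
  -- On the line, `w` equals `c` plus the primitive of `∂_z w`, and by definition minus the
  -- primitive of `div_H v`. The primitive of the sum of the two integrands is therefore the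
  -- constant `-c`.
  have := ae_eq_zero_of_primitive_const (by norm_num) (hg.add hd') (C := -c) (by
    filter_upwards [hc, ae_restrict_mem measurableSet_Ioo] with s hs hsi
    have mono : ∀ {f : ℝ → ℝ}, IntegrableOn f (Ioo (-1) 1) →
        IntervalIntegrable f volume (-1) s := fun hf =>
      (intervalIntegrable_of_Ioo (by norm_num) hf).mono_set (by
        rw [uIcc_of_le (by norm_num : (-1 : ℝ) ≤ 1), uIcc_of_le hsi.1.le]; exact Icc_subset_Icc_right hsi.2.le)
    simp only [Pi.add_apply]
    rw [intervalIntegral.integral_add (mono hg) (mono hd')]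
    have e : vertVel T v (insZ (s, q)) = - ∫ ξ in (-1 : ℝ)..s, divH T v (insZ (ξ, q)) := rfl
    rw [e] at hs
    linarith)
  filter_upwards [this] with s hs
  simp only [Pi.add_apply] at hs
  linarith

/-! ### Anisotropic product estimates -/

lemma enn_sq_rpow_half (x : ℝ≥0∞) : (x ^ (1 / 2 : ℝ)) ^ 2 = x := by
  rw [← ENNReal.rpow_natCast, ← ENNReal.rpow_mul]; norm_num

/-- The Cauchy-Schwarz inequality in squared form. -/
lemma sq_lintegral_mul_le {X : Type*} [MeasurableSpace X] {μ : Measure X} {f g : X → ℝ≥0∞}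
    (hf : AEMeasurable f μ) (hg : AEMeasurable g μ) :
    (∫⁻ x, f x * g x ∂μ) ^ 2 ≤ (∫⁻ x, f x ^ 2 ∂μ) * ∫⁻ x, g x ^ 2 ∂μ := by
  have h := ENNReal.lintegral_mul_le_Lp_mul_Lq μ (p := 2) (q := 2)
    ⟨by norm_num, by norm_num, by norm_num⟩ hf hg
  calc (∫⁻ x, f x * g x ∂μ) ^ 2
      ≤ ((∫⁻ x, f x ^ (2 : ℝ) ∂μ) ^ (1 / 2 : ℝ) * (∫⁻ x, g x ^ (2 : ℝ) ∂μ) ^ (1 / 2 : ℝ)) ^ 2 :=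
        pow_le_pow_left₀ (zero_le) h 2
    _ = _ := by
        rw [mul_pow, enn_sq_rpow_half, enn_sq_rpow_half]
        norm_cast

lemma enn_add_sq_le (x y : ℝ≥0∞) : (x + y) ^ 2 ≤ 2 * (x ^ 2 + y ^ 2) := by
  have := ENNReal.rpow_add_le_mul_rpow_add_rpow x y (p := 2) (by norm_num)
  norm_num at this
  norm_cast at this

lemma enn_two_mul_le (x y : ℝ≥0∞) : 2 * x * y ≤ x ^ 2 + y ^ 2 := by
  rcases eq_or_ne x ⊤ with rfl | hx
  · simp
  rcases eq_or_ne y ⊤ with rfl | hy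
  · simp
  lift x to NNReal using hx
  lift y to NNReal using hy
  norm_cast
  rw [← NNReal.coe_le_coe]
  push_cast
  nlinarith [sq_nonneg ((x : ℝ) - y)]

lemma enn_le_of_sq_le {x y : ℝ≥0∞} (h : x ^ 2 ≤ y ^ 2) : x ≤ y :=
  (ENNReal.pow_right_strictMono two_ne_zero).le_iff_le.1 h

section abstract_estimates

variable {A X Y Z : Type*} [MeasurableSpace A] [MeasurableSpace X] [MeasurableSpace Y]
  [MeasurableSpace Z] {τ : Measure A} {ξ : Measure X} {η : Measure Y} {ζ : Measure Z}
  [SFinite ξ] [SFinite η] [SFinite ζ]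

/-- Two one-dimensional bounds in different variables give a bound of the square. -/
lemma lintegral_sq_le_of_cross_bounds {h k₁ k₂ : A × X × Y × Z → ℝ≥0∞}
    (hk₁ : Measurable k₁) (hk₂ : Measurable k₂)
    (h₁ : ∀ᵐ p ∂(τ.prod (ξ.prod (η.prod ζ))), h p ≤ ∫⁻ x, k₁ (p.1, x, p.2.2) ∂ξ)
    (h₂ : ∀ᵐ p ∂(τ.prod (ξ.prod (η.prod ζ))), h p ≤ ∫⁻ y, k₂ (p.1, p.2.1, y, p.2.2.2) ∂η) :
    ∫⁻ t, ∫⁻ x, ∫⁻ y, (∫⁻ z, h (t, x, y, z) ∂ζ) ^ 2 ∂η ∂ξ ∂τ ≤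
      ∫⁻ t, (∫⁻ r, k₁ (t, r) ∂(ξ.prod (η.prod ζ))) * (∫⁻ r, k₂ (t, r) ∂(ξ.prod (η.prod ζ))) ∂τ := by
  refine lintegral_mono_ae ?_
  filter_upwards [Measure.ae_ae_of_ae_prod h₁, Measure.ae_ae_of_ae_prod h₂] with t ht₁ ht₂
  have m₁ : Measurable fun r => k₁ (t, r) := hk₁.comp measurable_prodMk_left
  have m₂ : Measurable fun r => k₂ (t, r) := hk₂.comp measurable_prodMk_left
  have e₁ : ∫⁻ r, k₁ (t, r) ∂(ξ.prod (η.prod ζ)) = ∫⁻ y, ∫⁻ z, ∫⁻ x, k₁ (t, x, y, z) ∂ξ ∂ζ ∂η := by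
    rw [lintegral_prod_symm _ m₁.aemeasurable]
    exact lintegral_prod _ (Measurable.lintegral_prod_left'
      (f := fun r : X × Y × Z => k₁ (t, r)) m₁).aemeasurable
  have e₂ : ∫⁻ r, k₂ (t, r) ∂(ξ.prod (η.prod ζ)) = ∫⁻ x, ∫⁻ z, ∫⁻ y, k₂ (t, x, y, z) ∂η ∂ζ ∂ξ := by
    rw [lintegral_prod _ m₂.aemeasurable]
    refine lintegral_congr fun x => ?_
    exact lintegral_prod_symm _ (m₂.comp measurable_prodMk_left).aemeasurable
  rw [e₁, e₂, mul_comm]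
  have mA : Measurable fun y => ∫⁻ z, ∫⁻ x, k₁ (t, x, y, z) ∂ξ ∂ζ :=
    Measurable.lintegral_prod_right' (f := fun q : Y × Z => ∫⁻ x, k₁ (t, x, q) ∂ξ)
      (Measurable.lintegral_prod_left' (f := fun r : X × Y × Z => k₁ (t, r)) m₁)
  calc ∫⁻ x, ∫⁻ y, (∫⁻ z, h (t, x, y, z) ∂ζ) ^ 2 ∂η ∂ξ
      ≤ ∫⁻ x, ∫⁻ y, (∫⁻ z, ∫⁻ y', k₂ (t, x, y', z) ∂η ∂ζ) *
          (∫⁻ z, ∫⁻ x', k₁ (t, x', y, z) ∂ξ ∂ζ) ∂η ∂ξ := by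
        refine lintegral_mono_ae ?_
        filter_upwards [Measure.ae_ae_of_ae_prod ht₁, Measure.ae_ae_of_ae_prod ht₂] with x hx₁ hx₂
        refine lintegral_mono_ae ?_
        filter_upwards [Measure.ae_ae_of_ae_prod hx₁, Measure.ae_ae_of_ae_prod hx₂] with y hy₁ hy₂
        -- One factor is bounded by a quantity free of `y`, the other by a quantity free of `x`, so
        -- the double integral factorizes.
        rw [pow_two]
        exact mul_le_mul' (lintegral_mono_ae hy₂) (lintegral_mono_ae hy₁)
    _ = _ := by
        simp_rw [lintegral_const_mul _ mA]
        rw [lintegral_mul_const'' _ (Measurable.aemeasurable ?_)]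
        have : Measurable fun q : X × Z => ∫⁻ y', k₂ (t, q.1, y', q.2) ∂η :=
          Measurable.lintegral_prod_right' (f := fun r : (X × Z) × Y => k₂ (t, r.1.1, r.2, r.1.2))
            (m₂.comp (g := fun r : X × Y × Z => k₂ (t, r))
              (f := fun r : (X × Z) × Y => (r.1.1, r.2, r.1.2)) (by fun_prop))
        exact Measurable.lintegral_prod_right' (f := fun q : X × Z => ∫⁻ y', k₂ (t, q.1, y', q.2) ∂η)
          this

/-- Cauchy-Schwarz for the product of a function bounded in `z` and a function in `L²_z`. -/
lemma sq_lintegral_mul_le_aniso [SFinite τ] {a b : A × X × Y × Z → ℝ≥0∞} {P : A × X × Y → ℝ≥0∞}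
    (ha : Measurable a) (hb : Measurable b) (hP : Measurable P)
    (h : ∀ᵐ p ∂(τ.prod (ξ.prod (η.prod ζ))), a p ≤ P (p.1, p.2.1, p.2.2.1)) :
    (∫⁻ p, a p * b p ∂(τ.prod (ξ.prod (η.prod ζ)))) ^ 2 ≤
      (∫⁻ t, ∫⁻ x, ∫⁻ y, P (t, x, y) ^ 2 ∂η ∂ξ ∂τ) *
        ∫⁻ t, ∫⁻ x, ∫⁻ y, (∫⁻ z, b (t, x, y, z) ∂ζ) ^ 2 ∂η ∂ξ ∂τ := by
  have split : ∀ f : A × X × Y → ℝ≥0∞, Measurable f →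
      ∫⁻ q, f q ∂(τ.prod (ξ.prod η)) = ∫⁻ t, ∫⁻ x, ∫⁻ y, f (t, x, y) ∂η ∂ξ ∂τ := by
    intro f hf
    rw [lintegral_prod _ hf.aemeasurable]
    refine lintegral_congr fun t => ?_
    exact lintegral_prod _ (hf.comp measurable_prodMk_left).aemeasurable
  have mB : Measurable fun q : A × X × Y => ∫⁻ z, b (q.1, q.2.1, q.2.2, z) ∂ζ :=
    Measurable.lintegral_prod_right' (f := fun r : (A × X × Y) × Z => b (r.1.1, r.1.2.1, r.1.2.2, r.2))
      (hb.comp (f := fun r : (A × X × Y) × Z => (r.1.1, r.1.2.1, r.1.2.2, r.2)) (by fun_prop))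
  have le : ∫⁻ p, a p * b p ∂(τ.prod (ξ.prod (η.prod ζ))) ≤
      ∫⁻ q, P q * ∫⁻ z, b (q.1, q.2.1, q.2.2, z) ∂ζ ∂(τ.prod (ξ.prod η)) := by
    rw [split (fun q => P q * ∫⁻ z, b (q.1, q.2.1, q.2.2, z) ∂ζ) (hP.mul mB),
      lintegral_prod (fun p => a p * b p) (ha.mul hb).aemeasurable]
    refine lintegral_mono_ae ?_
    filter_upwards [Measure.ae_ae_of_ae_prod h] with t ht
    have hab : Measurable fun p => a p * b p := ha.mul hb
    rw [lintegral_prod (fun r => a (t, r) * b (t, r)) (hab.comp measurable_prodMk_left).aemeasurable]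
    refine lintegral_mono_ae ?_
    filter_upwards [Measure.ae_ae_of_ae_prod ht] with x hx
    rw [lintegral_prod (fun r => a (t, x, r) * b (t, x, r)) ((hab.comp measurable_prodMk_left).comp
      measurable_prodMk_left).aemeasurable]
    refine lintegral_mono_ae ?_
    filter_upwards [Measure.ae_ae_of_ae_prod hx] with y hy
    have mb : Measurable fun z => b (t, x, y, z) := hb.comp (by fun_prop)
    rw [← lintegral_const_mul _ mb]
    refine lintegral_mono_ae ?_
    filter_upwards [hy] with z hz
    exact mul_le_mul_left hz _
  refine (pow_le_pow_left₀ (zero_le) le 2).trans ?_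
  refine (sq_lintegral_mul_le hP.aemeasurable mB.aemeasurable).trans ?_
  rw [split _ (hP.pow_const 2), split _ (mB.pow_const 2)]

end abstract_estimates

/-- The fourth power of the norm of `L⁴((0,T); L⁴_xy L²_z)`. -/
def aniso (T : ℝ) (f : Field) : ℝ≥0∞ :=
  ∫⁻ t, ∫⁻ x, ∫⁻ y, (∫⁻ z, ‖f (t, x, y, z)‖ₑ ^ 2 ∂muJ) ^ 2 ∂muJ ∂muJ ∂(muT T)

lemma aniso_congr {T : ℝ} {f g : Field} (h : f =ᵐ[mu T] g) : aniso T f = aniso T g := by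
  rw [mu_eq] at h
  refine lintegral_congr_ae ?_
  filter_upwards [Measure.ae_ae_of_ae_prod h] with t ht
  refine lintegral_congr_ae ?_
  filter_upwards [Measure.ae_ae_of_ae_prod ht] with x hx
  refine lintegral_congr_ae ?_
  filter_upwards [Measure.ae_ae_of_ae_prod hx] with y hy
  congr 1
  refine lintegral_congr_ae ?_
  filter_upwards [hy] with z hz
  rw [hz]

lemma eLpNorm_two_sq {X : Type*} [MeasurableSpace X] {μ : Measure X} (f : X → ℝ) :
    eLpNorm f 2 μ ^ 2 = ∫⁻ x, ‖f x‖ₑ ^ 2 ∂μ := by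
  rw [eLpNorm_eq_lintegral_rpow_enorm_toReal (by norm_num) (by norm_num), ENNReal.toReal_ofNat,
    enn_sq_rpow_half]
  norm_cast

lemma sq_eq {T : ℝ} (f : Field) : sq T f = ∫⁻ p, ‖f p‖ₑ ^ 2 ∂(mu T) := eLpNorm_two_sq f

lemma sq_congr {T : ℝ} {f g : Field} (h : f =ᵐ[mu T] g) : sq T f = sq T g := by
  rw [sq, sq, eLpNorm_congr_ae h]

/-- The integrand in the pointwise bound of a primitive on an interval of length `2`. -/
def lineKernel (f g : Field) (p : Pt) : ℝ≥0∞ :=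
  ENNReal.ofReal (1 - (-1) : ℝ)⁻¹ * ‖f p‖ₑ ^ 2 + 2 * ‖f p‖ₑ * ‖g p‖ₑ

lemma measurable_lineKernel {f g : Field} (hf : Measurable f) (hg : Measurable g) :
    Measurable (lineKernel f g) :=
  ((hf.enorm.pow_const 2).const_mul _).add ((hf.enorm.const_mul 2).mul hg.enorm)

lemma lineKernel_le (f g : Field) (p : Pt) :
    lineKernel f g p ≤ 2 * (‖f p‖ₑ ^ 2 + ‖g p‖ₑ ^ 2) := by
  have h1 : ENNReal.ofReal (1 - (-1) : ℝ)⁻¹ ≤ 1 := by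
    rw [ENNReal.ofReal_le_one]; norm_num
  calc lineKernel f g p ≤ 1 * ‖f p‖ₑ ^ 2 + (‖f p‖ₑ ^ 2 + ‖g p‖ₑ ^ 2) :=
        add_le_add (mul_le_mul_left h1 _) (enn_two_mul_le _ _)
    _ ≤ (‖f p‖ₑ ^ 2 + ‖g p‖ₑ ^ 2) + (‖f p‖ₑ ^ 2 + ‖g p‖ₑ ^ 2) := by
        rw [one_mul]; gcongr; exact le_self_add
    _ = _ := by ring

/-- The kernel is at most `‖f‖ (‖f‖ + 2 ‖g‖)`. Cauchy-Schwarz thus leaves a factor free of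
derivatives, to be bounded uniformly in time. The constant comes from `(x + 2y)² ≤ 2 (x² + 4y²)`. -/
lemma sq_lintegral_lineKernel_le {X : Type*} [MeasurableSpace X] {μ : Measure X} {e : X → Pt}
    {f g : Field} (he : Measurable e) (hf : Measurable f) (hg : Measurable g) :
    (∫⁻ x, lineKernel f g (e x) ∂μ) ^ 2 ≤
      8 * (∫⁻ x, ‖f (e x)‖ₑ ^ 2 ∂μ) *
        ((∫⁻ x, ‖f (e x)‖ₑ ^ 2 ∂μ) + ∫⁻ x, ‖g (e x)‖ₑ ^ 2 ∂μ) := by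
  have h1 : ENNReal.ofReal (1 - (-1) : ℝ)⁻¹ ≤ 1 := by
    rw [ENNReal.ofReal_le_one]; norm_num
  have m1 : Measurable fun x => ‖f (e x)‖ₑ := (hf.comp he).enorm
  have m2 : Measurable fun x => ‖g (e x)‖ₑ := (hg.comp he).enorm
  calc (∫⁻ x, lineKernel f g (e x) ∂μ) ^ 2
      ≤ (∫⁻ x, ‖f (e x)‖ₑ * (‖f (e x)‖ₑ + 2 * ‖g (e x)‖ₑ) ∂μ) ^ 2 := by
        refine pow_le_pow_left₀ (zero_le) (lintegral_mono fun x => ?_) 2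
        unfold lineKernel
        refine (add_le_add (mul_le_mul_left h1 _) le_rfl).trans (le_of_eq ?_)
        ring
    _ ≤ (∫⁻ x, ‖f (e x)‖ₑ ^ 2 ∂μ) * ∫⁻ x, (‖f (e x)‖ₑ + 2 * ‖g (e x)‖ₑ) ^ 2 ∂μ :=
        sq_lintegral_mul_le m1.aemeasurable (m1.add (m2.const_mul 2)).aemeasurable
    _ ≤ (∫⁻ x, ‖f (e x)‖ₑ ^ 2 ∂μ) * ∫⁻ x, 8 * (‖f (e x)‖ₑ ^ 2 + ‖g (e x)‖ₑ ^ 2) ∂μ := by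
        refine mul_le_mul_right (lintegral_mono fun x => ?_) _
        refine (enn_add_sq_le _ _).trans ?_
        rw [mul_pow, mul_add, mul_add]
        refine add_le_add (mul_le_mul_left (by norm_num) _) (le_of_eq ?_)
        ring
    _ = _ := by
        rw [lintegral_const_mul 8 (f := fun x => ‖f (e x)‖ₑ ^ 2 + ‖g (e x)‖ₑ ^ 2)
          ((m1.pow_const 2).add (m2.pow_const 2)), lintegral_add_left (m1.pow_const 2)]
        ring

/-- Anisotropic Ladyzhenskaya inequality. -/
theorem aniso_le {T : ℝ} {f fx fy : Field} (hx : HasWeakDeriv T (zInterior T) eX f fx)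
    (hy : HasWeakDeriv T (zInterior T) eY f fy) {B : ℝ≥0∞}
    (hB : ∀ᵐ t ∂(muT T), ∫⁻ r, ‖f (t, r)‖ₑ ^ 2 ∂(muJ.prod (muJ.prod muJ)) ≤ B) :
    aniso T f ≤ 8 * B * (sq T f + sq T fx + sq T fy) := by
  -- Measurable representatives make slices and line integrals measurable; every quantity involved
  -- is insensitive to null sets.
  wlog hmeas : Measurable f ∧ Measurable fx ∧ Measurable fy generalizing f fx fy
  · have e := hx.1.1.ae_eq_mk
    have ex := hx.2.1.1.ae_eq_mk
    have ey := hy.2.1.1.ae_eq_mk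
    rw [aniso_congr e, sq_congr e, sq_congr ex, sq_congr ey]
    refine this (hx.congr e ex) (hy.congr e ey) ?_
      ⟨hx.1.1.stronglyMeasurable_mk.measurable, hx.2.1.1.stronglyMeasurable_mk.measurable,
        hy.2.1.1.stronglyMeasurable_mk.measurable⟩
    have e' : ∀ᵐ p ∂((muT T).prod (muJ.prod (muJ.prod muJ))), f p = hx.1.1.mk f p :=
      (mu_eq T) ▸ e
    filter_upwards [hB, Measure.ae_ae_of_ae_prod e'] with t ht ht'
    refine le_trans (le_of_eq (lintegral_congr_ae ?_)) ht
    filter_upwards [ht'] with r hr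
    rw [hr]
  obtain ⟨mf, mx, my⟩ := hmeas
  have b1 : ∀ᵐ p ∂(mu T), ‖f p‖ₑ ^ 2 ≤ ∫⁻ x, lineKernel f fx (p.1, x, p.2.2) ∂muJ := by
    refine ae_of_ae_lines insX (measurePreserving_insX T) (MeasurableSet.nullMeasurableSet
      (measurableSet_le (mf.enorm.pow_const 2) ?_)) ?_
    · exact Measurable.lintegral_prod_right'
        (f := fun r : Pt × ℝ => lineKernel f fx (r.1.1, r.2, r.1.2.2))
        ((measurable_lineKernel mf mx).comp (by fun_prop))
    · filter_upwards [ae_perPrim_X hx] with q hq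
      exact hq.prim.sq_le (by norm_num)
  have b2 : ∀ᵐ p ∂(mu T), ‖f p‖ₑ ^ 2 ≤ ∫⁻ y, lineKernel f fy (p.1, p.2.1, y, p.2.2.2) ∂muJ := by
    refine ae_of_ae_lines insY (measurePreserving_insY T) (MeasurableSet.nullMeasurableSet
      (measurableSet_le (mf.enorm.pow_const 2) ?_)) ?_
    · exact Measurable.lintegral_prod_right'
        (f := fun r : Pt × ℝ => lineKernel f fy (r.1.1, r.1.2.1, r.2, r.1.2.2.2))
        ((measurable_lineKernel mf my).comp (by fun_prop))
    · filter_upwards [ae_perPrim_Y hy] with q hq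
      exact hq.prim.sq_le (by norm_num)
  rw [mu_eq] at b1 b2
  refine (lintegral_sq_le_of_cross_bounds (measurable_lineKernel mf mx)
    (measurable_lineKernel mf my) b1 b2).trans ?_
  set S : (Pt → ℝ) → ℝ → ℝ≥0∞ := fun f t => ∫⁻ r, ‖f (t, r)‖ₑ ^ 2 ∂(muJ.prod (muJ.prod muJ)) with hS
  have mS : ∀ {f : Field}, Measurable f → Measurable (S f) := fun {f} hf =>
    Measurable.lintegral_prod_right' (f := fun p : Pt => ‖f p‖ₑ ^ 2) (hf.enorm.pow_const 2)
  have iS : ∀ {f : Field}, Measurable f → ∫⁻ t, S f t ∂(muT T) = sq T f := fun {f} hf => by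
    rw [sq_eq, mu_eq, lintegral_prod _ (hf.enorm.pow_const 2).aemeasurable]
  calc _ ≤ ∫⁻ t, 8 * B * (S f t + S fx t + S fy t) ∂(muT T) := by
        refine lintegral_mono_ae ?_
        filter_upwards [hB] with t ht
        have c1 := sq_lintegral_lineKernel_le (μ := muJ.prod (muJ.prod muJ)) (e := fun r => (t, r))
          measurable_prodMk_left mf mx
        have c2 := sq_lintegral_lineKernel_le (μ := muJ.prod (muJ.prod muJ)) (e := fun r => (t, r))
          measurable_prodMk_left mf my
        -- The square of each of the two factors is at most `8 B` times the sum in parentheses;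
        -- comparing squares avoids roots.
        refine enn_le_of_sq_le ?_
        rw [mul_pow, pow_two (8 * B * _)]
        refine mul_le_mul' (c1.trans ?_) (c2.trans ?_)
        · refine mul_le_mul' (mul_le_mul_right ht _) le_self_add
        · refine mul_le_mul' (mul_le_mul_right ht _) ?_
          rw [add_right_comm]; exact le_self_add
    _ = _ := by
        rw [lintegral_const_mul (8 * B) (f := fun t => S f t + S fx t + S fy t)
          (((mS mf).add (mS mx)).add (mS my)),
          lintegral_add_left (f := fun t => S f t + S fx t) ((mS mf).add (mS mx)), lintegral_add_left (mS mf), iS mf, iS mx, iS my]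

/-- The product estimate `L⁴_t L^∞_z L⁴_xy × L⁴_t L²_z L⁴_xy → L²`, where the first factor is
controlled through the `L²`-norm in `z` of two functions. -/
theorem sq_mul_le {T : ℝ} {a b F₁ F₂ : Field} (ha : AEStronglyMeasurable a (mu T))
    (hb : AEStronglyMeasurable b (mu T)) (h₁ : AEStronglyMeasurable F₁ (mu T))
    (h₂ : AEStronglyMeasurable F₂ (mu T)) (c : ℝ≥0∞)
    (h : ∀ᵐ p ∂(mu T), ‖a p‖ₑ ^ 2 ≤ c * ∫⁻ z, (‖F₁ (p.1, p.2.1, p.2.2.1, z)‖ₑ ^ 2 +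
      ‖F₂ (p.1, p.2.1, p.2.2.1, z)‖ₑ ^ 2) ∂muJ) :
    sq T (fun p => a p * b p) ^ 2 ≤ 2 * c ^ 2 * (aniso T F₁ + aniso T F₂) * aniso T b := by
  wlog hmeas : Measurable a ∧ Measurable b ∧ Measurable F₁ ∧ Measurable F₂
      generalizing a b F₁ F₂
  · have ea := ha.ae_eq_mk
    have eb := hb.ae_eq_mk
    have e1 := h₁.ae_eq_mk
    have e2 := h₂.ae_eq_mk
    rw [aniso_congr eb, aniso_congr e1, aniso_congr e2,
      sq_congr (show (fun p => a p * b p) =ᵐ[mu T] fun p => ha.mk a p * hb.mk b p from ea.mul eb)]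
    refine this ha.stronglyMeasurable_mk.aestronglyMeasurable
      hb.stronglyMeasurable_mk.aestronglyMeasurable
      h₁.stronglyMeasurable_mk.aestronglyMeasurable h₂.stronglyMeasurable_mk.aestronglyMeasurable
      ?_ ⟨ha.stronglyMeasurable_mk.measurable, hb.stronglyMeasurable_mk.measurable,
        h₁.stronglyMeasurable_mk.measurable, h₂.stronglyMeasurable_mk.measurable⟩
    have hl := ae_ae_swap ((measurePreserving_insZ T).quasiMeasurePreserving.ae (e1.and e2))
    have hl' : ∀ᵐ p ∂(mu T), ∀ᵐ z ∂muJ, F₁ (insZ (z, p.1, p.2.1, p.2.2.1)) =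
        h₁.mk F₁ (insZ (z, p.1, p.2.1, p.2.2.1)) ∧ F₂ (insZ (z, p.1, p.2.1, p.2.2.1)) =
        h₂.mk F₂ (insZ (z, p.1, p.2.1, p.2.2.1)) :=
      (Measure.quasiMeasurePreserving_snd.comp
        (measurePreserving_insZ T).symm.quasiMeasurePreserving).ae hl
    filter_upwards [h, ea, hl'] with p hp hpa hpl
    rw [← hpa]
    refine hp.trans (mul_le_mul_right (le_of_eq (lintegral_congr_ae ?_)) _)
    filter_upwards [hpl] with z hz
    have z1 : F₁ (p.1, p.2.1, p.2.2.1, z) = h₁.mk F₁ (p.1, p.2.1, p.2.2.1, z) := hz.1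
    have z2 : F₂ (p.1, p.2.1, p.2.2.1, z) = h₂.mk F₂ (p.1, p.2.1, p.2.2.1, z) := hz.2
    rw [z1, z2]
  obtain ⟨ma, mb, m1, m2⟩ := hmeas
  set Q : Field → ℝ × ℝ × ℝ → ℝ≥0∞ := fun F q => ∫⁻ z, ‖F (q.1, q.2.1, q.2.2, z)‖ₑ ^ 2 ∂muJ with hQ
  have mQ : ∀ {F : Field}, Measurable F → Measurable (Q F) := fun {F} hF =>
    Measurable.lintegral_prod_right'
      (f := fun r : (ℝ × ℝ × ℝ) × ℝ => ‖F (r.1.1, r.1.2.1, r.1.2.2, r.2)‖ₑ ^ 2)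
      ((hF.enorm.pow_const 2).comp (f := fun r : (ℝ × ℝ × ℝ) × ℝ =>
        (r.1.1, r.1.2.1, r.1.2.2, r.2)) (by fun_prop))
  set P : ℝ × ℝ × ℝ → ℝ≥0∞ := fun q => c * (Q F₁ q + Q F₂ q) with hP
  have mP : Measurable P := ((mQ m1).add (mQ m2)).const_mul c
  have hb' : ∀ᵐ p ∂(mu T), ‖a p‖ₑ ^ 2 ≤ P (p.1, p.2.1, p.2.2.1) := by
    filter_upwards [h] with p hp
    refine hp.trans (le_of_eq ?_)
    simp only [hP, hQ]
    rw [lintegral_add_left]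
    exact (m1.comp (by fun_prop)).enorm.pow_const 2
  rw [mu_eq] at hb'
  -- Cauchy-Schwarz in `(t, x, y)` is applied to `|a|²` and `|b|²`, so its square form controls the
  -- fourth power of the `L²` norm.
  have main := sq_lintegral_mul_le_aniso (ma.enorm.pow_const 2) (mb.enorm.pow_const 2) mP hb'
  rw [← mu_eq] at main
  have e : sq T (fun p => a p * b p) = ∫⁻ p, ‖a p‖ₑ ^ 2 * ‖b p‖ₑ ^ 2 ∂(mu T) := by
    rw [sq_eq]
    refine lintegral_congr fun p => ?_
    rw [enorm_mul, mul_pow]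
  rw [e]
  refine main.trans (mul_le_mul_left ?_ _)
  have split : ∀ f : ℝ × ℝ × ℝ → ℝ≥0∞, Measurable f →
      ∫⁻ q, f q ∂((muT T).prod (muJ.prod muJ)) = ∫⁻ t, ∫⁻ x, ∫⁻ y, f (t, x, y) ∂muJ ∂muJ ∂(muT T) := by
    intro f hf
    rw [lintegral_prod _ hf.aemeasurable]
    refine lintegral_congr fun t => ?_
    exact lintegral_prod _ (hf.comp measurable_prodMk_left).aemeasurable
  have iQ : ∀ {F : Field}, Measurable F →
      ∫⁻ q, Q F q ^ 2 ∂((muT T).prod (muJ.prod muJ)) = aniso T F := fun {F} hF =>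
    split _ ((mQ hF).pow_const 2)
  rw [← split _ (mP.pow_const 2), ← iQ m1, ← iQ m2, ← lintegral_add_left ((mQ m1).pow_const 2),
    ← lintegral_const_mul (2 * c ^ 2) (f := fun q => Q F₁ q ^ 2 + Q F₂ q ^ 2)
      (((mQ m1).pow_const 2).add ((mQ m2).pow_const 2))]
  refine lintegral_mono fun q => ?_
  simp only [hP]
  rw [mul_pow]
  calc c ^ 2 * (Q F₁ q + Q F₂ q) ^ 2 ≤ c ^ 2 * (2 * (Q F₁ q ^ 2 + Q F₂ q ^ 2)) :=
        mul_le_mul_right (enn_add_sq_le _ _) _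
    _ = _ := by ring

/-! ### Boundedness in time -/

lemma lintegral_shift_le {T h r : ℝ} (h0 : 0 ≤ r) (hr : r ≤ h) (k : ℝ → ℝ≥0∞) :
    ∫⁻ τ in Ioo 0 (T - h), k (τ + r) ≤ ∫⁻ τ in Ioo 0 T, k τ := by
  rw [← lintegral_indicator measurableSet_Ioo, ← lintegral_indicator measurableSet_Ioo,
    ← lintegral_add_right_eq_self ((Ioo 0 T).indicator k) r]
  refine lintegral_mono fun τ => ?_
  by_cases hτ : τ ∈ Ioo 0 (T - h)
  · have hm : τ + r ∈ Ioo 0 T := ⟨by linarith [hτ.1], by linarith [hτ.2]⟩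
    rw [indicator_of_mem hτ, indicator_of_mem hm]
  · rw [indicator_of_notMem hτ]; exact zero_le

lemma ae_shift {T h : ℝ} (h0 : 0 ≤ h) {p : ℝ → Prop} (hp : ∀ᵐ s ∂(muT T), p s) :
    ∀ᵐ τ ∂(volume.restrict (Ioo 0 (T - h))), p (τ + h) ∧ p τ := by
  rw [ae_restrict_iff' measurableSet_Ioo] at hp ⊢
  filter_upwards [hp, (measurePreserving_add_right volume h).quasiMeasurePreserving.ae hp]
    with τ h1 h2 hτ
  exact ⟨h2 ⟨by linarith [hτ.1], by linarith [hτ.2]⟩, h1 ⟨hτ.1, by linarith [hτ.2]⟩⟩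

/-- The `L²`-norm of an increment of a primitive. -/
lemma Prim.lintegral_increment_sq_le {T h : ℝ} (hT : 0 < T) (h0 : 0 < h) {u k : ℝ → ℝ}
    (hk : Measurable k) (hu : Prim 0 T u k) :
    ∫⁻ τ in Ioo 0 (T - h), ‖u (τ + h) - u τ‖ₑ ^ 2 ≤
      ENNReal.ofReal h ^ 2 * ∫⁻ τ in Ioo 0 T, ‖k τ‖ₑ ^ 2 := by
  obtain ⟨E, hE, hEE⟩ := hu.sub_eq hT.le
  have mk2 : Measurable fun q : ℝ × ℝ => ‖k (q.1 + q.2)‖ₑ ^ 2 :=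
    ((hk.comp (measurable_fst.add measurable_snd)).enorm).pow_const 2
  calc ∫⁻ τ in Ioo 0 (T - h), ‖u (τ + h) - u τ‖ₑ ^ 2
      ≤ ∫⁻ τ in Ioo 0 (T - h), ENNReal.ofReal h * ∫⁻ r in Ioc 0 h, ‖k (τ + r)‖ₑ ^ 2 := by
        refine lintegral_mono_ae ?_
        filter_upwards [ae_shift h0.le hE, ae_restrict_mem measurableSet_Ioo] with τ hτ hτi
        rw [hEE _ hτ.1 _ hτ.2 ⟨by linarith [hτi.1], by linarith [hτi.2]⟩
          ⟨hτi.1, by linarith [hτi.2]⟩, intervalIntegral.integral_of_le (by linarith)]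
        have e : ∫⁻ σ in Ioc τ (τ + h), ‖k σ‖ₑ = ∫⁻ r in Ioc 0 h, ‖k (τ + r)‖ₑ := by
          rw [← lintegral_indicator measurableSet_Ioc, ← lintegral_indicator measurableSet_Ioc,
            ← lintegral_add_left_eq_self _ τ]
          refine lintegral_congr fun r => ?_
          by_cases hr : r ∈ Ioc 0 h
          · have hm : τ + r ∈ Ioc τ (τ + h) := ⟨by linarith [hr.1], by linarith [hr.2]⟩
            rw [indicator_of_mem hr, indicator_of_mem hm]
          · rw [indicator_of_notMem hr, indicator_of_notMem]
            exact fun hm => hr ⟨by linarith [hm.1], by linarith [hm.2]⟩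
        refine (pow_le_pow_left₀ zero_le (enorm_integral_le_lintegral_enorm _) 2).trans ?_
        rw [e]
        have mk1 : Measurable fun r => ‖k (τ + r)‖ₑ := (hk.comp (measurable_const_add τ)).enorm
        have := sq_lintegral_mul_le (μ := volume.restrict (Ioc 0 h)) (f := fun _ => 1)
          aemeasurable_const mk1.aemeasurable
        simpa using this
    -- One factor `h` comes from Cauchy-Schwarz, the other from the integral over the shift `r`
    -- after exchanging the order of integration.
    _ = ENNReal.ofReal h * ∫⁻ r in Ioc 0 h, ∫⁻ τ in Ioo 0 (T - h), ‖k (τ + r)‖ₑ ^ 2 := by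
        rw [lintegral_const_mul _ (Measurable.lintegral_prod_right' mk2),
          lintegral_lintegral_swap mk2.aemeasurable]
    _ ≤ ENNReal.ofReal h * ∫⁻ r in Ioc 0 h, ∫⁻ τ in Ioo 0 T, ‖k τ‖ₑ ^ 2 := by
        refine mul_le_mul_right (setLIntegral_mono' measurableSet_Ioc fun r hr => ?_) _
        exact lintegral_shift_le hr.1.le hr.2 (fun τ => ‖k τ‖ₑ ^ 2)
    _ = _ := by
        rw [setLIntegral_const, Real.volume_Ioc, sub_zero]; ring

/-- A function whose increments are of size `h K` in `L¹` oscillates by at most `K`. -/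
lemma ae_sub_le_of_increments {T : ℝ} {g : ℝ → ℝ} {K : ℝ} (hK : 0 ≤ K)
    (hg : IntegrableOn g (Ioo 0 T))
    (h : ∀ h, 0 < h → h < T → ∫⁻ τ in Ioo 0 (T - h), ‖g (τ + h) - g τ‖ₑ ≤ ENNReal.ofReal (h * K)) :
    ∃ E : Set ℝ, (∀ᵐ t ∂(muT T), t ∈ E) ∧ ∀ t ∈ E, ∀ s ∈ E, g t - g s ≤ K := by
  rcases le_or_gt T 0 with hT | hT
  · exact ⟨∅, by simp [muT, Ioo_eq_empty (not_lt.2 hT)], by simp⟩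
  have hi := intervalIntegrable_of_Ioo hT.le hg
  -- At such times `g` is the limit of difference quotients of its primitive.
  refine ⟨{t | t ∈ Ioo 0 T ∧ HasDerivAt (fun x => ∫ σ in (0 : ℝ)..x, g σ) (g t) t}, ?_, ?_⟩
  · filter_upwards [ae_restrict_of_ae hi.ae_hasDerivAt_integral, ae_restrict_mem measurableSet_Ioo]
      with t ht hti
    exact ⟨hti, ht (by rw [uIcc_of_le hT.le]; exact Ioo_subset_Icc_self hti) 0 left_mem_uIcc⟩
  rintro t ⟨ht, dt⟩ s ⟨hs, ds⟩
  set P : ℝ → ℝ := fun x => ∫ σ in (0 : ℝ)..x, g σ with hP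
  have lim := (dt.tendsto_slope_zero_right).sub (ds.tendsto_slope_zero_right)
  refine le_of_tendsto lim ?_
  have hm : Ioo 0 (min (T - t) (T - s)) ∈ nhdsWithin (0 : ℝ) (Ioi 0) :=
    Ioo_mem_nhdsGT (lt_min (sub_pos.2 ht.2) (sub_pos.2 hs.2))
  filter_upwards [hm] with η hη
  obtain ⟨h1, h2⟩ := lt_min_iff.1 hη.2
  have hη0 := hη.1
  rw [smul_eq_mul, smul_eq_mul, ← mul_sub, inv_mul_le_iff₀ hη0]
  have ii : ∀ a ∈ Icc 0 T, ∀ b ∈ Icc 0 T, IntervalIntegrable g volume a b := fun a ha b hb =>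
    hi.mono_set (by rw [uIcc_of_le hT.le]; exact ordConnected_Icc.uIcc_subset ha hb)
  have z : (0 : ℝ) ∈ Icc 0 T := left_mem_Icc.2 hT.le
  have mt : t ∈ Icc 0 T := Ioo_subset_Icc_self ht
  have ms : s ∈ Icc 0 T := Ioo_subset_Icc_self hs
  have mt' : t + η ∈ Icc 0 T := ⟨by linarith [ht.1], by linarith⟩
  have ms' : s + η ∈ Icc 0 T := ⟨by linarith [hs.1], by linarith⟩
  -- The difference of two short averages, at `t` and at `s`, is the integral of an increment of `g`
  -- over the interval between `s` and `t`.
  have e : P (t + η) - P t - (P (s + η) - P s) = ∫ τ in s..t, (g (τ + η) - g τ) := by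
    have i1 : IntervalIntegrable (fun τ => g (τ + η)) volume s t := by
      have := (ii _ ms' _ mt').comp_add_right η
      simpa using this
    rw [intervalIntegral.integral_sub i1 (ii _ ms _ mt), intervalIntegral.integral_comp_add_right,
      ← intervalIntegral.integral_interval_sub_left (ii _ z _ mt') (ii _ z _ ms'),
      ← intervalIntegral.integral_interval_sub_left (ii _ z _ mt) (ii _ z _ ms)]
    simp only [hP]; ring
  rw [e]
  refine (le_abs_self _).trans ?_
  rw [← Real.norm_eq_abs, ← ENNReal.ofReal_le_ofReal_iff (by positivity), 
    intervalIntegral.norm_integral_eq_norm_integral_uIoc, ofReal_norm]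
  refine (enorm_integral_le_lintegral_enorm _).trans (le_trans ?_ (h η hη0 (by linarith [ht.1])))
  refine lintegral_mono_set fun x hx => ?_
  rcases mem_uIoc.1 hx with hx | hx
  · exact ⟨by linarith [hx.1, hs.1], by linarith [hx.2]⟩
  · exact ⟨by linarith [hx.1, ht.1], by linarith [hx.2]⟩

section parabolic

variable {X : Type*} [MeasurableSpace X] {ν : Measure X} [IsFiniteMeasure ν] {T : ℝ}

lemma memLp_two_slice {f : ℝ × X → ℝ} (hm : Measurable f) (hf : MemLp f 2 ((muT T).prod ν)) :
    ∀ᵐ t ∂(muT T), MemLp (fun r => f (t, r)) 2 ν := by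
  filter_upwards [hf.integrable_sq.prod_right_ae] with t ht
  exact (memLp_two_iff_integrable_sq (hm.comp measurable_prodMk_left).aestronglyMeasurable).2 ht

/-- If `‖F(t)‖² ` polarizes as `-⟨f(t), F'(s)⟩` for almost all times, with `F'` and `∂_t f` in `L²`,
then `F` is bounded in time with values in `L²`. -/
theorem ae_lintegral_sq_le_of_polar (hT : 0 < T) {f k F F' : ℝ × X → ℝ} (mf : Measurable f)
    (mk : Measurable k) (mF : Measurable F) (mF' : Measurable F')
    (hf : MemLp f 2 ((muT T).prod ν)) (hk : MemLp k 2 ((muT T).prod ν))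
    (hF : MemLp F 2 ((muT T).prod ν)) (hF' : MemLp F' 2 ((muT T).prod ν))
    (hprim : ∀ᵐ x ∂ν, Prim 0 T (fun t => f (t, x)) (fun t => k (t, x)))
    {E : Set ℝ} (hE : ∀ᵐ t ∂(muT T), t ∈ E)
    (hpolar : ∀ t ∈ E, ∀ s ∈ E, ∫ x, F (t, x) * F (s, x) ∂ν = - ∫ x, f (t, x) * F' (s, x) ∂ν) :
    ∀ᵐ t ∂(muT T), ∫⁻ x, ‖F (t, x)‖ₑ ^ 2 ∂ν ≤ ENNReal.ofReal T⁻¹ *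
      (∫⁻ p, ‖F p‖ₑ ^ 2 ∂((muT T).prod ν)) + (∫⁻ p, ‖k p‖ₑ ^ 2 ∂((muT T).prod ν)) +
        ∫⁻ p, ‖F' p‖ₑ ^ 2 ∂((muT T).prod ν) := by
  set A := ∫⁻ p, ‖k p‖ₑ ^ 2 ∂((muT T).prod ν) with hA
  set B := ∫⁻ p, ‖F' p‖ₑ ^ 2 ∂((muT T).prod ν) with hB
  have hAt : A ≠ ⊤ := by rw [hA, ← eLpNorm_two_sq]; exact ENNReal.pow_ne_top hk.2.ne
  have hBt : B ≠ ⊤ := by rw [hB, ← eLpNorm_two_sq]; exact ENNReal.pow_ne_top hF'.2.ne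
  set g : ℝ → ℝ := fun t => ∫ x, F (t, x) ^ 2 ∂ν with hg
  have hgi : IntegrableOn g (Ioo 0 T) := hF.integrable_sq.integral_prod_left
  set G : ℝ → Prop := fun t => t ∈ E ∧ MemLp (fun x => f (t, x)) 2 ν ∧
    MemLp (fun x => F (t, x)) 2 ν ∧ MemLp (fun x => F' (t, x)) 2 ν with hG
  have hGae : ∀ᵐ t ∂(muT T), G t := by
    filter_upwards [hE, memLp_two_slice mf hf, memLp_two_slice mF hF, memLp_two_slice mF' hF']
      with t h1 h2 h3 h4 using ⟨h1, h2, h3, h4⟩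
  -- On expanding the product, the mixed terms `⟨F(t), F(s)⟩` and `⟨F(s), F(t)⟩` cancel.
  have diff : ∀ t s, G t → G s →
      g t - g s = - ∫ x, (f (t, x) - f (s, x)) * (F' (t, x) + F' (s, x)) ∂ν := by
    rintro t s ⟨ht, f1, -, F1⟩ ⟨hs, f2, -, F2⟩
    have e : ∀ x, (f (t, x) - f (s, x)) * (F' (t, x) + F' (s, x)) =
        (f (t, x) * F' (t, x) + f (t, x) * F' (s, x)) -
          (f (s, x) * F' (t, x) + f (s, x) * F' (s, x)) := fun x => by ring
    simp only [e]
    have i := fun {a b : X → ℝ} (ha : MemLp a 2 ν) (hb : MemLp b 2 ν) =>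
      (show Integrable (fun x => a x * b x) ν from ha.integrable_mul hb)
    rw [integral_sub (f := fun x => f (t, x) * F' (t, x) + f (t, x) * F' (s, x))
      (g := fun x => f (s, x) * F' (t, x) + f (s, x) * F' (s, x))
      ((i f1 F1).add (i f1 F2)) ((i f2 F1).add (i f2 F2)),
      integral_add (i f1 F1) (i f1 F2), integral_add (i f2 F1) (i f2 F2)]
    have p1 := hpolar t ht t ht
    have p2 := hpolar t ht s hs
    have p3 := hpolar s hs t ht
    have p4 := hpolar s hs s hs
    have c : ∫ x, F (t, x) * F (s, x) ∂ν = ∫ x, F (s, x) * F (t, x) ∂ν := by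
      congr 1; ext x; ring
    simp only [hg, pow_two]
    linarith
  have incr : ∀ h, 0 < h → h < T → ∫⁻ τ in Ioo 0 (T - h), ‖g (τ + h) - g τ‖ₑ ≤
      ENNReal.ofReal (h * (A + B).toReal) := by
    intro h h0 hhT
    rw [ENNReal.ofReal_mul h0.le, ENNReal.ofReal_toReal (ENNReal.add_ne_top.2 ⟨hAt, hBt⟩)]
    set μ := volume.restrict (Ioo 0 (T - h)) with hμ
    have m1 : Measurable fun p : ℝ × X => ‖f (p.1 + h, p.2) - f p‖ₑ :=
      ((mf.comp (by fun_prop)).sub mf).enorm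
    have m2 : Measurable fun p : ℝ × X => ‖F' (p.1 + h, p.2) + F' p‖ₑ :=
      ((mF'.comp (by fun_prop)).add mF').enorm
    have s1 : ∫⁻ τ, ‖g (τ + h) - g τ‖ₑ ∂μ ≤
        ∫⁻ p, ‖f (p.1 + h, p.2) - f p‖ₑ * ‖F' (p.1 + h, p.2) + F' p‖ₑ ∂(μ.prod ν) := by
      rw [lintegral_prod (fun p : ℝ × X => ‖f (p.1 + h, p.2) - f p‖ₑ * ‖F' (p.1 + h, p.2) + F' p‖ₑ)
        (m1.mul m2).aemeasurable]
      refine lintegral_mono_ae ?_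
      filter_upwards [ae_shift h0.le hGae] with τ hτ
      rw [diff _ _ hτ.1 hτ.2, enorm_neg]
      refine (enorm_integral_le_lintegral_enorm _).trans (le_of_eq ?_)
      simp only [enorm_mul]
    have s2 : ∫⁻ p, ‖f (p.1 + h, p.2) - f p‖ₑ ^ 2 ∂(μ.prod ν) ≤ ENNReal.ofReal h ^ 2 * A := by
      rw [lintegral_prod_symm _ (m1.pow_const 2).aemeasurable, hA,
        lintegral_prod_symm _ (mk.enorm.pow_const 2).aemeasurable,
        ← lintegral_const_mul _ (Measurable.lintegral_prod_left' (mk.enorm.pow_const 2))]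
      refine lintegral_mono_ae ?_
      filter_upwards [hprim] with x hx
      exact hx.lintegral_increment_sq_le hT h0 (mk.comp measurable_prodMk_right)
    have s3 : ∫⁻ p, ‖F' (p.1 + h, p.2) + F' p‖ₑ ^ 2 ∂(μ.prod ν) ≤ 4 * B := by
      have sh : ∀ r, 0 ≤ r → r ≤ h → ∫⁻ p, ‖F' (p.1 + r, p.2)‖ₑ ^ 2 ∂(μ.prod ν) ≤ B := by
        intro r hr0 hr
        have m4 : Measurable fun p : ℝ × X => ‖F' (p.1 + r, p.2)‖ₑ ^ 2 :=
          (mF'.comp (by fun_prop)).enorm.pow_const 2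
        rw [lintegral_prod_symm _ m4.aemeasurable, hB,
          lintegral_prod_symm _ (mF'.enorm.pow_const 2).aemeasurable]
        refine lintegral_mono fun x => ?_
        exact lintegral_shift_le hr0 hr fun τ => ‖F' (τ, x)‖ₑ ^ 2
      calc _ ≤ ∫⁻ p, 2 * (‖F' (p.1 + h, p.2)‖ₑ ^ 2 + ‖F' (p.1 + 0, p.2)‖ₑ ^ 2) ∂(μ.prod ν) := by
            refine lintegral_mono fun p => ?_
            refine (pow_le_pow_left₀ zero_le (enorm_add_le _ _) 2).trans ?_
            rw [add_zero]
            exact enn_add_sq_le _ _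
        _ ≤ 2 * (B + B) := by
            have m3 : ∀ r : ℝ, Measurable fun p : ℝ × X => ‖F' (p.1 + r, p.2)‖ₑ ^ 2 := fun r =>
              (mF'.comp (by fun_prop)).enorm.pow_const 2
            rw [lintegral_const_mul 2 (f := fun p : ℝ × X => ‖F' (p.1 + h, p.2)‖ₑ ^ 2 +
              ‖F' (p.1 + 0, p.2)‖ₑ ^ 2) ((m3 h).add (m3 0)), lintegral_add_left (m3 h)]
            exact mul_le_mul_right (add_le_add (sh h h0.le le_rfl) (sh 0 le_rfl h0.le)) _
        _ = 4 * B := by ring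
    -- The increment of `f` contributes `h √A`, the sum of the values of `F'` contributes `2 √B`,
    -- and `2 √A √B ≤ A + B`.
    refine s1.trans (enn_le_of_sq_le ((sq_lintegral_mul_le m1.aemeasurable m2.aemeasurable).trans ?_))
    refine (mul_le_mul' s2 s3).trans ?_
    rw [mul_pow, mul_assoc]
    refine mul_le_mul_right ?_ _
    calc A * (4 * B) = 2 * A * B + 2 * A * B := by ring
      _ ≤ 2 * A * B + (A ^ 2 + B ^ 2) := add_le_add le_rfl (enn_two_mul_le _ _)
      _ = (A + B) ^ 2 := by ring
  obtain ⟨E', hE', hosc⟩ := ae_sub_le_of_increments ENNReal.toReal_nonneg hgi incr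
  filter_upwards [hE', hGae] with t ht hGt
  -- Averaging `g t ≤ g s + (A + B)` over `s`.
  have avg : g t ≤ T⁻¹ * (∫ s in Ioo 0 T, g s) + (A + B).toReal := by
    have := integral_mono_ae (μ := muT T) (integrable_const (g t))
      (hgi.add (integrable_const (A + B).toReal)) (by
        filter_upwards [hE'] with s hs
        simp only [Pi.add_apply]
        linarith [hosc t ht s hs])
    simp only [Pi.add_apply] at this
    rw [integral_add hgi (integrable_const _), setIntegral_const, setIntegral_const] at this
    simp only [measureReal_def, Real.volume_Ioo, sub_zero, ENNReal.toReal_ofReal hT.le,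
      smul_eq_mul] at this
    rw [← mul_le_mul_iff_right₀ hT, mul_add, ← mul_assoc, mul_inv_cancel₀ hT.ne', one_mul]
    exact this
  have toG : ∫⁻ x, ‖F (t, x)‖ₑ ^ 2 ∂ν = ENNReal.ofReal (g t) := by
    rw [hg, ofReal_integral_eq_lintegral_ofReal hGt.2.2.1.integrable_sq
      (ae_of_all _ fun x => sq_nonneg _)]
    refine lintegral_congr fun x => ?_
    rw [Real.enorm_eq_ofReal_abs, ← ENNReal.ofReal_pow (abs_nonneg _), sq_abs]
  have toI : ∫⁻ p, ‖F p‖ₑ ^ 2 ∂((muT T).prod ν) = ENNReal.ofReal (∫ s in Ioo 0 T, g s) := by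
    rw [hg, ← integral_prod _ hF.integrable_sq,
      ofReal_integral_eq_lintegral_ofReal hF.integrable_sq (ae_of_all _ fun x => sq_nonneg _)]
    refine lintegral_congr fun x => ?_
    rw [Real.enorm_eq_ofReal_abs, ← ENNReal.ofReal_pow (abs_nonneg _), sq_abs]
  rw [toG, toI, ← ENNReal.ofReal_mul (by positivity), add_assoc,
    ← ENNReal.ofReal_toReal (ENNReal.add_ne_top.2 ⟨hAt, hBt⟩)]
  exact (ENNReal.ofReal_le_ofReal avg).trans ENNReal.ofReal_add_le

end parabolic

lemma PerPrim.congr {u u' g g' : ℝ → ℝ} (h : PerPrim u g) (hu : u =ᵐ[muJ] u')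
    (hg : g =ᵐ[muJ] g') : PerPrim u' g' :=
  ⟨h.prim.congr hu hg, by rw [← h.mean]; exact integral_congr_ae hg.symm⟩

/-- Parabolic regularity in one periodic direction, given by the equivalence `e`: if
`f, ∂_t f, ∂_e f, ∂_e² f ∈ L²` then `∂_e f` is bounded in time with values in `L²`. -/
theorem ae_lintegral_sq_le_of_perPrim {T : ℝ} (hT : 0 < T) {f k F F' : Field}
    (ht : HasWeakDeriv T (zInterior T) eT f k) (hF : MemLp F 2 (mu T)) (hF' : MemLp F' 2 (mu T))
    (e : ℝ × (ℝ × ℝ) ≃ᵐ ℝ × ℝ × ℝ)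
    (he : MeasurePreserving e (muJ.prod (muJ.prod muJ)) (muJ.prod (muJ.prod muJ)))
    (h1 : ∀ᵐ q ∂((muT T).prod (muJ.prod muJ)),
      PerPrim (fun s => f (q.1, e (s, q.2))) (fun s => F (q.1, e (s, q.2))))
    (h2 : ∀ᵐ q ∂((muT T).prod (muJ.prod muJ)),
      PerPrim (fun s => F (q.1, e (s, q.2))) (fun s => F' (q.1, e (s, q.2)))) :
    ∀ᵐ t ∂(muT T), ∫⁻ r, ‖F (t, r)‖ₑ ^ 2 ∂(muJ.prod (muJ.prod muJ)) ≤
      ENNReal.ofReal T⁻¹ * sq T F + sq T k + sq T F' := by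
  wlog hmeas : Measurable f ∧ Measurable k ∧ Measurable F ∧ Measurable F' generalizing f k F F'
  · have ef := ht.1.1.ae_eq_mk
    have ek := ht.2.1.1.ae_eq_mk
    have eF := hF.1.ae_eq_mk
    have eF' := hF'.1.ae_eq_mk
    have hmp : MeasurePreserving (fun q : ℝ × (ℝ × (ℝ × ℝ)) => ((q.2.1, e (q.1, q.2.2)) : Pt))
        (muJ.prod ((muT T).prod (muJ.prod muJ))) (mu T) := by
      rw [mu_eq]
      exact ((MeasurePreserving.id _).prod he).comp (measurePreserving_swapFst _ _ _)
    have hl := ae_ae_swap (hmp.quasiMeasurePreserving.ae (ef.and (eF.and eF')))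
    have := this (ht.congr ef ek) ((memLp_congr_ae eF).1 hF) ((memLp_congr_ae eF').1 hF')
      (by
        filter_upwards [h1, hl] with q hq hl
        exact PerPrim.congr hq (hl.mono fun s hs => hs.1) (hl.mono fun s hs => hs.2.1))
      (by
        filter_upwards [h2, hl] with q hq hl
        exact PerPrim.congr hq (hl.mono fun s hs => hs.2.1) (hl.mono fun s hs => hs.2.2))
      ⟨ht.1.1.stronglyMeasurable_mk.measurable, ht.2.1.1.stronglyMeasurable_mk.measurable,
        hF.1.stronglyMeasurable_mk.measurable, hF'.1.stronglyMeasurable_mk.measurable⟩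
    rw [sq_congr ek, sq_congr eF, sq_congr eF']
    have e' : ∀ᵐ p ∂((muT T).prod (muJ.prod (muJ.prod muJ))), F p = hF.1.mk F p := (mu_eq T) ▸ eF
    filter_upwards [this, Measure.ae_ae_of_ae_prod e'] with t ht ht'
    refine le_trans (le_of_eq (lintegral_congr_ae ?_)) ht
    filter_upwards [ht'] with r hr
    rw [hr]
  obtain ⟨mf, mk, mF, mF'⟩ := hmeas
  have lf := (mu_eq T) ▸ ht.1
  have lk := (mu_eq T) ▸ ht.2.1
  have lF := (mu_eq T) ▸ hF
  have lF' := (mu_eq T) ▸ hF'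
  set ν := muJ.prod (muJ.prod muJ) with hν
  -- The set of good times is fixed before pairs are formed: membership concerns one slice only, so
  -- any two members may be combined.
  have key := ae_lintegral_sq_le_of_polar hT mf mk mF mF' lf lk lF lF' (ae_prim_T hT ht)
    (E := {t | (MemLp (fun r => f (t, r)) 2 ν ∧ MemLp (fun r => F (t, r)) 2 ν ∧
      MemLp (fun r => F' (t, r)) 2 ν) ∧
      ∀ᵐ q ∂(muJ.prod muJ), PerPrim (fun s => f (t, e (s, q))) (fun s => F (t, e (s, q))) ∧
        PerPrim (fun s => F (t, e (s, q))) (fun s => F' (t, e (s, q)))}) (by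
      filter_upwards [memLp_two_slice mf lf, memLp_two_slice mF lF, memLp_two_slice mF' lF',
        Measure.ae_ae_of_ae_prod h1, Measure.ae_ae_of_ae_prod h2] with t a1 a2 a3 a4 a5
      exact ⟨⟨a1, a2, a3⟩, by filter_upwards [a4, a5] with q b1 b2 using ⟨b1, b2⟩⟩) (by
      -- Integration by parts on lines between `f` at time `t` and `F` at time `s`; periodicity of
      -- both removes the boundary terms.
      rintro t ⟨⟨t1, t2, -⟩, t4⟩ s ⟨⟨-, s2, s3⟩, s4⟩
      have i1 : Integrable (fun r => F (t, r) * F (s, r)) ν := t2.integrable_mul s2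
      have i2 : Integrable (fun r => f (t, r) * F' (s, r)) ν := t1.integrable_mul s3
      have j1 := he.integrable_comp_of_integrable i1
      have j2 := he.integrable_comp_of_integrable i2
      rw [← he.integral_comp' (fun r => F (t, r) * F (s, r)),
        ← he.integral_comp' (fun r => f (t, r) * F' (s, r))]
      refine (integral_prod_symm _ j1).trans
        (Eq.trans ?_ (congrArg Neg.neg (integral_prod_symm _ j2)).symm)
      rw [← integral_neg]
      apply integral_congr_ae
      filter_upwards [t4, s4] with q hq1 hq2
      exact hq1.1.prim.integral_mul_eq_neg (by norm_num) hq2.2.prim hq1.1.mean hq2.2.mean)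
  rw [← mu_eq, ← sq_eq, ← sq_eq, ← sq_eq] at key
  exact key

section directions

variable {T : ℝ} {f k F F' : Field}

lemma ae_lintegral_sq_le_X (hT : 0 < T) (ht : HasWeakDeriv T (zInterior T) eT f k)
    (h1 : HasWeakDeriv T (zInterior T) eX f F) (h2 : HasWeakDeriv T (zInterior T) eX F F') :
    ∀ᵐ t ∂(muT T), ∫⁻ r, ‖F (t, r)‖ₑ ^ 2 ∂(muJ.prod (muJ.prod muJ)) ≤
      ENNReal.ofReal T⁻¹ * sq T F + sq T k + sq T F' :=
  ae_lintegral_sq_le_of_perPrim hT ht h1.2.1 h2.2.1 (MeasurableEquiv.refl _)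
    (MeasurePreserving.id _) (ae_perPrim_X h1) (ae_perPrim_X h2)

lemma ae_lintegral_sq_le_Y (hT : 0 < T) (ht : HasWeakDeriv T (zInterior T) eT f k)
    (h1 : HasWeakDeriv T (zInterior T) eY f F) (h2 : HasWeakDeriv T (zInterior T) eY F F') :
    ∀ᵐ t ∂(muT T), ∫⁻ r, ‖F (t, r)‖ₑ ^ 2 ∂(muJ.prod (muJ.prod muJ)) ≤
      ENNReal.ofReal T⁻¹ * sq T F + sq T k + sq T F' :=
  ae_lintegral_sq_le_of_perPrim hT ht h1.2.1 h2.2.1 (swapFst _ _ _)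
    (measurePreserving_swapFst _ _ _) (ae_perPrim_Y h1) (ae_perPrim_Y h2)

/-- In the vertical direction the boundary terms at `z = ± 1` cancel only by periodicity, hence the
tests in `zPeriodic`. -/
lemma ae_lintegral_sq_le_Z (hT : 0 < T) (ht : HasWeakDeriv T (zInterior T) eT f k)
    (h1 : HasWeakDeriv T (zPeriodic T) eZ f F) (h2 : HasWeakDeriv T (zPeriodic T) eZ F F') :
    ∀ᵐ t ∂(muT T), ∫⁻ r, ‖F (t, r)‖ₑ ^ 2 ∂(muJ.prod (muJ.prod muJ)) ≤
      ENNReal.ofReal T⁻¹ * sq T F + sq T k + sq T F' :=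
  ae_lintegral_sq_le_of_perPrim hT ht h1.2.1 h2.2.1
    ((swapFst _ _ _).trans ((MeasurableEquiv.refl ℝ).prodCongr MeasurableEquiv.prodComm))
    (((MeasurePreserving.id _).prod Measure.measurePreserving_swap).comp
      (measurePreserving_swapFst _ _ _)) (ae_perPrim_Z h1) (ae_perPrim_Z h2)

/-- `H¹(0,T; L²) ⊂ L^∞(0,T; L²)`. -/
lemma ae_lintegral_sq_le_T (hT : 0 < T) (ht : HasWeakDeriv T (zInterior T) eT f k) :
    ∀ᵐ t ∂(muT T), ∫⁻ r, ‖f (t, r)‖ₑ ^ 2 ∂(muJ.prod (muJ.prod muJ)) ≤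
      (ENNReal.ofReal T⁻¹ + 1) * sq T f + sq T k := by
  wlog hmeas : Measurable f ∧ Measurable k generalizing f k
  · have ef := ht.1.1.ae_eq_mk
    have ek := ht.2.1.1.ae_eq_mk
    have := this (ht.congr ef ek) ⟨ht.1.1.stronglyMeasurable_mk.measurable,
      ht.2.1.1.stronglyMeasurable_mk.measurable⟩
    rw [sq_congr ef, sq_congr ek]
    have e' : ∀ᵐ p ∂((muT T).prod (muJ.prod (muJ.prod muJ))), f p = ht.1.1.mk f p := (mu_eq T) ▸ ef
    filter_upwards [this, Measure.ae_ae_of_ae_prod e'] with t ht ht'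
    refine le_trans (le_of_eq (lintegral_congr_ae ?_)) ht
    filter_upwards [ht'] with r hr
    rw [hr]
  obtain ⟨mf, mk⟩ := hmeas
  set κ : Pt → ℝ≥0∞ := fun p => (ENNReal.ofReal T⁻¹ + 1) * ‖f p‖ₑ ^ 2 + ‖k p‖ₑ ^ 2 with hκ
  have mκ : Measurable κ := ((mf.enorm.pow_const 2).const_mul _).add (mk.enorm.pow_const 2)
  have lines : ∀ᵐ q ∂(muJ.prod (muJ.prod muJ)), ∀ᵐ t ∂(muT T),
      ‖f (t, q)‖ₑ ^ 2 ≤ ∫⁻ τ, κ (τ, q) ∂(muT T) := by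
    filter_upwards [ae_prim_T hT ht] with q hq
    filter_upwards [hq.sq_le hT] with t hqt
    refine hqt.trans (lintegral_mono fun τ => ?_)
    simp only [hκ]
    rw [sub_zero, add_mul, add_assoc, one_mul]
    exact add_le_add le_rfl (enn_two_mul_le _ _)
  have all : ∀ᵐ p ∂(mu T), ‖f p‖ₑ ^ 2 ≤ ∫⁻ τ, κ (τ, p.2) ∂(muT T) := by
    refine ae_of_ae_lines (MeasurableEquiv.refl Pt) (by rw [mu_eq]; exact MeasurePreserving.id _)
      (MeasurableSet.nullMeasurableSet (measurableSet_le (mf.enorm.pow_const 2) ?_)) lines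
    exact (Measurable.lintegral_prod_left' mκ).comp measurable_snd
  rw [mu_eq] at all
  filter_upwards [Measure.ae_ae_of_ae_prod all] with t ht
  refine (lintegral_mono_ae ht).trans (le_of_eq ?_)
  rw [sq_eq, sq_eq, ← lintegral_const_mul _ (mf.enorm.pow_const 2),
    ← lintegral_add_left ((mf.enorm.pow_const 2).const_mul _), mu_eq,
    lintegral_prod_symm _ mκ.aemeasurable]

end directions

/-! ### The norms -/

section norms

variable {ι : Type} [Fintype ι] {T : ℝ} (u : ι → Field)

lemma le_sum_of_le {g : ι → ℝ≥0∞} (k : ι) {x : ℝ≥0∞} (h : x ≤ g k) : x ≤ ∑ k, g k :=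
  h.trans (Finset.single_le_sum (fun _ _ => zero_le) (Finset.mem_univ k))

lemma sq_le_normH1L2 (k : ι) : sq T (u k) ≤ normH1L2 T u ^ 2 := by
  rw [normH1L2, enn_sq_rpow_half]
  exact le_sum_of_le k le_self_add

lemma sq_D_eT_le_normH1L2 (k : ι) : sq T (D T eT (u k)) ≤ normH1L2 T u ^ 2 := by
  rw [normH1L2, enn_sq_rpow_half]
  exact le_sum_of_le k le_add_self

lemma sq_first_le_normL2H2 (k : ι) (i : Fin 3) : sq T (D T (eS i) (u k)) ≤ normL2H2 T u ^ 2 := by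
  rw [normL2H2, enn_sq_rpow_half]
  exact le_sum_of_le k ((le_sum_of_le i le_rfl).trans (le_add_self.trans le_self_add))

lemma sq_second_le_normL2H2 (k : ι) (i j : Fin 3) :
    sq T (D T (eS j) (D T (eS i) (u k))) ≤ normL2H2 T u ^ 2 := by
  rw [normL2H2, enn_sq_rpow_half]
  exact le_sum_of_le k ((le_sum_of_le i (le_sum_of_le j le_rfl)).trans le_add_self)

lemma sq_first_le_normL2L2zH2xy (k : ι) (i : Fin 2) :
    sq T (D T (eH i) (u k)) ≤ normL2L2zH2xy T u ^ 2 := by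
  rw [normL2L2zH2xy, enn_sq_rpow_half]
  exact le_sum_of_le k ((le_sum_of_le i le_rfl).trans (le_add_self.trans le_self_add))

lemma sq_second_le_normL2L2zH2xy (k : ι) (i j : Fin 2) :
    sq T (D T (eH j) (D T (eH i) (u k))) ≤ normL2L2zH2xy T u ^ 2 := by
  rw [normL2L2zH2xy, enn_sq_rpow_half]
  exact le_sum_of_le k ((le_sum_of_le i (le_sum_of_le j le_rfl)).trans le_add_self)

lemma sq_vert_le_normL2H1zH1xy (k : ι) : sq T (D T eZ (u k)) ≤ normL2H1zH1xy T u ^ 2 := by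
  rw [normL2H1zH1xy, enn_sq_rpow_half]
  exact le_sum_of_le k (le_self_add.trans le_add_self)

lemma sq_mixed_le_normL2H1zH1xy (k : ι) (i : Fin 2) :
    sq T (D T (eH i) (D T eZ (u k))) ≤ normL2H1zH1xy T u ^ 2 := by
  rw [normL2H1zH1xy, enn_sq_rpow_half]
  exact le_sum_of_le k ((le_sum_of_le i le_rfl).trans (le_add_self.trans le_add_self))

lemma ae_sum_le_normLinfty : ∀ᵐ t ∂(muT T), ∀ k,
    ∫⁻ r, ‖u k (t, r)‖ₑ ^ 2 ∂(muJ.prod (muJ.prod muJ)) +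
      ∫⁻ r, ‖D T eZ (u k) (t, r)‖ₑ ^ 2 ∂(muJ.prod (muJ.prod muJ)) ≤
      normLinftyH1zL2xy T u ^ 2 := by
  have := ENNReal.ae_le_essSup (μ := muT T) (fun t : ℝ =>
    (∑ k, (eLpNorm (fun q : ℝ × ℝ × ℝ => u k (t, q)) 2 (volume.restrict Omega) ^ 2 +
      eLpNorm (fun q : ℝ × ℝ × ℝ => D T eZ (u k) (t, q)) 2 (volume.restrict Omega) ^ 2)) ^
        (1 / 2 : ℝ))
  filter_upwards [this] with t ht k
  have h2 := pow_le_pow_left₀ zero_le ht 2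
  rw [enn_sq_rpow_half] at h2
  refine le_trans (le_sum_of_le (g := fun k =>
    eLpNorm (fun q : ℝ × ℝ × ℝ => u k (t, q)) 2 (volume.restrict Omega) ^ 2 +
      eLpNorm (fun q : ℝ × ℝ × ℝ => D T eZ (u k) (t, q)) 2 (volume.restrict Omega) ^ 2) k ?_) h2
  rw [eLpNorm_two_sq, eLpNorm_two_sq, restrict_Omega]

variable {u}

lemma sq_lt_top {f : Field} (h : MemLp f 2 (mu T)) : sq T f < ⊤ := ENNReal.pow_lt_top h.2

lemma normE1_lt_top (h : ∀ k, MemE1 T (u k)) : normE1 T u < ⊤ := by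
  refine ENNReal.add_lt_top.2 ⟨?_, ?_⟩
  · refine ENNReal.rpow_lt_top_of_nonneg (by norm_num) (ne_of_lt ?_)
    refine ENNReal.sum_lt_top.2 fun k _ => ENNReal.add_lt_top.2 ⟨ENNReal.add_lt_top.2 ⟨?_, ?_⟩, ?_⟩
    · exact sq_lt_top (h k).memLp
    · exact ENNReal.sum_lt_top.2 fun i _ => sq_lt_top ((h k).first i).1.2.1
    · exact ENNReal.sum_lt_top.2 fun i _ => ENNReal.sum_lt_top.2 fun j _ =>
        sq_lt_top ((h k).second i j).1.2.1
  · refine ENNReal.rpow_lt_top_of_nonneg (by norm_num) (ne_of_lt ?_)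
    exact ENNReal.sum_lt_top.2 fun k _ => ENNReal.add_lt_top.2
      ⟨sq_lt_top (h k).memLp, sq_lt_top (h k).time.2.1⟩

lemma normEHz_lt_top (h : ∀ k, MemEHz T (u k)) : normEHz T u < ⊤ := by
  refine ENNReal.add_lt_top.2 ⟨ENNReal.add_lt_top.2 ⟨?_, ?_⟩, ENNReal.add_lt_top.2 ⟨?_, ?_⟩⟩
  · refine ENNReal.rpow_lt_top_of_nonneg (by norm_num) (ne_of_lt ?_)
    refine ENNReal.sum_lt_top.2 fun k _ => ENNReal.add_lt_top.2 ⟨ENNReal.add_lt_top.2 ⟨?_, ?_⟩,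
      ENNReal.add_lt_top.2 ⟨?_, ?_⟩⟩
    · exact sq_lt_top (h k).1.memLp
    · exact ENNReal.sum_lt_top.2 fun i _ => sq_lt_top ((h k).1.hor i).2.1
    · exact sq_lt_top (h k).1.vert.2.1
    · exact ENNReal.sum_lt_top.2 fun i _ => sq_lt_top ((h k).1.mixed i).2.1
  -- Boundedness is given for each component separately; the norm of the family is at most the
  -- Euclidean sum of these bounds.
  · have hfin : (∑ k, normLinftyH1zL2xy T ![u k] ^ 2) ^ (1 / 2 : ℝ) < ⊤ :=
      ENNReal.rpow_lt_top_of_nonneg (by norm_num) (ne_of_lt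
        (ENNReal.sum_lt_top.2 fun k _ => ENNReal.pow_lt_top (h k).1.bounded))
    refine lt_of_le_of_lt (essSup_le_of_ae_le _ ?_) hfin
    have := ae_all_iff.2 fun k => ae_sum_le_normLinfty (T := T) ![u k]
    filter_upwards [this] with t ht
    refine ENNReal.rpow_le_rpow (Finset.sum_le_sum fun k _ => ?_) (by norm_num)
    rw [eLpNorm_two_sq, eLpNorm_two_sq, restrict_Omega]
    exact ht k 0
  · refine ENNReal.rpow_lt_top_of_nonneg (by norm_num) (ne_of_lt ?_)
    refine ENNReal.sum_lt_top.2 fun k _ => ENNReal.add_lt_top.2 ⟨ENNReal.add_lt_top.2 ⟨?_, ?_⟩, ?_⟩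
    · exact sq_lt_top (h k).2.memLp
    · exact ENNReal.sum_lt_top.2 fun i _ => sq_lt_top ((h k).2.first i).2.1
    · exact ENNReal.sum_lt_top.2 fun i _ => ENNReal.sum_lt_top.2 fun j _ =>
        sq_lt_top ((h k).2.second i j).2.1
  · refine ENNReal.rpow_lt_top_of_nonneg (by norm_num) (ne_of_lt ?_)
    exact ENNReal.sum_lt_top.2 fun k _ => ENNReal.add_lt_top.2
      ⟨sq_lt_top (h k).2.memLp, sq_lt_top (h k).2.time.2.1⟩

end norms

/-! ### Fields with anisotropically controlled gradient -/

/-- The constant of the embeddings into `L⁴((0,T); L⁴_xy L²_z)`. -/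
def embConst (T : ℝ) : ℝ≥0∞ := 24 * (ENNReal.ofReal T⁻¹ + 2)

/-- A field that is, together with its spatial derivatives, bounded by `n` in
`L⁴((0,T); L⁴_xy L²_z)`. -/
structure Controlled (T : ℝ) (n : ℝ≥0∞) (f : Field) : Prop where
  diffble : ∀ i, Diffble T (eS i) f
  aniso_le : aniso T f ≤ embConst T * n ^ 4
  aniso_D_le : ∀ i, aniso T (D T (eS i) f) ≤ embConst T * n ^ 4

/-- A field that is bounded by `n` in `L⁴((0,T); L⁴_xy L^∞_z)`. -/
structure Advects (T : ℝ) (n : ℝ≥0∞) (a : Field) : Prop where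
  aestronglyMeasurable : AEStronglyMeasurable a (mu T)
  bound : ∃ F₁ F₂ : Field, AEStronglyMeasurable F₁ (mu T) ∧ AEStronglyMeasurable F₂ (mu T) ∧
    aniso T F₁ ≤ embConst T * n ^ 4 ∧ aniso T F₂ ≤ embConst T * n ^ 4 ∧
    ∀ᵐ p ∂(mu T), ‖a p‖ₑ ^ 2 ≤ 4 * ∫⁻ z, (‖F₁ (p.1, p.2.1, p.2.2.1, z)‖ₑ ^ 2 +
      ‖F₂ (p.1, p.2.1, p.2.2.1, z)‖ₑ ^ 2) ∂muJ

section controlled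

variable {T : ℝ} {n : ℝ≥0∞}

lemma aniso_le_embConst {f fx fy : Field} (hx : HasWeakDeriv T (zInterior T) eX f fx)
    (hy : HasWeakDeriv T (zInterior T) eY f fy) {B : ℝ≥0∞}
    (hB : ∀ᵐ t ∂(muT T), ∫⁻ r, ‖f (t, r)‖ₑ ^ 2 ∂(muJ.prod (muJ.prod muJ)) ≤ B)
    (hB' : B ≤ (ENNReal.ofReal T⁻¹ + 2) * n ^ 2) (h0 : sq T f ≤ n ^ 2) (h1 : sq T fx ≤ n ^ 2)
    (h2 : sq T fy ≤ n ^ 2) : aniso T f ≤ embConst T * n ^ 4 := by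
  refine (aniso_le hx hy hB).trans ?_
  -- The factor `24` of `embConst` is `8 * 3`, and `T⁻¹ + 2` is the bound in time.
  calc 8 * B * (sq T f + sq T fx + sq T fy)
      ≤ 8 * ((ENNReal.ofReal T⁻¹ + 2) * n ^ 2) * (n ^ 2 + n ^ 2 + n ^ 2) := by gcongr
    _ = _ := by rw [embConst]; ring

lemma parabolic_bound_le {a b c : ℝ≥0∞} (ha : a ≤ n ^ 2) (hb : b ≤ n ^ 2) (hc : c ≤ n ^ 2) :
    ENNReal.ofReal T⁻¹ * a + b + c ≤ (ENNReal.ofReal T⁻¹ + 2) * n ^ 2 := by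
  calc ENNReal.ofReal T⁻¹ * a + b + c ≤ ENNReal.ofReal T⁻¹ * n ^ 2 + n ^ 2 + n ^ 2 := by gcongr
    _ = _ := by ring

/-- The field itself is bounded in time by `H¹(0,T; L²)`, its derivative in direction `i` by
parabolic regularity with `∂_i²`. Periodicity in `z` enters for `i = 2`. -/
lemma controlled_of_memE1 (hT : 0 < T) {ι : Type} [Fintype ι] {u : ι → Field} (k : ι)
    (h : MemE1 T (u k)) : Controlled T (normE1 T u) (u k) := by
  have hb : ∀ {x : ℝ≥0∞}, x ≤ normH1L2 T u ^ 2 → x ≤ normE1 T u ^ 2 := fun hx =>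
    hx.trans (pow_le_pow_left₀ zero_le le_add_self 2)
  have hc : ∀ {x : ℝ≥0∞}, x ≤ normL2H2 T u ^ 2 → x ≤ normE1 T u ^ 2 := fun hx =>
    hx.trans (pow_le_pow_left₀ zero_le le_self_add 2)
  have s0 := hb (sq_le_normH1L2 (T := T) u k)
  have st := hb (sq_D_eT_le_normH1L2 (T := T) u k)
  have s1 := fun i => hc (sq_first_le_normL2H2 (T := T) u k i)
  have s2 := fun i j => hc (sq_second_le_normL2H2 (T := T) u k i j)
  refine ⟨fun i => (h.first i).1, ?_, fun i => ?_⟩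
  · refine aniso_le_embConst (h.first 0).1 (h.first 1).1 (ae_lintegral_sq_le_T hT h.time) ?_ s0
      (s1 0) (s1 1)
    calc _ ≤ (ENNReal.ofReal T⁻¹ + 1) * normE1 T u ^ 2 + normE1 T u ^ 2 := by gcongr
      _ = _ := by ring
  · refine aniso_le_embConst (h.second i 0).1 (h.second i 1).1
      (B := ENNReal.ofReal T⁻¹ * sq T (D T (eS i) (u k)) + sq T (D T eT (u k)) +
        sq T (D T (eS i) (D T (eS i) (u k)))) ?_ (parabolic_bound_le (s1 i) st (s2 i i))
        (s1 i) (s2 i 0) (s2 i 1)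
    fin_cases i
    · exact ae_lintegral_sq_le_X hT h.time (h.first 0).1 (h.second 0 0).1
    · exact ae_lintegral_sq_le_Y hT h.time (h.first 1).1 (h.second 1 1).1
    · exact ae_lintegral_sq_le_Z hT h.time (h.first 2).2 (h.second 2 2).2

/-- Neither `∂_z²` nor periodicity in `z` is available here. The field and its vertical derivative
are bounded in time through the norm of `𝔼_z`; only horizontal derivatives use parabolic regularity.
-/
lemma controlled_of_memEHz (hT : 0 < T) {ι : Type} [Fintype ι] {u : ι → Field} (k : ι)
    (h : MemEHz T (u k)) : Controlled T (normEHz T u) (u k) := by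
  obtain ⟨hz, hH⟩ := h
  have h1 : ∀ {x : ℝ≥0∞}, x ≤ normH1L2 T u ^ 2 → x ≤ normEHz T u ^ 2 := fun hx =>
    hx.trans (pow_le_pow_left₀ zero_le (le_add_self.trans le_add_self) 2)
  have h2 : ∀ {x : ℝ≥0∞}, x ≤ normL2L2zH2xy T u ^ 2 → x ≤ normEHz T u ^ 2 := fun hx =>
    hx.trans (pow_le_pow_left₀ zero_le (le_self_add.trans le_add_self) 2)
  have h3 : ∀ {x : ℝ≥0∞}, x ≤ normL2H1zH1xy T u ^ 2 → x ≤ normEHz T u ^ 2 := fun hx =>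
    hx.trans (pow_le_pow_left₀ zero_le (le_self_add.trans le_self_add) 2)
  have h4 : ∀ {x : ℝ≥0∞}, x ≤ normLinftyH1zL2xy T u ^ 2 → x ≤ normEHz T u ^ 2 := fun hx =>
    hx.trans (pow_le_pow_left₀ zero_le (le_add_self.trans le_self_add) 2)
  have s0 := h1 (sq_le_normH1L2 (T := T) u k)
  have st := h1 (sq_D_eT_le_normH1L2 (T := T) u k)
  have s1 := fun i => h2 (sq_first_le_normL2L2zH2xy (T := T) u k i)
  have s2 := fun i j => h2 (sq_second_le_normL2L2zH2xy (T := T) u k i j)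
  have sz := h3 (sq_vert_le_normL2H1zH1xy (T := T) u k)
  have sm := fun i => h3 (sq_mixed_le_normL2H1zH1xy (T := T) u k i)
  have hle : normEHz T u ^ 2 ≤ (ENNReal.ofReal T⁻¹ + 2) * normEHz T u ^ 2 := by
    conv_lhs => rw [← one_mul (normEHz T u ^ 2)]
    gcongr
    exact le_trans (by norm_num) le_add_self
  have hor : ∀ i, aniso T (D T (eH i) (u k)) ≤ embConst T * normEHz T u ^ 4 := by
    intro i
    refine aniso_le_embConst (hH.second i 0) (hH.second i 1)
      (B := ENNReal.ofReal T⁻¹ * sq T (D T (eH i) (u k)) + sq T (D T eT (u k)) +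
        sq T (D T (eH i) (D T (eH i) (u k)))) ?_ (parabolic_bound_le (s1 i) st (s2 i i))
        (s1 i) (s2 i 0) (s2 i 1)
    fin_cases i
    · exact ae_lintegral_sq_le_X hT hH.time (hH.first 0) (hH.second 0 0)
    · exact ae_lintegral_sq_le_Y hT hH.time (hH.first 1) (hH.second 1 1)
  refine ⟨fun i => ?_, ?_, fun i => ?_⟩
  · fin_cases i
    · exact hH.first 0
    · exact hH.first 1
    · exact hz.vert
  · refine aniso_le_embConst (hH.first 0) (hH.first 1) (B := normEHz T u ^ 2) ?_ hle s0 (s1 0) (s1 1)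
    filter_upwards [ae_sum_le_normLinfty (T := T) u] with t ht
    exact h4 (le_self_add.trans (ht k))
  · fin_cases i
    · exact hor 0
    · exact hor 1
    · refine aniso_le_embConst (hz.mixed 0) (hz.mixed 1) (B := normEHz T u ^ 2) ?_ hle sz (sm 0)
        (sm 1)
      filter_upwards [ae_sum_le_normLinfty (T := T) u] with t ht
      exact h4 (le_add_self.trans (ht k))

lemma Controlled.memLp {f : Field} (h : Controlled T n f) : MemLp f 2 (mu T) := (h.diffble 0).1

/-- Pointwise bounds by an integral over vertical lines can be checked line by line. -/
lemma ae_le_lintegral_lines {a : Field} {h : Pt → ℝ≥0∞} {c : ℝ≥0∞}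
    (ha : AEStronglyMeasurable a (mu T)) (hh : AEMeasurable h (mu T))
    (hl : ∀ᵐ q ∂((muT T).prod (muJ.prod muJ)), ∀ᵐ s ∂muJ,
      ‖a (insZ (s, q))‖ₑ ^ 2 ≤ c * ∫⁻ z, h (insZ (z, q)) ∂muJ) :
    ∀ᵐ p ∂(mu T), ‖a p‖ₑ ^ 2 ≤ c * ∫⁻ z, h (p.1, p.2.1, p.2.2.1, z) ∂muJ := by
  have hmp := measurePreserving_insZ T
  have m1 := (hh.comp_quasiMeasurePreserving hmp.quasiMeasurePreserving).lintegral_prod_left'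
  have m2 := m1.comp_quasiMeasurePreserving (Measure.quasiMeasurePreserving_snd.comp
    (hmp.symm insZ).quasiMeasurePreserving)
  exact ae_of_ae_lines insZ hmp
    (nullMeasurableSet_le (ha.enorm.pow_const 2) (m2.const_mul c)) hl

/-- The embedding `H¹_z ⊂ L^∞_z`. -/
lemma Controlled.advects {f : Field} (h : Controlled T n f) : Advects T n f := by
  have hz : HasWeakDeriv T (zInterior T) eZ f (D T eZ f) := h.diffble 2
  refine ⟨h.memLp.1, f, D T eZ f, h.memLp.1, hz.2.1.1, h.aniso_le, h.aniso_D_le 2, ?_⟩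
  refine ae_le_lintegral_lines (h := fun p => ‖f p‖ₑ ^ 2 + ‖D T eZ f p‖ₑ ^ 2) h.memLp.1
    ((h.memLp.1.enorm.pow_const 2).add (hz.2.1.1.enorm.pow_const 2)) ?_
  filter_upwards [ae_prim_Z hz] with q hq
  filter_upwards [hq.sq_le (by norm_num)] with s hs
  refine hs.trans ?_
  rw [← lintegral_const_mul' _ _ (by norm_num)]
  refine lintegral_mono fun z => ?_
  -- The constant two would do here; the four in `Advects` is what the vertical component `W/ε`
  -- requires.
  refine (lineKernel_le f (D T eZ f) (insZ (z, q))).trans ?_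
  gcongr
  norm_num

/-- The vertical component of a scaled divergence free field that is odd in `z` is bounded in `z`
through the horizontal derivatives of the horizontal component. -/
lemma advects_inv_mul {ε : ℝ} {V : Fin 2 → Field} {W : Field} (h0 : Controlled T n (V 0))
    (h1 : Controlled T n (V 1)) (hW : Controlled T n W) (hodd : OddZ T W)
    (hdiv : DivEpsFree T ε V W) : Advects T n (fun p => ε⁻¹ * W p) := by
  have hz : HasWeakDeriv T (zInterior T) eZ W (D T eZ W) := hW.diffble 2
  have hx : HasWeakDeriv T (zInterior T) eX (V 0) (D T eX (V 0)) := h0.diffble 0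
  have hy : HasWeakDeriv T (zInterior T) eY (V 1) (D T eY (V 1)) := h1.diffble 1
  have hmp := measurePreserving_insZ T
  refine ⟨hW.memLp.1.const_mul _, _, _, hx.2.1.1, hy.2.1.1, h0.aniso_D_le 0, h1.aniso_D_le 1, ?_⟩
  refine ae_le_lintegral_lines (h := fun p => ‖D T eX (V 0) p‖ₑ ^ 2 + ‖D T eY (V 1) p‖ₑ ^ 2)
    (hW.memLp.1.const_mul _) ((hx.2.1.1.enorm.pow_const 2).add (hy.2.1.1.enorm.pow_const 2)) ?_
  have hsl : ∀ᵐ q ∂((muT T).prod (muJ.prod muJ)),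
      AEStronglyMeasurable (fun s => D T eX (V 0) (insZ (s, q)) + D T eY (V 1) (insZ (s, q))) muJ := by
    have := hmp.integrable_comp_of_integrable ((hx.integrable.2).add (hy.integrable.2))
    filter_upwards [this.prod_left_ae] with q hq using hq.1
  filter_upwards [ae_prim_Z hz, ae_ae_swap (hmp.quasiMeasurePreserving.ae hodd),
    ae_ae_swap (hmp.quasiMeasurePreserving.ae hdiv), hsl] with q hq ho hd hm
  have mean : ∫ s in Ioo (-1) 1, W (insZ (s, q)) = 0 := by
    have e1 : ∫ s in Ioo (-1 : ℝ) 1, W (insZ (-s, q)) = ∫ s in Ioo (-1 : ℝ) 1, W (insZ (s, q)) := by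
      rw [setIntegral_Ioo_eq_intervalIntegral (by norm_num),
        setIntegral_Ioo_eq_intervalIntegral (by norm_num),
        intervalIntegral.integral_comp_neg (fun s => W (insZ (s, q))), neg_neg]
    have e2 : ∫ s in Ioo (-1 : ℝ) 1, W (insZ (-s, q)) =
        ∫ s in Ioo (-1 : ℝ) 1, - W (insZ (s, q)) := integral_congr_ae ho
    rw [e1, integral_neg] at e2
    linarith
  filter_upwards [hq.enorm_le (by norm_num) mean] with s hs
  set G : ℝ → ℝ := fun z => D T eX (V 0) (insZ (z, q)) + D T eY (V 1) (insZ (z, q)) with hG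
  -- The divergence condition converts `ε⁻¹ ∂_z W` into `-div_H V`, and `ε` disappears from the
  -- bound.
  have step : ‖ε⁻¹ * W (insZ (s, q))‖ₑ ≤ ∫⁻ z, ‖G z‖ₑ ∂muJ := by
    rw [enorm_mul]
    refine (mul_le_mul_right hs _).trans ?_
    rw [← lintegral_const_mul' _ _ enorm_ne_top]
    refine le_of_eq (lintegral_congr_ae ?_)
    filter_upwards [hd] with z hz
    rw [← enorm_mul, ← enorm_neg]
    congr 1
    simp only [divH] at hz
    simp only [hG]
    linarith
  refine (pow_le_pow_left₀ zero_le step 2).trans ?_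
  have cs := sq_lintegral_mul_le (μ := muJ) (f := fun _ => 1) aemeasurable_const hm.enorm
  simp only [one_mul, one_pow, lintegral_const] at cs
  have vol : muJ univ = 2 := by
    rw [Measure.restrict_apply_univ, Real.volume_Ioo]; norm_num
  rw [vol] at cs
  refine cs.trans ?_
  rw [← lintegral_const_mul' _ _ (by norm_num), ← lintegral_const_mul' _ _ (by norm_num)]
  refine lintegral_mono fun z => ?_
  calc 2 * ‖G z‖ₑ ^ 2 ≤ 2 * (2 * (‖D T eX (V 0) (insZ (z, q))‖ₑ ^ 2 +
        ‖D T eY (V 1) (insZ (z, q))‖ₑ ^ 2)) := by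
        gcongr
        exact (pow_le_pow_left₀ zero_le (enorm_add_le _ _) 2).trans (enn_add_sq_le _ _)
    _ = _ := by ring

lemma one_le_embConst : 1 ≤ embConst T := by
  rw [embConst]
  calc (1 : ℝ≥0∞) ≤ 24 * (0 + 2) := by norm_num
    _ ≤ _ := by gcongr; exact zero_le

variable {m : ℝ≥0∞}

lemma Advects.eLpNorm_mul_le {a b : Field} (ha : Advects T n a)
    (hb : AEStronglyMeasurable b (mu T)) (hb' : aniso T b ≤ embConst T * m ^ 4) :
    eLpNorm (fun p => a p * b p) 2 (mu T) ≤ 8 * embConst T * (n * m) := by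
  obtain ⟨F₁, F₂, m1, m2, h1, h2, h⟩ := ha.bound
  have key := sq_mul_le ha.aestronglyMeasurable hb m1 m2 4 h
  have key2 : sq T (fun p => a p * b p) ≤ 8 * embConst T * (n * m) ^ 2 := by
    refine enn_le_of_sq_le (key.trans ?_)
    calc 2 * 4 ^ 2 * (aniso T F₁ + aniso T F₂) * aniso T b
        ≤ 2 * 4 ^ 2 * (embConst T * n ^ 4 + embConst T * n ^ 4) * (embConst T * m ^ 4) := by gcongr
      _ = _ := by ring
  refine enn_le_of_sq_le (key2.trans ?_)
  rw [mul_pow (8 * embConst T), pow_two (8 * embConst T)]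
  -- The constant in `key2` is at least one and may be replaced by its square, so no root of it is
  -- needed.
  have one_le : (1 : ℝ≥0∞) ≤ 8 * embConst T := by
    calc (1 : ℝ≥0∞) = 1 * 1 := (one_mul 1).symm
      _ ≤ 8 * embConst T := mul_le_mul' (by norm_num) one_le_embConst
  refine mul_le_mul' ?_ le_rfl
  calc 8 * embConst T = 1 * (8 * embConst T) := (one_mul _).symm
    _ ≤ (8 * embConst T) * (8 * embConst T) := mul_le_mul' one_le le_rfl

/-- The `L²` bound of the advection term. -/
lemma eLpNorm_adv_le {a : Fin 3 → Field} {f : Field} (ha : ∀ i, Advects T n (a i))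
    (hf : Controlled T m f) :
    AEStronglyMeasurable (adv T a f) (mu T) ∧
      eLpNorm (adv T a f) 2 (mu T) ≤ 24 * embConst T * (n * m) := by
  have e : adv T a f = ∑ i, fun p => a i p * D T (eS i) f p := by
    ext p; simp [adv]
  have hm : ∀ i, AEStronglyMeasurable (fun p => a i p * D T (eS i) f p) (mu T) := fun i =>
    (ha i).aestronglyMeasurable.mul (hf.diffble i).2.1.1
  rw [e]
  refine ⟨Finset.aestronglyMeasurable_sum _ fun i _ => hm i, ?_⟩
  refine (eLpNorm_sum_le (fun i _ => hm i) (by norm_num)).trans ?_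
  refine (Finset.sum_le_sum fun i _ => (ha i).eLpNorm_mul_le (hf.diffble i).2.1.1
    (hf.aniso_D_le i)).trans (le_of_eq ?_)
  rw [Finset.sum_const, Finset.card_univ, Fintype.card_fin, nsmul_eq_mul]
  push_cast
  ring

end controlled

/-! ### The terms with coefficient `δ` -/

/-- The `H²` norm of one component contains `∂_z²` and both orders of one mixed derivative as
separate summands, which leaves room for `∂_z² w`. -/
lemma sum_sum_ge (g : Fin 3 → Fin 3 → ℝ≥0∞) (i : Fin 2) :
    g 2 2 + (g i.castSucc 2 + g 2 i.castSucc) ≤ ∑ i, ∑ j, g i j := by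
  simp only [Fin.sum_univ_three]
  fin_cases i
  · calc g 2 2 + (g 0 2 + g 2 0) ≤ g 2 2 + (g 0 2 + g 2 0) +
          (g 0 0 + g 0 1 + g 1 0 + g 1 1 + g 1 2 + g 2 1) := le_self_add
      _ = _ := by ring
  · calc g 2 2 + (g 1 2 + g 2 1) ≤ g 2 2 + (g 1 2 + g 2 1) +
          (g 0 0 + g 0 1 + g 1 0 + g 1 1 + g 0 2 + g 2 0) := le_self_add
      _ = _ := by ring

variable {T : ℝ}

/-- `‖∂_z² w‖²` is controlled by the mixed derivatives of `v`, each counted twice. -/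
lemma sq_D_eZ_D_eZ_vertVel_le {v : Fin 2 → Field} (hv : ∀ k, MemE1 T (v k))
    (hw : MemE1 T (vertVel T v)) :
    sq T (D T eZ (D T eZ (vertVel T v))) ≤
      ∑ k : Fin 2, (sq T (D T eZ (D T (eH k) (v k))) + sq T (D T (eH k) (D T eZ (v k)))) := by
  have d0 : HasWeakDeriv T (zInterior T) eX (v 0) (D T eX (v 0)) := ((hv 0).first 0).1
  have d1 : HasWeakDeriv T (zInterior T) eY (v 1) (D T eY (v 1)) := ((hv 1).first 1).1
  have e0 : HasWeakDeriv T (zInterior T) eZ (D T eX (v 0)) (D T eZ (D T eX (v 0))) :=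
    ((hv 0).second 0 2).1
  have e1 : HasWeakDeriv T (zInterior T) eZ (D T eY (v 1)) (D T eZ (D T eY (v 1))) :=
    ((hv 1).second 1 2).1
  have c0 : D T eZ (D T eX (v 0)) =ᵐ[mu T] D T eX (D T eZ (v 0)) :=
    mixed_comm 0 d0 e0 ((hv 0).first 2).1 ((hv 0).second 2 0).1
  have c1 : D T eZ (D T eY (v 1)) =ᵐ[mu T] D T eY (D T eZ (v 1)) :=
    mixed_comm 1 d1 e1 ((hv 1).first 2).1 ((hv 1).second 2 1).1
  have hz := D_eZ_vertVel (hw.first 2).1 d0.diffble d1.diffble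
  have hneg : HasWeakDeriv T (zInterior T) eZ (D T eZ (vertVel T v))
      (fun p => -1 * (D T eZ (D T eX (v 0)) p + D T eZ (D T eY (v 1)) p)) := by
    refine ((e0.add_zInterior e1).const_mul (-1)).congr ?_ (ae_eq_refl _)
    filter_upwards [hz] with p hp
    rw [hp, divH]; ring
  rw [sq_congr hneg.D_ae_eq, Fin.sum_univ_two]
  have l : sq T (fun p => -1 * (D T eZ (D T eX (v 0)) p + D T eZ (D T eY (v 1)) p)) ≤
      2 * (sq T (D T eZ (D T eX (v 0))) + sq T (D T eZ (D T eY (v 1)))) := by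
    have : (fun p => -1 * (D T eZ (D T eX (v 0)) p + D T eZ (D T eY (v 1)) p)) =
        -(D T eZ (D T eX (v 0)) + D T eZ (D T eY (v 1))) := by ext p; simp
    rw [this, sq, eLpNorm_neg]
    exact (pow_le_pow_left₀ zero_le (eLpNorm_add_le e0.2.1.1 e1.2.1.1 (by norm_num)) 2).trans
      (enn_add_sq_le _ _)
  -- The factor two is spent on writing each mixed derivative in both orders.
  refine l.trans (le_of_eq ?_)
  change _ = sq T (D T eZ (D T eX (v 0))) + sq T (D T eX (D T eZ (v 0))) +
    (sq T (D T eZ (D T eY (v 1))) + sq T (D T eY (D T eZ (v 1))))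
  rw [← sq_congr c0, ← sq_congr c1]
  ring

/-- The terms with coefficient `δ` are bounded, with constant one, by the `L²(0,T; H²)`-norm. -/
lemma normE0_vert_le {v : Fin 2 → Field} (hv : ∀ k, MemE1 T (v k)) (hw : MemE1 T (vertVel T v))
    {ε : ℝ} (h0 : 0 < ε) (h1 : ε ≤ 1) :
    normE0 T (vec (fun k => D T eZ (D T eZ (v k)))
      (fun p => -ε * D T eZ (D T eZ (vertVel T v)) p)) ≤ normE1 T v := by
  refine le_trans ?_ (le_self_add : normL2H2 T v ≤ normE1 T v)
  refine ENNReal.rpow_le_rpow ?_ (by norm_num)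
  have s2 : sq T (fun p => -ε * D T eZ (D T eZ (vertVel T v)) p) ≤
      sq T (D T eZ (D T eZ (vertVel T v))) := by
    refine pow_le_pow_left₀ zero_le (eLpNorm_mono fun p => ?_) 2
    rw [norm_mul, norm_neg, Real.norm_of_nonneg h0.le]
    exact mul_le_of_le_one_left (norm_nonneg _) h1
  rw [Fin.sum_univ_three]
  change sq T (D T eZ (D T eZ (v 0))) + sq T (D T eZ (D T eZ (v 1))) +
    sq T (fun p => -ε * D T eZ (D T eZ (vertVel T v)) p) ≤ _
  calc _ ≤ sq T (D T eZ (D T eZ (v 0))) + sq T (D T eZ (D T eZ (v 1))) +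
        ∑ k : Fin 2, (sq T (D T eZ (D T (eH k) (v k))) + sq T (D T (eH k) (D T eZ (v k)))) :=
        add_le_add le_rfl (s2.trans (sq_D_eZ_D_eZ_vertVel_le hv hw))
    _ = ∑ k : Fin 2, (sq T (D T eZ (D T eZ (v k))) +
        (sq T (D T eZ (D T (eH k) (v k))) + sq T (D T (eH k) (D T eZ (v k))))) := by
        simp only [Fin.sum_univ_two]; ring
    _ ≤ _ := by
        refine Finset.sum_le_sum fun k _ => ?_
        have hk : eS k.castSucc = eH k := by fin_cases k <;> rfl
        have := sum_sum_ge (fun i j => sq T (D T (eS j) (D T (eS i) (v k)))) k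
        simp only [hk] at this
        exact le_trans this le_add_self

/-! ### Assembly -/

lemma normE0_congr {ι : Type} [Fintype ι] {f g : ι → Field} (h : ∀ k, f k =ᵐ[mu T] g k) :
    normE0 T f = normE0 T g := by
  unfold normE0
  congr 1
  exact Finset.sum_congr rfl fun k _ => sq_congr (h k)

/-- Minkowski's inequality keeps the constant one in front of the `δ`-part; the crude passage from
the Euclidean norm to the sum affects only `N`. -/
lemma normE0_add_smul_le {N B : Fin 3 → Field} (hN : ∀ k, AEStronglyMeasurable (N k) (mu T))
    (hB : ∀ k, AEStronglyMeasurable (B k) (mu T)) {δ : ℝ} (hδ : 0 ≤ δ) :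
    normE0 T (fun k p => N k p + δ * B k p) ≤
      ∑ k, eLpNorm (N k) 2 (mu T) + ENNReal.ofReal δ * normE0 T B := by
  set x : Fin 3 → ℝ≥0∞ := fun k => eLpNorm (N k) 2 (mu T) with hx
  set y : Fin 3 → ℝ≥0∞ := fun k => ENNReal.ofReal δ * eLpNorm (B k) 2 (mu T) with hy
  have h1 : ∀ k, eLpNorm (fun p => N k p + δ * B k p) 2 (mu T) ≤ x k + y k := by
    intro k
    have e : (fun p => N k p + δ * B k p) = N k + δ • B k := by ext p; simp
    rw [e]
    refine (eLpNorm_add_le (hN k) ((hB k).const_smul δ) (by norm_num)).trans ?_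
    rw [eLpNorm_const_smul, Real.enorm_of_nonneg hδ]
  have h2 : normE0 T (fun k p => N k p + δ * B k p) ≤
      (∑ k, (x k + y k) ^ (2 : ℝ)) ^ (1 / 2 : ℝ) := by
    refine ENNReal.rpow_le_rpow (Finset.sum_le_sum fun k _ => ?_) (by norm_num)
    rw [sq, ENNReal.rpow_two]
    exact pow_le_pow_left₀ zero_le (h1 k) 2
  refine h2.trans ((ENNReal.Lp_add_le Finset.univ x y one_le_two).trans (add_le_add ?_ ?_))
  · refine enn_le_of_sq_le ?_
    rw [enn_sq_rpow_half]
    simp only [ENNReal.rpow_two, Fin.sum_univ_three]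
    calc x 0 ^ 2 + x 1 ^ 2 + x 2 ^ 2 ≤ x 0 ^ 2 + x 1 ^ 2 + x 2 ^ 2 +
          2 * (x 0 * x 1 + x 0 * x 2 + x 1 * x 2) := le_self_add
      _ = _ := by ring
  · refine enn_le_of_sq_le (le_of_eq ?_)
    rw [mul_pow, normE0, enn_sq_rpow_half, enn_sq_rpow_half, Finset.mul_sum]
    refine Finset.sum_congr rfl fun k _ => ?_
    rw [ENNReal.rpow_two, hy, mul_pow, sq]

lemma memLp_of_normE0 {ι : Type} [Fintype ι] {f : ι → Field}
    (hf : ∀ k, AEStronglyMeasurable (f k) (mu T)) (h : normE0 T f < ⊤) (k : ι) :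
    MemLp (f k) 2 (mu T) := by
  refine ⟨hf k, ?_⟩
  have h1 : sq T (f k) ≤ normE0 T f ^ 2 := by
    rw [normE0, enn_sq_rpow_half]
    exact le_sum_of_le k le_rfl
  exact lt_of_le_of_lt (enn_le_of_sq_le h1) h

/-- `D` selects a representative of the weak derivative, so homogeneity is known only almost
everywhere. -/
lemma adv_const_mul {a : Fin 3 → Field} {f : Field} (hf : ∀ i, Diffble T (eS i) f) (ε : ℝ) :
    adv T a (fun q => ε * f q) =ᵐ[mu T] fun p => ε * adv T a f p := by
  have h := ae_all_iff.2 fun i => (HasWeakDeriv.const_mul (hf i) ε).D_ae_eq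
  filter_upwards [h] with p hp
  simp only [adv, Finset.mul_sum]
  refine Finset.sum_congr rfl fun i _ => ?_
  rw [hp i]; ring

lemma eLpNorm_const_mul_le {f : Field} {ε : ℝ} (h0 : 0 ≤ ε) :
    eLpNorm (fun p => ε * f p) 2 (mu T) = ENNReal.ofReal ε * eLpNorm f 2 (mu T) := by
  have := eLpNorm_const_smul ε f 2 (mu T)
  rw [Real.enorm_of_nonneg h0] at this
  exact this

end HydroDiff

end

theorem proposition6p6 (T : ℝ) (hT : 0 < T) :
    ∃ C : ℝ, 0 < C ∧
      ∀ (ε δ : ℝ), 0 < ε → ε ≤ 1 → 0 < δ →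
      ∀ (V : Fin 2 → Field) (W : Field) (v : Fin 2 → Field),
        (∀ k, MemEHz T (vec V W k)) →
        (∀ k, EvenZ T (V k)) → OddZ T W → DivEpsFree T ε V W →
        (∀ k, MemE1 T (vec v (vertVel T v) k)) →
        (∀ k, MemE0 T (vec (FH T ε δ v V W) (Fz T ε δ v V W) k)) ∧
        normE0 T (vec (FH T ε δ v V W) (Fz T ε δ v V W)) ≤
          ENNReal.ofReal C *
            (normEHz T (vec V W) ^ 2
              + normEHz T (vec V W) * normE1 T (vec v (vertVel T v))
              + ENNReal.ofReal ε *
                (normE1 T ![vertVel T v] + normE1 T (vec v (vertVel T v)) ^ 2))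
          + ENNReal.ofReal δ * normE1 T v := by
  -- This is `6 κ` with `κ = 24 * embConst T`, the constant of a single advection term.
  refine ⟨144 * (24 * (T⁻¹ + 2)), by positivity, ?_⟩
  intro ε δ hε hε1 hδ V W v hU _ hodd hdiv hu
  set w := vertVel T v with hw
  set n := normEHz T (vec V W) with hn
  set m := normE1 T (vec v w) with hm
  set r := normE1 T ![w] with hr
  have cV : ∀ k : Fin 2, Controlled T n (V k) := fun k => by
    have := controlled_of_memEHz hT k.castSucc (hU k.castSucc)
    fin_cases k <;> exact this
  have cW : Controlled T n W := controlled_of_memEHz hT 2 (hU 2)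
  have hv : ∀ k : Fin 2, MemE1 T (v k) := fun k => by
    have := hu k.castSucc
    fin_cases k <;> exact this
  have cv : ∀ k : Fin 2, Controlled T m (v k) := fun k => by
    have := controlled_of_memE1 hT k.castSucc (hu k.castSucc)
    fin_cases k <;> exact this
  have hw1 : MemE1 T w := hu 2
  have cw : Controlled T m w := controlled_of_memE1 hT 2 (hu 2)
  have aU : ∀ i, Advects T n (scaled ε V W i) := fun i => by
    fin_cases i
    · exact (cV 0).advects
    · exact (cV 1).advects
    · exact advects_inv_mul (cV 0) (cV 1) cW hodd hdiv
  have au : ∀ i, Advects T m (vec v w i) := fun i => by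
    fin_cases i
    · exact (cv 0).advects
    · exact (cv 1).advects
    · exact cw.advects
  set a := scaled ε V W with ha
  set b := vec v w with hb
  set κ := 24 * embConst T with hκ
  have b1 := fun k => eLpNorm_adv_le aU (cv k)
  have b2 := fun k => eLpNorm_adv_le au (cV k)
  have b3 := fun k => eLpNorm_adv_le aU (cV k)
  have b4 := eLpNorm_adv_le aU cw
  have b5 := eLpNorm_adv_le au cW
  have b6 := eLpNorm_adv_le aU cW
  have b7 := eLpNorm_adv_le au cw
  -- The right-hand side is split as `N + δ B`, with `B` collecting the second vertical derivatives
  -- and `R` the part of the bracket multiplied by `ε` that is free of `δ`.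
  set NH : Fin 2 → Field := fun k => -adv T a (v k) - adv T b (V k) - adv T a (V k) with hNH
  set R : Field := D T eT w - adv T b w + D T eX (D T eX w) + D T eY (D T eY w) with hR
  set Nz : Field := -(fun p => ε * adv T a w p) - adv T b W - adv T a W - (fun p => ε * R p) with hNz
  set BH : Fin 2 → Field := fun k => D T eZ (D T eZ (v k)) with hBH
  set Bz : Field := fun p => -ε * D T eZ (D T eZ w) p with hBz
  have mT := hw1.time.2.1.1
  have mX : AEStronglyMeasurable (D T eX (D T eX w)) (mu T) := (hw1.second 0 0).1.2.1.1
  have mY : AEStronglyMeasurable (D T eY (D T eY w)) (mu T) := (hw1.second 1 1).1.2.1.1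
  have mZ : AEStronglyMeasurable (D T eZ (D T eZ w)) (mu T) := (hw1.second 2 2).1.2.1.1
  have mNH : ∀ k, AEStronglyMeasurable (NH k) (mu T) := fun k =>
    ((b1 k).1.neg.sub (b2 k).1).sub (b3 k).1
  have mR : AEStronglyMeasurable R (mu T) := ((mT.sub b7.1).add mX).add mY
  have mNz : AEStronglyMeasurable Nz (mu T) :=
    (((b4.1.const_mul ε).neg.sub b5.1).sub b6.1).sub (mR.const_mul ε)
  have mN : ∀ k, AEStronglyMeasurable (vec NH Nz k) (mu T) := fun k => by
    fin_cases k
    · exact mNH 0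
    · exact mNH 1
    · exact mNz
  have mB : ∀ k, AEStronglyMeasurable (vec BH Bz k) (mu T) := fun k => by
    fin_cases k
    · exact ((hv 0).second 2 2).1.2.1.1
    · exact ((hv 1).second 2 2).1.2.1.1
    · exact mZ.const_mul _
  have eqF : ∀ k, vec (FH T ε δ v V W) (Fz T ε δ v V W) k =ᵐ[mu T]
      fun p => vec NH Nz k p + δ * vec BH Bz k p := fun k => by
    fin_cases k
    · exact ae_eq_refl _
    · exact ae_eq_refl _
    · change Fz T ε δ v V W =ᵐ[mu T] fun p => Nz p + δ * Bz p
      filter_upwards [adv_const_mul (a := a) cw.diffble ε] with p hp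
      simp only [Fz, lapl, hNz, hBz, hR, ← hw, ← ha, ← hb, hp, Pi.sub_apply, Pi.neg_apply,
        Pi.add_apply]
      ring
  have nNH : ∀ k, eLpNorm (NH k) 2 (mu T) ≤ κ * (n * m) + κ * (m * n) + κ * (n * n) := fun k => by
    refine (eLpNorm_sub_le ((b1 k).1.neg.sub (b2 k).1) (b3 k).1 (by norm_num)).trans ?_
    refine add_le_add ((eLpNorm_sub_le (b1 k).1.neg (b2 k).1 (by norm_num)).trans
      (add_le_add ?_ (b2 k).2)) (b3 k).2
    rw [eLpNorm_neg]
    exact (b1 k).2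
  have leT : eLpNorm (D T eT w) 2 (mu T) ≤ r :=
    (enn_le_of_sq_le (sq_D_eT_le_normH1L2 (T := T) ![w] 0)).trans le_add_self
  have leS : ∀ i, eLpNorm (D T (eS i) (D T (eS i) w)) 2 (mu T) ≤ r := fun i =>
    (enn_le_of_sq_le (sq_second_le_normL2H2 (T := T) ![w] 0 i i)).trans le_self_add
  have nR : eLpNorm R 2 (mu T) ≤ r + κ * (m * m) + r + r := by
    refine (eLpNorm_add_le ((mT.sub b7.1).add mX) mY (by norm_num)).trans (add_le_add ?_ (leS 1))
    refine (eLpNorm_add_le (mT.sub b7.1) mX (by norm_num)).trans (add_le_add ?_ (leS 0))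
    exact (eLpNorm_sub_le mT b7.1 (by norm_num)).trans (add_le_add leT b7.2)
  set e := ENNReal.ofReal ε with he
  -- Used to absorb the factor `ε` of `(V, W/ε) · ∇(ε w)`, so that this term is counted with `n *
  -- m`.
  have he1 : e ≤ 1 := ENNReal.ofReal_le_one.2 hε1
  have nNz : eLpNorm Nz 2 (mu T) ≤ e * (κ * (n * m)) + κ * (m * n) + κ * (n * n) +
      e * (r + κ * (m * m) + r + r) := by
    refine (eLpNorm_sub_le (((b4.1.const_mul ε).neg.sub b5.1).sub b6.1) (mR.const_mul ε)
      (by norm_num)).trans (add_le_add ?_ ?_)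
    · refine (eLpNorm_sub_le ((b4.1.const_mul ε).neg.sub b5.1) b6.1 (by norm_num)).trans
        (add_le_add ?_ b6.2)
      refine (eLpNorm_sub_le (b4.1.const_mul ε).neg b5.1 (by norm_num)).trans (add_le_add ?_ b5.2)
      rw [eLpNorm_neg, eLpNorm_const_mul_le hε.le]
      exact mul_le_mul_right b4.2 _
    · rw [eLpNorm_const_mul_le hε.le]
      exact mul_le_mul_right nR _
  have hκ1 : 1 ≤ κ := by
    calc (1 : ENNReal) = 1 * 1 := (one_mul 1).symm
      _ ≤ κ := mul_le_mul' (by norm_num) one_le_embConst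
  have hC : ENNReal.ofReal (144 * (24 * (T⁻¹ + 2))) = 6 * κ := by
    have hTi : 0 ≤ T⁻¹ := by positivity
    rw [ENNReal.ofReal_mul (by norm_num), ENNReal.ofReal_mul (by norm_num),
      ENNReal.ofReal_add hTi (by norm_num), hκ, embConst]
    norm_num
    ring
  have main : normE0 T (vec (FH T ε δ v V W) (Fz T ε δ v V W)) ≤
      ENNReal.ofReal (144 * (24 * (T⁻¹ + 2))) * (n ^ 2 + n * m + e * (r + m ^ 2)) +
        ENNReal.ofReal δ * normE1 T v := by
    rw [normE0_congr eqF, hC]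
    refine (normE0_add_smul_le mN mB hδ.le).trans (add_le_add ?_
      (mul_le_mul_right (normE0_vert_le hv hw1 hε hε1) _))
    rw [Fin.sum_univ_three]
    calc _ ≤ (κ * (n * m) + κ * (m * n) + κ * (n * n)) + (κ * (n * m) + κ * (m * n) + κ * (n * n)) +
          (e * (κ * (n * m)) + κ * (m * n) + κ * (n * n) + e * (r + κ * (m * m) + r + r)) :=
          add_le_add (add_le_add (nNH 0) (nNH 1)) nNz
      _ ≤ (κ * (n * m) + κ * (m * n) + κ * (n * n)) + (κ * (n * m) + κ * (m * n) + κ * (n * n)) +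
          (1 * (κ * (n * m)) + κ * (m * n) + κ * (n * n) +
            e * (κ * r + κ * (m * m) + κ * r + κ * r)) := by
          have : r ≤ κ * r := by
            calc r = 1 * r := (one_mul r).symm
              _ ≤ κ * r := by gcongr
          gcongr
      -- The product `n * m` already occurs six times; the added terms bring `n ^ 2`, `e * r` and `e
      -- * m ^ 2` up to six copies as well.
      _ ≤ (κ * (n * m) + κ * (m * n) + κ * (n * n)) + (κ * (n * m) + κ * (m * n) + κ * (n * n)) +
          (1 * (κ * (n * m)) + κ * (m * n) + κ * (n * n) +
            e * (κ * r + κ * (m * m) + κ * r + κ * r)) +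
          (3 * (κ * (n * n)) + e * (3 * (κ * r) + 5 * (κ * (m * m)))) := le_self_add
      _ = 6 * κ * (n ^ 2 + n * m + e * (r + m ^ 2)) := by ring
  -- Membership in `𝔼₀` follows from the estimate, whose right-hand side is finite.
  refine ⟨memLp_of_normE0 (fun k => ?_) (lt_of_le_of_lt main ?_), main⟩
  · exact ((mN k).add ((mB k).const_mul δ)).congr (eqF k).symm
  · have tn : n < ⊤ := normEHz_lt_top hU
    have tm : m < ⊤ := normE1_lt_top hu
    have tr : r < ⊤ := normE1_lt_top fun k => by fin_cases k; exact hw1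
    have tv : normE1 T v < ⊤ := normE1_lt_top hv
    refine ENNReal.add_lt_top.2 ⟨ENNReal.mul_lt_top ENNReal.ofReal_lt_top (ENNReal.add_lt_top.2
      ⟨ENNReal.add_lt_top.2 ⟨ENNReal.pow_lt_top tn, ENNReal.mul_lt_top tn tm⟩,
        ENNReal.mul_lt_top ENNReal.ofReal_lt_top (ENNReal.add_lt_top.2
          ⟨tr, ENNReal.pow_lt_top tm⟩)⟩), ENNReal.mul_lt_top ENNReal.ofReal_lt_top tv⟩
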